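/- Let $(\mathcal V,\otimes,e)$ be a closed symmetric monoidal Grothendieck category, $\mathcal C$ a small $\mathcal V$-category and $\mathcal A\subset\mathcal C$ a set of objects, regarded as a full $\mathcal V$-subcategory. Let $[\mathcal C,\mathcal V]$ be the Grothendieck category of $\mathcal V$-functors $\mathcal C\to\mathcal V$ and $\mathcal V$-natural transformations, and $\mathrm D[\mathcal C,\mathcal V]$ its derived category. Suppose that $\mathrm D(\mathcal V)$ is compactly generated by a set $\{P_j\}_{j\in J}$ of compact generators, and that $\{Q_j\}_{j\in J}$ are complexes in $\mathcal V$ for which one of the following holds: 1. each $P_j$ is K-projective, and $Q_j=P_j$; 2. for every K-injective complex $Y$ in $[\mathcal C,\mathcal V]$ and every $c\in\mathcal C$ the complex $Y(c)$ is K-injective, and $Q_j=P_j$; 3. $\mathrm{Ch}(\mathcal V)$ has a model structure whose weak equivalences are the quasi-isomorphisms, such that $Y(c)$ is fibrant for every injective fibrant complex $Y$ in $[\mathcal C,\mathcal V]$ and every $c\in\mathcal C$; $Q_j$ is a cofibrant replacement of $P_j$ (a cofibrant complex with a quasi-isomorphism $Q_j\to P_j$); and every chain map from $Q_j$ to a fibrant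 complex that becomes zero in $\mathrm D(\mathcal V)$ is null-homotopic. (Injective fibrant means: having the extension property with respect to monomorphisms of complexes that are quasi-isomorphisms.) Put $\mathcal S_{\mathcal A}=\{F\in[\mathcal C,\mathcal V]\mid F(a)=0 \text{ for all } a\in\mathcal A\}$ and $\mathcal E_{\mathcal A}=\{Y\in \mathrm D[\mathcal C,\mathcal V]\mid H_n(Y(a))=0\text{ for all }a\in\mathcal A,\ n\in\mathbb Z\}$. Let $r:[\mathcal C,\mathcal V]\to[\mathcal A,\mathcal V]$ be restriction and $\ell:[\mathcal C,\mathcal V]\to[\mathcal C,\mathcal V]/\mathcal S_{\mathcal A}$ the $\mathcal S_{\mathcal A}$-localization functor, both of which are exact; let $\rho:\mathrm D[\mathcal C,\mathcal V]\to\mathrm D[\mathcal A,\mathcal V]$ and $\lambda:\mathrm D[\mathcal C,\mathcal V]\to\mathrm D([\mathcal C,\mathcal V]/\mathcal S_{\mathcal A})$ be the functors that apply $r$ and $\ell$ degreewise, and $\iota:\mathcal E_{\mathcal A}\to\mathrm D[\mathcal C,\mathcal V]$ and $\tau_L:\mathcal T_{\mathcal A}\to\mathrm D[\mathcal C,\mathcal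 V]$ the inclusions, where $\mathcal T_{\mathcal A}$ is the smallest localizing subcategory of $\mathrm D[\mathcal C,\mathcal V]$ containing all complexes $\mathcal V_{\mathcal C}(a,-)\oslash Q_j$, with value $\mathcal V_{\mathcal C}(a,d)\otimes Q_j$ at $d\in\mathcal C$, for $a\in\mathcal A$ and $j\in J$. Then $r$ has a left adjoint $r_L$ (the enriched left Kan extension), $\varkappa=\ell\circ r_L:[\mathcal A,\mathcal V]\to[\mathcal C,\mathcal V]/\mathcal S_{\mathcal A}$ is an equivalence, and $\ell$ has a fully faithful additive right adjoint $\ell_R$, the inclusion of the $\mathcal S_{\mathcal A}$-local objects. Moreover $F=\rho\circ\tau_L:\mathcal T_{\mathcal A}\to\mathrm D[\mathcal A,\mathcal V]$ is an equivalence, and there are recollements of triangulated categories $$\mathcal E_{\mathcal A}\xrightarrow{\ \iota\ }\mathrm D[\mathcal C,\mathcal V]\xrightarrow{\ \rho\ }\mathrm D[\mathcal A,\mathcal V],\qquad \mathcal E_{\mathcal A}\xrightarrow{\ \iota\ }\mathrm D[\mathcal C,\mathcal V]\xrightarrow{\ \lambda\ }\mathrm D([\mathcal C,\mathcal V]/\mathcal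 S_{\mathcal A})$$ with the same adjoints $\iota_L\dashv\iota\dashv\iota_R$. Here, for a recollement with middle functors $\iota$ and $\lambda$, all functors in the adjunctions $\iota_L\dashv\iota\dashv\iota_R$ and $\lambda_L\dashv\lambda\dashv\lambda_R$ are triangulated, $\iota,\lambda_L,\lambda_R$ are fully faithful, and the essential image of $\iota$ is the kernel of $\lambda$; the adjoints of $\rho$ in the first recollement are written $\rho_L,\rho_R$. The left adjoints satisfy $$\rho_L\cong\tau_L\circ F^{-1},\qquad \lambda_L\cong\rho_L\circ\varkappa^{-1},$$ where $\varkappa^{-1}$ is applied degreewise. The right adjoint $\lambda_R$ is $Y\mapsto\ell_R(kY)$, where $kY$ is a K-injective resolution of $Y$ in $[\mathcal C,\mathcal V]/\mathcal S_{\mathcal A}$ and $\ell_R$ is applied degreewise; such functorial resolutions exist, and any choice of them gives $\lambda_R$ up to isomorphism. -/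

import Mathlib

universe w w₁ w₂ w₃ w₄ v u

namespace EnrRec

open CategoryTheory Limits MonoidalCategory MonoidalClosed

lemma uncurry_tensor_comp {V : Type u} [Category.{v} V] [MonoidalCategory V] [MonoidalClosed V]
    {P Q X Y Z : V} (f : P ⟶ (ihom X).obj Y) (g : Q ⟶ (ihom Y).obj Z) :
    uncurry ((f ⊗ₘ g) ≫ comp X Y Z) = (α_ _ _ _).inv ≫ uncurry f ▷ Q ≫ uncurry g := by
  rw [uncurry_natural_left, comp_eq, uncurry_curry, compTranspose_eq, MonoidalCategory.tensorHom_def,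
    uncurry_eq f, uncurry_eq g, MonoidalCategory.whiskerLeft_comp, Category.assoc,
    associator_inv_naturality_right_assoc, whisker_exchange_assoc,
    associator_inv_naturality_middle_assoc, comp_whiskerRight, Category.assoc]
  rfl

section EnrichedFunctors

variable (V : Type u) [Category.{v} V] [MonoidalCategory V] [MonoidalClosed V]
  (C : Type w) [EnrichedCategory V C]

/-- The objects of the category `[C, V]`: the `V`-enriched functors from `C` to `V`, where `V` is
enriched over itself by its internal hom. (Mathlib's category structure on `EnrichedFunctor` only
asks transformations to be natural for the underlying functors; the wrapper is there in order to
equip the enriched functors with the `V`-natural transformations instead.) -/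
structure EnrFun where
  /-- the underlying enriched functor -/
  toEnriched : EnrichedFunctor V C V

namespace EnrFun

variable {V C}

/-- The value `F(c)`. -/
def obj (F : EnrFun V C) (c : C) : V := F.toEnriched.obj c

/-- The structure morphism `V_C(c, d) ⟶ [F(c), F(d)]`. -/
def map (F : EnrFun V C) (c d : C) : (c ⟶[V] d) ⟶ (ihom (F.obj c)).obj (F.obj d) :=
  F.toEnriched.map c d

/-- The action `F(c) ⊗ V_C(c, d) ⟶ F(d)` adjoint to the structure morphism. -/
def act (F : EnrFun V C) (c d : C) : F.obj c ⊗ (c ⟶[V] d) ⟶ F.obj d :=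
  uncurry (F.map c d)

lemma act_id (F : EnrFun V C) (c : C) :
    (ρ_ (F.obj c)).inv ≫ F.obj c ◁ eId V c ≫ F.act c c = 𝟙 _ := by
  have h := F.toEnriched.map_id c
  have h2 : uncurry (eId V c ≫ F.map c c) = (ρ_ (F.obj c)).hom := by
    erw [h]
    exact uncurry_curry _
  rw [uncurry_natural_left] at h2
  rw [act, h2, Iso.inv_hom_id]

lemma act_comp (F : EnrFun V C) (b c d : C) :
    F.obj b ◁ eComp V b c d ≫ F.act b d =
      (α_ _ _ _).inv ≫ F.act b c ▷ _ ≫ F.act c d := by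
  have h : eComp V b c d ≫ F.map b d = (F.map b c ⊗ₘ F.map c d) ≫
    MonoidalClosed.comp (F.obj b) (F.obj c) (F.obj d) := F.toEnriched.map_comp b c d
  rw [act, ← uncurry_natural_left, h, uncurry_tensor_comp]
  rfl

/-- An enriched functor with values in `V`, given by an associative and unital action. -/
def mk' (X : C → V) (act : ∀ c d, X c ⊗ (c ⟶[V] d) ⟶ X d)
    (act_id : ∀ c, (ρ_ (X c)).inv ≫ X c ◁ eId V c ≫ act c c = 𝟙 _)
    (act_comp : ∀ b c d, X b ◁ eComp V b c d ≫ act b d =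
      (α_ _ _ _).inv ≫ act b c ▷ _ ≫ act c d) : EnrFun V C where
  toEnriched :=
    { obj := X
      map c d := curry (act c d)
      map_id c := by
        apply uncurry_injective
        rw [uncurry_natural_left, uncurry_curry]
        erw [uncurry_curry (A := X c) (ρ_ (X c)).hom]
        rw [← cancel_epi (ρ_ (X c)).inv, act_id, Iso.inv_hom_id]
      map_comp b c d := by
        apply uncurry_injective
        rw [uncurry_natural_left, uncurry_curry, act_comp]
        exact Eq.trans (by rw [uncurry_curry, uncurry_curry])
          (uncurry_tensor_comp (curry (act b c)) (curry (act c d))).symm }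

@[simp] lemma mk'_act (X : C → V) (act : ∀ c d, X c ⊗ (c ⟶[V] d) ⟶ X d) (h₁ h₂) (c d : C) :
    (mk' X act h₁ h₂).act c d = act c d := uncurry_curry _

/-- The `V`-natural transformations: for all `c, d` the two morphisms
`V_C(c, d) ⟶ [F(c), G(d)]` agree. -/
@[ext]
structure Hom (F G : EnrFun V C) where
  /-- the components -/
  app (c : C) : F.obj c ⟶ G.obj c
  naturality (c d : C) :
    F.map c d ≫ (ihom (F.obj c)).map (app d) = G.map c d ≫ (pre (app c)).app (G.obj d)

lemma natural_iff (F G : EnrFun V C) {c d : C} (f : F.obj c ⟶ G.obj c) (g : F.obj d ⟶ G.obj d) :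
    F.map c d ≫ (ihom (F.obj c)).map g = G.map c d ≫ (pre f).app (G.obj d) ↔
      F.act c d ≫ g = f ▷ _ ≫ G.act c d := by
  rw [← uncurry_injective.eq_iff, uncurry_natural_right, uncurry_pre_app]
  rfl

lemma Hom.act_app {F G : EnrFun V C} (φ : Hom F G) (c d : C) :
    F.act c d ≫ φ.app d = φ.app c ▷ _ ≫ G.act c d :=
  (natural_iff F G _ _).1 (φ.naturality c d)

/-- A `V`-natural transformation, given by components that commute with the actions. -/
def Hom.mk' {F G : EnrFun V C} (app : ∀ c, F.obj c ⟶ G.obj c)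
    (h : ∀ c d, F.act c d ≫ app d = app c ▷ _ ≫ G.act c d) : Hom F G where
  app := app
  naturality c d := (natural_iff F G _ _).2 (h c d)

/-- The category `[C, V]` of enriched functors and `V`-natural transformations. -/
instance : Category (EnrFun V C) where
  Hom := Hom
  id F := Hom.mk' (fun _ => 𝟙 _) (by simp)
  comp φ ψ := Hom.mk' (fun c => φ.app c ≫ ψ.app c) (fun c d => by
    rw [← Category.assoc, φ.act_app, Category.assoc, ψ.act_app, comp_whiskerRight, Category.assoc])
  id_comp _ := Hom.ext (funext fun _ => Category.id_comp _)
  comp_id _ := Hom.ext (funext fun _ => Category.comp_id _)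
  assoc _ _ _ := Hom.ext (funext fun _ => Category.assoc _ _ _)

@[ext] lemma hom_ext {F G : EnrFun V C} {φ ψ : F ⟶ G} (h : ∀ c, φ.app c = ψ.app c) : φ = ψ :=
  Hom.ext (funext h)

variable (V) in
/-- Evaluation at `c`. -/
def ev (c : C) : EnrFun V C ⥤ V where
  obj F := F.obj c
  map φ := φ.app c

@[simp] lemma ev_obj (c : C) (F : EnrFun V C) : (ev V c).obj F = F.obj c := rfl
@[simp] lemma ev_map (c : C) {F G : EnrFun V C} (φ : F ⟶ G) : (ev V c).map φ = φ.app c := rfl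

lemma isIso_of_app {F G : EnrFun V C} (φ : F ⟶ G) [∀ c, IsIso (φ.app c)] : IsIso φ := by
  refine ⟨Hom.mk' (fun c => inv (φ.app c)) (fun c d => ?_), ?_, ?_⟩
  · rw [IsIso.comp_inv_eq, Category.assoc, φ.act_app, ← Category.assoc, ← comp_whiskerRight]
    simp
  · ext c; exact IsIso.hom_inv_id _
  · ext c; exact IsIso.inv_hom_id _


section Limits

lemma lift_compat {T S K : EnrFun V C} {c d : C} (lc : T.obj c ⟶ S.obj c) (ld : T.obj d ⟶ S.obj d)
    (p : Hom S K) (q : Hom T K) (hc : lc ≫ p.app c = q.app c) (hd : ld ≫ p.app d = q.app d) :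
    (T.act c d ≫ ld) ≫ p.app d = (lc ▷ _ ≫ S.act c d) ≫ p.app d := by
  rw [Category.assoc, hd, q.act_app, Category.assoc, p.act_app, ← comp_whiskerRight_assoc, hc]

lemma desc_compat {K S T : EnrFun V C} {c d : C} (lc : S.obj c ⟶ T.obj c) (ld : S.obj d ⟶ T.obj d)
    (p : Hom K S) (q : Hom K T) (hc : p.app c ≫ lc = q.app c) (hd : p.app d ≫ ld = q.app d) :
    p.app c ▷ _ ≫ (S.act c d ≫ ld) = p.app c ▷ _ ≫ (lc ▷ _ ≫ T.act c d) := by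
  rw [← comp_whiskerRight_assoc, hc, ← q.act_app, ← hd, ← Category.assoc, ← Category.assoc,
    p.act_app]

variable {J : Type w₁}

/-- An action on a jointly monic family of sources. -/
def ofJointlyMono (F : J → EnrFun V C) (L : C → V) (p : ∀ c j, L c ⟶ (F j).obj c)
    (hp : ∀ (c : C) {Z : V} (f g : Z ⟶ L c), (∀ j, f ≫ p c j = g ≫ p c j) → f = g)
    (a : ∀ c d, L c ⊗ (c ⟶[V] d) ⟶ L d)
    (ha : ∀ c d j, a c d ≫ p d j = p c j ▷ _ ≫ (F j).act c d) : EnrFun V C :=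
  mk' L a
    (fun c => hp c _ _ (fun j => by
      rw [Category.assoc, Category.assoc, ha, whisker_exchange_assoc,
        ← rightUnitor_inv_naturality_assoc, (F j).act_id, Category.comp_id, Category.id_comp]))
    (fun b c d => hp d _ _ (fun j => by
      rw [Category.assoc, ha, whisker_exchange_assoc, (F j).act_comp, Category.assoc,
        Category.assoc, ha, ← comp_whiskerRight_assoc, ha]
      simp))

/-- An action on a jointly epic family of targets. -/
def ofJointlyEpi (F : J → EnrFun V C) (L : C → V) (q : ∀ c j, (F j).obj c ⟶ L c)
    (hq : ∀ (c : C) {Z : V} (f g : L c ⟶ Z), (∀ j, q c j ≫ f = q c j ≫ g) → f = g)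
    (hq' : ∀ (c : C) {X Z : V} (f g : L c ⊗ X ⟶ Z),
      (∀ j, q c j ▷ X ≫ f = q c j ▷ X ≫ g) → f = g)
    (a : ∀ c d, L c ⊗ (c ⟶[V] d) ⟶ L d)
    (ha : ∀ c d j, q c j ▷ _ ≫ a c d = (F j).act c d ≫ q d j) : EnrFun V C :=
  mk' L a
    (fun c => hq c _ _ (fun j => by
      rw [rightUnitor_inv_naturality_assoc, ← whisker_exchange_assoc, ha, ← Category.assoc,
        ← Category.assoc, Category.assoc _ _ ((F j).act c c), (F j).act_id, Category.comp_id,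
        Category.id_comp]))
    (fun b c d => hq' b _ _ (fun j => by
      rw [← whisker_exchange_assoc, ha, ← Category.assoc, (F j).act_comp,
        associator_inv_naturality_left_assoc, ← comp_whiskerRight_assoc, ha, comp_whiskerRight,
        Category.assoc, Category.assoc, Category.assoc, ha]))

variable [Category.{w₂} J]

/-- Limits in `[C, V]` are detected pointwise. -/
def isLimitOfEv {K : J ⥤ EnrFun V C} (s : Cone K)
    (h : ∀ c, IsLimit ((ev V c).mapCone s)) : IsLimit s where
  lift t := Hom.mk' (fun c => (h c).lift ((ev V c).mapCone t)) (fun c d =>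
    (h d).hom_ext (fun j => lift_compat _ _ (s.π.app j) (t.π.app j)
      ((h c).fac ((ev V c).mapCone t) j) ((h d).fac ((ev V d).mapCone t) j)))
  fac t j := by ext c; exact (h c).fac ((ev V c).mapCone t) j
  uniq t m hm := by
    ext c
    exact (h c).uniq ((ev V c).mapCone t) (m.app c) (fun j => congrArg (fun φ => Hom.app φ c) (hm j))

/-- Colimits in `[C, V]` are detected pointwise, when the tensor product preserves them. -/
def isColimitOfEv [∀ X : V, PreservesColimitsOfShape J (tensorRight X)]
    {K : J ⥤ EnrFun V C} (s : Cocone K)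
    (h : ∀ c, IsColimit ((ev V c).mapCocone s)) : IsColimit s where
  desc t := Hom.mk' (fun c => (h c).desc ((ev V c).mapCocone t)) (fun c d =>
    (isColimitOfPreserves (tensorRight (c ⟶[V] d)) (h c)).hom_ext
      (fun j => desc_compat _ _ (s.ι.app j) (t.ι.app j)
        ((h c).fac ((ev V c).mapCocone t) j) ((h d).fac ((ev V d).mapCocone t) j)))
  fac t j := by ext c; exact (h c).fac ((ev V c).mapCocone t) j
  uniq t m hm := by
    ext c
    exact (h c).uniq ((ev V c).mapCocone t) (m.app c)
      (fun j => congrArg (fun φ => Hom.app φ c) (hm j))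

section

variable [HasLimitsOfShape J V] (K : J ⥤ EnrFun V C)

/-- Projections of the pointwise limit. -/
noncomputable def limπ (c : C) (j : J) : limit (K ⋙ ev V c) ⟶ (K.obj j).obj c :=
  limit.π (K ⋙ ev V c) j

lemma limπ_w (c : C) {i j : J} (f : i ⟶ j) : limπ K c i ≫ Hom.app (K.map f) c = limπ K c j :=
  limit.w (K ⋙ ev V c) f

/-- The action on the pointwise limit. -/
noncomputable def limAct (c d : C) :
    limit (K ⋙ ev V c) ⊗ (c ⟶[V] d) ⟶ limit (K ⋙ ev V d) :=
  limit.lift (K ⋙ ev V d)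
    { pt := limit (K ⋙ ev V c) ⊗ (c ⟶[V] d)
      π :=
        { app j := limπ K c j ▷ _ ≫ (K.obj j).act c d
          naturality i j f := by
            refine (Category.id_comp _).trans ?_
            change _ = (limπ K c i ▷ _ ≫ (K.obj i).act c d) ≫ Hom.app (K.map f) d
            rw [Category.assoc, Hom.act_app, ← comp_whiskerRight_assoc, limπ_w]
            rfl } }

lemma limAct_π (c d : C) (j : J) :
    limAct K c d ≫ limπ K d j = limπ K c j ▷ _ ≫ (K.obj j).act c d :=
  limit.lift_π _ j

/-- The object of the pointwise limit. -/
noncomputable def limObj : EnrFun V C :=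
  ofJointlyMono (fun j => K.obj j) (fun c => limit (K ⋙ ev V c)) (limπ K)
    (fun _ _ _ _ h => limit.hom_ext h) (limAct K) (limAct_π K)

lemma limObj_act (c d : C) : (limObj K).act c d = limAct K c d := uncurry_curry _

/-- The pointwise limit. -/
noncomputable def limitCone : Cone K where
  pt := limObj K
  π :=
    { app j := Hom.mk' (fun c => limπ K c j) (fun c d => by
        exact (congrArg (· ≫ limπ K d j) (limObj_act K c d)).trans (limAct_π K c d j))
      naturality i j f := by
        ext c
        exact (limit.cone (K ⋙ ev V c)).π.naturality f }

/-- The pointwise limit is a limit. -/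
noncomputable def limitConeIsLimit : IsLimit (limitCone K) :=
  isLimitOfEv _ (fun c => limit.isLimit (K ⋙ ev V c))

end

section

variable [HasColimitsOfShape J V] [∀ X : V, PreservesColimitsOfShape J (tensorRight X)]
  (K : J ⥤ EnrFun V C)

/-- Coprojections of the pointwise colimit. -/
noncomputable def colimι (c : C) (j : J) : (K.obj j).obj c ⟶ colimit (K ⋙ ev V c) :=
  colimit.ι (K ⋙ ev V c) j

lemma colimι_w (c : C) {i j : J} (f : i ⟶ j) :
    Hom.app (K.map f) c ≫ colimι K c j = colimι K c i :=
  colimit.w (K ⋙ ev V c) f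

lemma colim_hom_ext (c : C) {X Z : V} (f g : colimit (K ⋙ ev V c) ⊗ X ⟶ Z)
    (h : ∀ j, colimι K c j ▷ X ≫ f = colimι K c j ▷ X ≫ g) : f = g :=
  (isColimitOfPreserves (tensorRight X) (colimit.isColimit (K ⋙ ev V c))).hom_ext h

/-- The action on the pointwise colimit. -/
noncomputable def colimAct (c d : C) :
    colimit (K ⋙ ev V c) ⊗ (c ⟶[V] d) ⟶ colimit (K ⋙ ev V d) :=
  (isColimitOfPreserves (tensorRight (c ⟶[V] d)) (colimit.isColimit (K ⋙ ev V c))).desc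
    { pt := colimit (K ⋙ ev V d)
      ι :=
        { app j := (K.obj j).act c d ≫ colimι K d j
          naturality i j f := by
            refine Eq.trans ?_ (Category.comp_id _).symm
            change Hom.app (K.map f) c ▷ _ ≫ (K.obj j).act c d ≫ colimι K d j = _
            rw [← Category.assoc, ← Hom.act_app, Category.assoc, colimι_w]
            rfl } }

lemma ι_colimAct (c d : C) (j : J) :
    colimι K c j ▷ _ ≫ colimAct K c d = (K.obj j).act c d ≫ colimι K d j :=
  (isColimitOfPreserves (tensorRight (c ⟶[V] d)) (colimit.isColimit (K ⋙ ev V c))).fac _ j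

/-- The object of the pointwise colimit. -/
noncomputable def colimObj : EnrFun V C :=
  ofJointlyEpi (fun j => K.obj j) (fun c => colimit (K ⋙ ev V c)) (colimι K)
    (fun _ _ _ _ h => colimit.hom_ext h) (fun c _ _ => colim_hom_ext K c) (colimAct K) (ι_colimAct K)

lemma colimObj_act (c d : C) : (colimObj K).act c d = colimAct K c d := uncurry_curry _

/-- The pointwise colimit. -/
noncomputable def colimitCocone : Cocone K where
  pt := colimObj K
  ι :=
    { app j := Hom.mk' (fun c => colimι K c j) (fun c d => by
        exact (ι_colimAct K c d j).symm.trans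
          (congrArg (colimι K c j ▷ (c ⟶[V] d) ≫ ·) (colimObj_act K c d).symm))
      naturality i j f := by
        ext c
        exact (colimit.cocone (K ⋙ ev V c)).ι.naturality f }

/-- The pointwise colimit is a colimit. -/
noncomputable def colimitCoconeIsColimit : IsColimit (colimitCocone K) :=
  isColimitOfEv _ (fun c => colimit.isColimit (K ⋙ ev V c))

end

instance [HasLimitsOfShape J V] : HasLimitsOfShape J (EnrFun V C) where
  has_limit K := ⟨⟨⟨_, limitConeIsLimit K⟩⟩⟩

instance [HasLimitsOfShape J V] (c : C) : PreservesLimitsOfShape J (ev V c : EnrFun V C ⥤ V) where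
  preservesLimit {K} :=
    preservesLimit_of_preserves_limit_cone (limitConeIsLimit K) (limit.isLimit (K ⋙ ev V c))

instance [HasColimitsOfShape J V] [∀ X : V, PreservesColimitsOfShape J (tensorRight X)] :
    HasColimitsOfShape J (EnrFun V C) where
  has_colimit K := ⟨⟨⟨_, colimitCoconeIsColimit K⟩⟩⟩

instance [HasColimitsOfShape J V] [∀ X : V, PreservesColimitsOfShape J (tensorRight X)] (c : C) :
    PreservesColimitsOfShape J (ev V c : EnrFun V C ⥤ V) where
  preservesColimit {K} :=
    preservesColimit_of_preserves_colimit_cocone (colimitCoconeIsColimit K)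
      (colimit.isColimit (K ⋙ ev V c))

end Limits

section Abelian

variable [SymmetricCategory V]

instance (J : Type w₁) [Category.{w₂} J] (X : V) : PreservesColimitsOfShape J (tensorRight X) :=
  preservesColimitsOfShape_of_natIso (BraidedCategory.tensorLeftIsoTensorRight X)

instance [HasFiniteLimits V] : HasFiniteLimits (EnrFun V C) := ⟨fun _ _ _ => inferInstance⟩

instance [HasFiniteLimits V] (c : C) : PreservesFiniteLimits (ev V c : EnrFun V C ⥤ V) :=
  ⟨fun _ _ _ => inferInstance⟩

instance [HasFiniteColimits V] : HasFiniteColimits (EnrFun V C) := ⟨fun _ _ _ => inferInstance⟩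

instance [HasFiniteColimits V] (c : C) : PreservesFiniteColimits (ev V c : EnrFun V C ⥤ V) :=
  ⟨fun _ _ _ => inferInstance⟩

lemma preservesFiniteLimits_of_ev {D : Type*} [Category* D]
    (G : D ⥤ EnrFun V C) (h : ∀ c, PreservesFiniteLimits (G ⋙ ev V c)) :
    PreservesFiniteLimits G where
  preservesFiniteLimits _ _ _ :=
    ⟨fun {_} => ⟨fun hs => ⟨isLimitOfEv _ (fun c => isLimitOfPreserves (G ⋙ ev V c) hs)⟩⟩⟩

lemma preservesFiniteColimits_of_ev {D : Type*} [Category* D]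
    (G : D ⥤ EnrFun V C) (h : ∀ c, PreservesFiniteColimits (G ⋙ ev V c)) :
    PreservesFiniteColimits G where
  preservesFiniteColimits _ _ _ :=
    ⟨fun {_} => ⟨fun hs => ⟨isColimitOfEv _ (fun c => isColimitOfPreserves (G ⋙ ev V c) hs)⟩⟩⟩

variable [Abelian V]

instance (X : V) : (tensorRight X).Additive :=
  have : (tensorRight X).IsLeftAdjoint :=
    Functor.isLeftAdjoint_of_iso (BraidedCategory.tensorLeftIsoTensorRight X)
  have := preservesBinaryBiproducts_of_preservesBinaryCoproducts (tensorRight X)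
  Functor.additive_of_preservesBinaryBiproducts _

lemma add_whiskerRight {X Y : V} (f g : X ⟶ Y) (Z : V) : (f + g) ▷ Z = f ▷ Z + g ▷ Z :=
  (tensorRight Z).map_add

lemma neg_whiskerRight {X Y : V} (f : X ⟶ Y) (Z : V) : (-f) ▷ Z = -(f ▷ Z) :=
  (tensorRight Z).map_neg

lemma zero_whiskerRight (X Y Z : V) : (0 : X ⟶ Y) ▷ Z = 0 :=
  (tensorRight Z).map_zero X Y

instance (F G : EnrFun V C) : Zero (F ⟶ G) :=
  ⟨Hom.mk' (fun _ => 0) (by simp [zero_whiskerRight])⟩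

instance (F G : EnrFun V C) : Add (F ⟶ G) :=
  ⟨fun φ ψ => Hom.mk' (fun c => φ.app c + ψ.app c)
    (by simp [add_whiskerRight, φ.act_app, ψ.act_app])⟩

instance (F G : EnrFun V C) : Neg (F ⟶ G) :=
  ⟨fun φ => Hom.mk' (fun c => -φ.app c) (by simp [neg_whiskerRight, φ.act_app])⟩

instance (F G : EnrFun V C) : AddCommGroup (F ⟶ G) where
  add_assoc _ _ _ := hom_ext fun _ => add_assoc _ _ _
  zero_add _ := hom_ext fun _ => zero_add _
  add_zero _ := hom_ext fun _ => add_zero _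
  add_comm _ _ := hom_ext fun _ => add_comm _ _
  neg_add_cancel _ := hom_ext fun _ => neg_add_cancel _
  nsmul := nsmulRec
  zsmul := zsmulRec

instance : Preadditive (EnrFun V C) where
  add_comp _ _ _ _ _ _ := hom_ext fun _ => Preadditive.add_comp _ _ _ _ _ _
  comp_add _ _ _ _ _ _ := hom_ext fun _ => Preadditive.comp_add _ _ _ _ _ _

instance (c : C) : (ev V c : EnrFun V C ⥤ V).Additive where

/-- Kernels and cokernels in `[C, V]` are computed pointwise. -/
noncomputable instance : Abelian (EnrFun V C) :=
  have : HasFiniteProducts (EnrFun V C) := hasFiniteProducts_of_hasFiniteLimits _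
  have : ∀ {F G : EnrFun V C} (φ : F ⟶ G), IsIso (Abelian.coimageImageComparison φ) := by
    intro F G φ
    have : ∀ c, IsIso ((ev V c).map (Abelian.coimageImageComparison φ)) := fun c => by
      rw [Arrow.isIso_iff_isIso_of_isIso
        (Abelian.PreservesCoimageImageComparison.iso (ev V c) φ).hom]
      infer_instance
    have : ∀ c, IsIso (Hom.app (Abelian.coimageImageComparison φ) c) := this
    exact isIso_of_app _
  Abelian.ofCoimageImageComparisonIsIso

end Abelian

section Tensor

lemma tensorRepr_aux {M N P Q R : V} (f : M ⟶ N) (g : P ⊗ Q ⟶ R) :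
    ((α_ M P Q).hom ≫ M ◁ g) ≫ f ▷ R = (f ▷ P) ▷ Q ≫ (α_ N P Q).hom ≫ N ◁ g := by
  rw [Category.assoc, whisker_exchange, associator_naturality_left_assoc]

variable (V) in
/-- The functor `M ↦ V_C(c, -) ⊘ M`, the tensor of the representable functor `V_C(c, -)` with an
object `M` of `V`; its value at `d` is `M ⊗ V_C(c, d) ≅ V_C(c, d) ⊗ M`, with action by
composition. -/
def tensorRepr (c : C) : V ⥤ EnrFun V C where
  obj M := mk' (fun d => M ⊗ (c ⟶[V] d))
    (fun d e => (α_ _ _ _).hom ≫ M ◁ eComp V c d e)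
    (fun d => by
      have h := e_comp_id V c d
      have : (ρ_ (M ⊗ (c ⟶[V] d))).inv ≫ (M ⊗ (c ⟶[V] d)) ◁ eId V d ≫
          (α_ _ _ _).hom ≫ M ◁ eComp V c d d =
          M ◁ ((ρ_ (c ⟶[V] d)).inv ≫ (c ⟶[V] d) ◁ eId V d ≫ eComp V c d d) := by
        simp only [MonoidalCategory.whiskerLeft_comp]
        monoidal
      rw [this, h, MonoidalCategory.whiskerLeft_id])
    (fun b d e => by
      have h := e_assoc V c b d e
      have h2 : (α_ (M ⊗ (c ⟶[V] b)) (b ⟶[V] d) (d ⟶[V] e)).inv ≫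
          ((α_ M (c ⟶[V] b) (b ⟶[V] d)).hom ≫ M ◁ eComp V c b d) ▷ (d ⟶[V] e) ≫
          (α_ _ _ _).hom ≫ M ◁ eComp V c d e =
          (α_ _ _ _).hom ≫ M ◁ ((α_ _ _ _).inv ≫ eComp V c b d ▷ _ ≫ eComp V c d e) := by
        simp only [MonoidalCategory.whiskerLeft_comp, comp_whiskerRight]
        monoidal
      rw [h2, h, MonoidalCategory.whiskerLeft_comp, associator_naturality_right_assoc])
  map f := Hom.mk' (fun d => f ▷ _) (fun d e => by
    rw [mk'_act, mk'_act]
    exact tensorRepr_aux f (eComp V c d e))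
  map_id M := hom_ext fun d => id_whiskerRight _ _
  map_comp f g := hom_ext fun d => comp_whiskerRight _ _ _

instance [SymmetricCategory V] [Abelian V] (c : C) : (tensorRepr V c).Additive where
  map_add {_ _ _ _} := hom_ext fun _ => add_whiskerRight _ _ _

end Tensor

section Restriction

/-- The full `V`-subcategory of `C` on a set `A` of objects. -/
instance enrichedSubtype (A : Set C) : EnrichedCategory V A where
  Hom a b := (a : C) ⟶[V] (b : C)
  id a := eId V (a : C)
  comp a b c := eComp V (a : C) b c
  id_comp a b := e_id_comp V (a : C) b
  comp_id a b := e_comp_id V (a : C) b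
  assoc a b c d := e_assoc V (a : C) b c d

variable (V) in
/-- The inclusion of the full `V`-subcategory on `A`. -/
def inclusion (A : Set C) : EnrichedFunctor V A C where
  obj a := a
  map a b := 𝟙 ((a : C) ⟶[V] (b : C))
  map_id a := Category.comp_id _
  map_comp a b c := by
    refine (Category.comp_id _).trans ?_
    exact ((congrArg (· ≫ eComp V (a : C) b c) (id_tensorHom_id _ _)).trans
      (Category.id_comp _)).symm

variable (V) in
/-- The restriction functor `r : [C, V] ⥤ [A, V]`. -/
def restrict (A : Set C) : EnrFun V C ⥤ EnrFun V A where
  obj F := ⟨(inclusion V A).comp V F.toEnriched⟩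
  map {F G} φ :=
    { app a := φ.app a
      naturality a b := by
        have h := φ.naturality a b
        change (𝟙 ((a : C) ⟶[V] (b : C)) ≫ F.map a b) ≫ _ = (𝟙 ((a : C) ⟶[V] (b : C)) ≫ G.map a b) ≫ _
        rw [Category.id_comp, Category.id_comp]
        exact h }

variable [SymmetricCategory V] [Abelian V]

instance (A : Set C) : (restrict V A).Additive where

instance (A : Set C) : PreservesFiniteLimits (restrict V A) :=
  preservesFiniteLimits_of_ev _ (fun a => inferInstanceAs (PreservesFiniteLimits (ev V (a : C))))

instance (A : Set C) : PreservesFiniteColimits (restrict V A) :=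
  preservesFiniteColimits_of_ev _
    (fun a => inferInstanceAs (PreservesFiniteColimits (ev V (a : C))))

variable (V) in
/-- The localizing (in particular Serre) subcategory `S_A` of the enriched functors that vanish
on `A`. -/
def vanishing (A : Set C) : ObjectProperty (EnrFun V C) :=
  fun F => ∀ a ∈ A, IsZero (F.obj a)

instance (A : Set C) : (vanishing V A).IsSerreClass where
  exists_zero :=
    have := Abelian.hasZeroObject (C := EnrFun V C)
    ⟨_, isZero_zero _, fun a _ => (ev V a).map_isZero (isZero_zero _)⟩
  prop_of_mono f _ h a ha :=
    (ObjectProperty.inverseImage (IsZero (C := V)) (ev V a)).prop_of_mono f (h a ha)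
  prop_of_epi f _ h a ha :=
    (ObjectProperty.inverseImage (IsZero (C := V)) (ev V a)).prop_of_epi f (h a ha)
  prop_X₂_of_shortExact hS h₁ h₃ a ha :=
    (hS.map_of_exact (ev V a)).exact.isZero_of_both_zeros ((h₁ a ha).eq_of_src _ _)
      ((h₃ a ha).eq_of_tgt _ _)

variable (V) in
/-- The Serre quotient `[C, V] / S_A`: the localization of `[C, V]` at the morphisms whose kernel
and cokernel lie in `S_A`. -/
abbrev SerreQuotient (A : Set C) := (vanishing V A).isoModSerre.Localization

variable (V) in
/-- The (exact) quotient functor `ℓ : [C, V] ⥤ [C, V] / S_A`, that is, `S_A`-localization. -/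
abbrev localize (A : Set C) : EnrFun V C ⥤ SerreQuotient V A := (vanishing V A).isoModSerre.Q

noncomputable instance (A : Set C) : Abelian (SerreQuotient V A) :=
  ObjectProperty.SerreClassLocalization.abelian (localize V A) (vanishing V A)

instance (A : Set C) : PreservesFiniteLimits (localize V A) :=
  ObjectProperty.SerreClassLocalization.preservesFiniteLimits (localize V A) (vanishing V A)

instance (A : Set C) : PreservesFiniteColimits (localize V A) :=
  ObjectProperty.SerreClassLocalization.preservesFiniteColimits (localize V A) (vanishing V A)

end Restriction

end EnrFun

end EnrichedFunctors

section Triangulated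

variable (B : Type*) [Category* B] [HasZeroObject B] [Preadditive B] [HasShift B ℤ]
  [∀ n : ℤ, (shiftFunctor B n).Additive] [Pretriangulated B]
  (T : Type*) [Category* T] [HasZeroObject T] [Preadditive T] [HasShift T ℤ]
  [∀ n : ℤ, (shiftFunctor T n).Additive] [Pretriangulated T]
  (U : Type*) [Category* U] [HasZeroObject U] [Preadditive U] [HasShift U ℤ]
  [∀ n : ℤ, (shiftFunctor U n).Additive] [Pretriangulated U]

variable {B T U} in
/-- A functor between triangulated categories is triangulated if it commutes with the shifts up
to (suitable) natural isomorphisms and maps distinguished triangles to distinguished triangles. -/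
def IsTriangulatedFunctor (F : B ⥤ T) : Prop :=
  ∃ _ : F.CommShift ℤ, F.IsTriangulated

variable {B T U} in
/-- A recollement of triangulated categories `B ⟶ T ⟶ U` with middle functors `i` and `j`: there
are adjunctions `iL ⊣ i ⊣ iR` and `jL ⊣ j ⊣ jR`, all six functors are triangulated, `i`, `jL` and
`jR` are fully faithful, and the essential image of `i` is the kernel of `j`. -/
structure Recollement (i : B ⥤ T) (j : T ⥤ U) where
  /-- the left adjoint of `i` -/
  iL : T ⥤ B
  /-- the right adjoint of `i` -/
  iR : T ⥤ B
  /-- the left adjoint of `j` -/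
  jL : U ⥤ T
  /-- the right adjoint of `j` -/
  jR : U ⥤ T
  adjiL : iL ⊣ i
  adjiR : i ⊣ iR
  adjjL : jL ⊣ j
  adjjR : j ⊣ jR
  triangulated_i : IsTriangulatedFunctor i
  triangulated_j : IsTriangulatedFunctor j
  triangulated_iL : IsTriangulatedFunctor iL
  triangulated_iR : IsTriangulatedFunctor iR
  triangulated_jL : IsTriangulatedFunctor jL
  triangulated_jR : IsTriangulatedFunctor jR
  fullyFaithful_i : i.FullyFaithful
  fullyFaithful_jL : jL.FullyFaithful
  fullyFaithful_jR : jR.FullyFaithful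
  essImage_eq_kernel (X : T) : i.essImage X ↔ IsZero (j.obj X)

variable {T}

/-- `P` is compact: every morphism from `P` to a (small) coproduct is the sum of finitely many
morphisms that factor through one summand, i.e. `⨁ Hom(P, X i) ⟶ Hom(P, ∐ X i)` is surjective
(it is always injective). -/
def IsCompactObject (P : T) : Prop :=
  ∀ ⦃I : Type v⦄ (X : I → T) (c : Cofan X) (_ : IsColimit c) (f : P ⟶ c.pt),
    ∃ (s : Finset I) (g : ∀ i, P ⟶ X i), f = ∑ i ∈ s, g i ≫ c.inj i

/-- A family of compact generators: compact objects such that an object that receives only zero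
morphisms from their shifts is zero. -/
structure IsCompactGeneratingFamily {J : Type*} (P : J → T) : Prop where
  isCompact (j : J) : IsCompactObject.{v} (P j)
  isZero_of (X : T) (hX : ∀ (j : J) (n : ℤ) (f : P j ⟶ X⟦n⟧), f = 0) : IsZero X

/-- A localizing subcategory: a (strictly) full triangulated subcategory closed under small
coproducts. -/
structure IsLocalizingSubcategory (P : ObjectProperty T) : Prop where
  isTriangulated : P.IsTriangulated
  isClosedUnderIsomorphisms : P.IsClosedUnderIsomorphisms
  coproduct ⦃I : Type v⦄ (X : I → T) (c : Cofan X) (_ : IsColimit c) (hX : ∀ i, P (X i)) : P c.pt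

/-- The smallest localizing subcategory that contains the objects `G k`. -/
def localizingHull {K : Type*} (G : K → T) : ObjectProperty T :=
  fun X => ∀ P : ObjectProperty T, IsLocalizingSubcategory.{v} P → (∀ k, P (G k)) → P X

end Triangulated

section Complexes

variable {E : Type*} [Category* E] [Abelian E]

/-- A complex is injective fibrant if it is fibrant in the model structure on complexes whose
cofibrations are the monomorphisms and whose weak equivalences are the quasi-isomorphisms: it has
the extension property for monomorphisms that are quasi-isomorphisms. -/
def IsInjectiveFibrant (Y : CochainComplex E ℤ) : Prop :=
  ∀ ⦃K L : CochainComplex E ℤ⦄ (i : K ⟶ L) [Mono i] [QuasiIso i] (f : K ⟶ Y),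
    ∃ g : L ⟶ Y, i ≫ g = f

variable (E) in
/-- A choice of K-injective resolutions `Y ⟶ kY`, natural in `Y`: a functor `k` from the derived
category to the homotopy category with K-injective values, and a natural isomorphism `Y ≅ kY` in
the derived category. -/
structure KInjectiveResolution [HasDerivedCategory.{w₁} E] where
  /-- the resolution functor -/
  k : DerivedCategory E ⥤ HomotopyCategory E (ComplexShape.up ℤ)
  isKInjective (Y : DerivedCategory E) : CochainComplex.IsKInjective (k.obj Y).as
  /-- the isomorphisms `Y ≅ kY` in the derived category -/
  iso : 𝟭 (DerivedCategory E) ≅ k ⋙ DerivedCategory.Qh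

variable {E' : Type*} [Category* E'] [Abelian E']

/-- The triangulated functor induced on derived categories by an equivalence. -/
noncomputable def mapDerivedOfEquivalence [HasDerivedCategory.{w₁} E] [HasDerivedCategory.{w₂} E']
    (e : E ⥤ E') [e.IsEquivalence] : DerivedCategory E ⥤ DerivedCategory E' :=
  have : e.Additive := e.additive_of_preserves_binary_products
  e.mapDerivedCategory

end Complexes

section Statement

open EnrFun HomotopicalAlgebra

variable (V : Type u) [Category.{v} V] [Abelian V] [MonoidalCategory V] [MonoidalClosed V]
  [SymmetricCategory V] {C : Type w} [EnrichedCategory V C]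
  [HasDerivedCategory.{w₁} V] [HasDerivedCategory.{w₂} (EnrFun V C)]

/-- The subcategory `E_A` of `D[C, V]`: the complexes `Y` with `H_n(Y(a)) = 0` for all `a ∈ A` and
`n ∈ ℤ`. -/
def acyclicOn (A : Set C) : ObjectProperty (DerivedCategory (EnrFun V C)) :=
  fun Y => ∀ a ∈ A, ∀ n : ℤ,
    IsZero ((DerivedCategory.homologyFunctor V n).obj ((ev V a).mapDerivedCategory.obj Y))


lemma acyclicOn_iff (A : Set C) (Y : DerivedCategory (EnrFun V C)) :
    acyclicOn V A Y ↔ ∀ a ∈ A, ((DerivedCategory.homologyFunctor V 0).homologicalKernel.inverseImage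
      (ev V a).mapDerivedCategory) Y := by
  refine forall₂_congr fun a _ => ?_
  exact ((DerivedCategory.homologyFunctor V 0).mem_homologicalKernel_iff _).symm

instance (A : Set C) : (acyclicOn V A).IsClosedUnderIsomorphisms where
  of_iso e hY := (acyclicOn_iff V A _).2 fun a ha =>
    ObjectProperty.prop_of_iso _ e ((acyclicOn_iff V A _).1 hY a ha)

instance (A : Set C) : (acyclicOn V A).IsTriangulated where
  exists_zero := ⟨_, isZero_zero _, (acyclicOn_iff V A _).2 fun _ _ =>
    ObjectProperty.prop_zero _⟩
  isStableUnderShiftBy n :=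
    ⟨fun Y hY => (acyclicOn_iff V A _).2 fun a ha =>
      ObjectProperty.le_shift _ n _ ((acyclicOn_iff V A Y).1 hY a ha)⟩
  toIsTriangulatedClosed₂ := .mk' (fun T hT h₁ h₃ => (acyclicOn_iff V A _).2 fun a ha =>
      ObjectProperty.ext_of_isTriangulatedClosed₂ _ T hT ((acyclicOn_iff V A _).1 h₁ a ha)
        ((acyclicOn_iff V A _).1 h₃ a ha))


/-- The three alternative conditions on a family `P` of complexes in `V` and an enriched category
`C`, together with the corresponding family `Q`:
1. every `P j` is K-projective, and `Q = P`;
2. evaluation at every `c` preserves K-injective complexes, and `Q = P`;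
3. there is a model structure on `Ch(V)` with the quasi-isomorphisms as weak equivalences, such that
   evaluation at every `c` maps injective fibrant complexes to fibrant ones; `Q j` is a cofibrant
   replacement of `P j`, and a chain map from `Q j` to a fibrant complex is null-homotopic if it is
   zero in `D(V)` (so that `Hom` in `D(V)` is given by chain homotopy classes). -/
def TestCondition (C : Type w) [EnrichedCategory V C] {J : Type*}
    (P Q : J → CochainComplex V ℤ) : Prop :=
  (Q = P ∧ ∀ j, (P j).IsKProjective) ∨
  (Q = P ∧ ∀ (Y : CochainComplex (EnrFun V C) ℤ) [Y.IsKInjective] (c : C),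
    CochainComplex.IsKInjective
      (((ev V c).mapHomologicalComplex (ComplexShape.up ℤ)).obj Y)) ∨
  (∃ _ : ModelCategory (CochainComplex V ℤ),
    weakEquivalences (CochainComplex V ℤ) = HomologicalComplex.quasiIso V (ComplexShape.up ℤ) ∧
    (∀ Y : CochainComplex (EnrFun V C) ℤ, IsInjectiveFibrant Y → ∀ c : C,
      IsFibrant (((ev V c).mapHomologicalComplex (ComplexShape.up ℤ)).obj Y)) ∧
    ∀ j : J, IsCofibrant (Q j) ∧ (∃ f : Q j ⟶ P j, QuasiIso f) ∧
      ∀ (Z : CochainComplex V ℤ) [IsFibrant Z] (f : Q j ⟶ Z),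
        DerivedCategory.Q.map f = 0 → Nonempty (Homotopy f 0))

/-- The objects `V_C(a, -) ⊘ Q_j` of `D[C, V]`, for `a ∈ A` and `j ∈ J`. -/
noncomputable def generator (A : Set C) {J : Type*} (Q : J → CochainComplex V ℤ) (k : A × J) :
    DerivedCategory (EnrFun V C) :=
  DerivedCategory.Q.obj
    (((tensorRepr V (k.1 : C)).mapHomologicalComplex (ComplexShape.up ℤ)).obj (Q k.2))

/-- The subcategory `T_A` of `D[C, V]`: the smallest localizing subcategory that contains the
objects `V_C(a, -) ⊘ Q_j` with `a ∈ A` and `j ∈ J`. -/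
def generatedBy (A : Set C) {J : Type*} (Q : J → CochainComplex V ℤ) :
    ObjectProperty (DerivedCategory (EnrFun V C)) :=
  localizingHull.{v} (generator V A Q)

/-- The functor `D[C, V] ⥤ D[A, V]` that applies the restriction functor degreewise. -/
noncomputable abbrev restrictDerived (A : Set C) [HasDerivedCategory.{w₃} (EnrFun V A)] :
    DerivedCategory (EnrFun V C) ⥤ DerivedCategory (EnrFun V A) :=
  (restrict V A).mapDerivedCategory

/-- The functor `D[C, V] ⥤ D([C, V] / S_A)` that applies `S_A`-localization degreewise. -/
noncomputable abbrev localizeDerived (A : Set C) [HasDerivedCategory.{w₄} (SerreQuotient V A)] :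
    DerivedCategory (EnrFun V C) ⥤ DerivedCategory (SerreQuotient V A) :=
  (localize V A).mapDerivedCategory

/-- The inclusion `T_A ⥤ D[C, V]` followed by the restriction `D[C, V] ⥤ D[A, V]`. -/
noncomputable abbrev comparison (A : Set C) {J : Type*} (Q : J → CochainComplex V ℤ)
    [HasDerivedCategory.{w₃} (EnrFun V A)] :
    (generatedBy V A Q).FullSubcategory ⥤ DerivedCategory (EnrFun V A) :=
  (generatedBy V A Q).ι ⋙ restrictDerived V A

end Statement
end EnrRec

open CategoryTheory EnrRec EnrRec.EnrFun

namespace EnrRec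

open CategoryTheory Limits

/-! Abelian level. Restriction `r` preserves all small limits and colimits between Grothendieck
categories, so both Kan extensions exist. By the enriched Yoneda lemma the right one is fully
faithful, hence so is the left one. Thus `r` is itself a localization, at the morphisms whose kernel
and cokernel lie in `S_A`. So the Serre quotient is `[A, V]` up to the equivalence `ϰ = ℓ r_L`, and
the second recollement is the first one transported along `D(ϰ)`. Only the first needs work.

Its right half holds for any exact functor with a right adjoint: the right adjoint preserves
K-injective complexes, so applying it to K-injective resolutions gives a right adjoint on derived
categories (`derivedAdj`). Its counit is invertible when the original one is
(`isIso_derivedAdj_counit`). So `ρ` is a localization functor, and its kernel is `E_A`.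

Its left half rests on the bijection `Hom(V_C(c, -) ⊘ Q_j, Y) = Hom(Q_j, Y(c))` in the derived
categories (`IsTestComplex.bijective`). The tensor functor need not be exact, so this is not formal.
Each of the three conditions makes both sides computable by chain maps for a suitable representative
of `Y`. It follows that the generators are compact, that they are left orthogonal to `E_A`, and that
`E_A` is exactly what their shifts do not see. Bousfield localization
(`exists_triangle_of_isCompactObject`) gives triangles `X ⟶ Y ⟶ Z ⟶` with `X` in `T_A` and `Z` in
`E_A`. Since `T_A` is left orthogonal to the kernel of `ρ`, the functor `ρ` is bijective on
morphisms out of `T_A`. So `F` is an equivalence, and `τ_L F⁻¹` is left adjoint to `ρ`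
(`recollementOfLocalization`).

Everything uses resolutions in a Grothendieck category. Condition 3 needs them injective fibrant and
not merely K-injective (`exists_injectiveFibrant`). An acyclic quotient contains acyclic
subcomplexes of bounded size around any given element, obtained by adjoining boundaries countably
often (`exists_acyclic_image`). Hence injective fibrancy can be tested on a set of inclusions, by
Zorn's lemma, and the small object argument for that set yields the resolutions. -/

lemma exists_of_acyclic {E : Type u} [Category.{v} E] [Abelian E] {M : CochainComplex E ℤ}
    (hM : M.Acyclic) {n : ℤ} {A : E} (z : A ⟶ M.X n) (hz : z ≫ M.d n (n + 1) = 0) :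
    ∃ (A' : E) (p : A' ⟶ A) (_ : Epi p) (y : A' ⟶ M.X (n - 1)), p ≫ z = y ≫ M.d (n - 1) n :=
  (M.exactAt_iff_exact_up_to_refinements (n - 1) n (n + 1) (by simp) (by simp)).1 (hM n) z hz

/-! ### Acyclicity of filtered colimits and countable unions -/

section FilteredAcyclic

variable {E : Type u} [Category.{v} E] [Abelian E] [IsGrothendieckAbelian.{v} E]

/-- A filtered colimit of complexes is acyclic if the cycles of every stage become boundaries at a
later stage. -/
lemma acyclic_of_isColimit {J : Type v} [SmallCategory J] [IsFiltered J]
    (F : J ⥤ CochainComplex E ℤ) {c : Cocone F} (hc : IsColimit c)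
    (h : ∀ (j : J) (n : ℤ), ∃ (j' : J) (φ : j ⟶ j'), ∀ ⦃A : E⦄ (z : A ⟶ (F.obj j).X n),
      z ≫ (F.obj j).d n (n + 1) = 0 →
        ∃ (A' : E) (p : A' ⟶ A) (_ : Epi p) (y : A' ⟶ (F.obj j').X (n - 1)),
          p ≫ z ≫ (F.map φ).f n = y ≫ (F.obj j').d (n - 1) n) :
    HomologicalComplex.Acyclic c.pt := by
  intro n
  rw [HomologicalComplex.exactAt_iff' _ (n - 1) n (n + 1) (by simp) (by simp)]
  let α : F ⋙ HomologicalComplex.eval E (.up ℤ) n ⟶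
      F ⋙ HomologicalComplex.eval E (.up ℤ) (n + 1) :=
    { app j := (F.obj j).d n (n + 1)
      naturality i j f := (F.map f).comm n (n + 1) }
  let f : colimit (kernel α) ⟶ c.pt.X n :=
    colimit.desc (kernel α) ((Cocone.precompose (kernel.ι α)).obj
      ((HomologicalComplex.eval E (.up ℤ) n).mapCocone c))
  have hf (j : J) : colimit.ι (kernel α) j ≫ f = (kernel.ι α).app j ≫ (c.ι.app j).f n :=
    colimit.ι_desc _ _
  -- Filtered colimits are exact, so the colimit of the cycles of the stages covers the cycles of
  -- the colimit. That a cycle is a boundary need then be checked stage by stage only.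
  obtain ⟨hw, hex⟩ : ∃ hw, (ShortComplex.mk f (c.pt.d n (n + 1)) hw).Exact :=
    ⟨_, colim.exact_mapShortComplex
      ((ShortComplex.mk _ _ (kernel.condition α)).exact_of_f_is_kernel (kernelIsKernel α))
      (colimit.isColimit _) (isColimitOfPreserves (HomologicalComplex.eval E (.up ℤ) n) hc)
      (isColimitOfPreserves (HomologicalComplex.eval E (.up ℤ) (n + 1)) hc)
      f (c.pt.d n (n + 1)) hf (fun j => (c.ι.app j).comm n (n + 1))⟩
  have : Epi (kernel.lift (c.pt.d n (n + 1)) f hw) := hex.epi_kernelLift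
  rw [ShortComplex.exact_iff_kernel_ι_comp_cokernel_π_zero]
  change kernel.ι (c.pt.d n (n + 1)) ≫ cokernel.π (c.pt.d (n - 1) n) = 0
  rw [← cancel_epi (kernel.lift (c.pt.d n (n + 1)) f hw), kernel.lift_ι_assoc, comp_zero]
  refine colimit.hom_ext fun j => ?_
  obtain ⟨j', φ, hφ⟩ := h j n
  let a : (kernel α).obj j ⟶ (F.obj j).X n := (kernel.ι α).app j
  let cj : F.obj j ⟶ c.pt := c.ι.app j
  let cj' : F.obj j' ⟶ c.pt := c.ι.app j'
  obtain ⟨A', p, _, y, hy⟩ := hφ a (NatTrans.congr_app (kernel.condition α) j)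
  have h2 : cj = F.map φ ≫ cj' := (c.w φ).symm
  have hf : colimit.ι (kernel α) j ≫ f = a ≫ cj.f n := hf j
  have h3 := cj'.comm (n - 1) n
  rw [comp_zero, ← Category.assoc, hf, h2, ← cancel_epi p, HomologicalComplex.comp_f,
    Category.assoc, Category.assoc, reassoc_of% hy, ← reassoc_of% h3, cokernel.condition]
  simp

/-- The union is a filtered colimit of the `I k`, and a cycle of stage `k` bounds at stage `k + 1`.
The equation is only required inside `M`, because the inclusions are monic. -/
lemma acyclic_iSup {M : CochainComplex E ℤ} (I : ℕ → Subobject M) (hI : Monotone I)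
    (h : ∀ (k : ℕ) (n : ℤ) ⦃A : E⦄ (z : A ⟶ (I k : CochainComplex E ℤ).X n),
      z ≫ (I k : CochainComplex E ℤ).d n (n + 1) = 0 →
        ∃ (A' : E) (p : A' ⟶ A) (_ : Epi p) (y : A' ⟶ (I (k + 1) : CochainComplex E ℤ).X (n - 1)),
          p ≫ z ≫ (I k).arrow.f n =
            y ≫ (I (k + 1) : CochainComplex E ℤ).d (n - 1) n ≫ (I (k + 1)).arrow.f n) :
    HomologicalComplex.Acyclic ((⨆ k, I k : Subobject M) : CochainComplex E ℤ) := by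
  -- The lift puts the index category in the universe `v` in which filtered colimits are exact.
  let m : ULift.{v} ℕ →o Subobject M := ⟨fun k => I k.down, fun _ _ h => hI h⟩
  let F : ULift.{v} ℕ ⥤ MonoOver M := m.monotone.functor ⋙ Subobject.representative
  have hF (k) : Subobject.mk (F.obj k).obj.hom = I k.down := Subobject.mk_arrow _
  let c : Cocone (F ⋙ MonoOver.forget _) :=
    { pt := Over.mk (⨆ k, I k : Subobject M).arrow
      ι :=
        { app k := Over.homMk (Subobject.ofLE (I k.down) _ (le_iSup I k.down))
            (Subobject.ofLE_arrow _)
          naturality k l f := by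
            ext1
            let a : (I k.down : CochainComplex E ℤ) ⟶ (I l.down : CochainComplex E ℤ) :=
              (F.map f).hom.left
            have ha : a ≫ (I l.down).arrow = (I k.down).arrow := MonoOver.w (F.map f)
            change a ≫ Subobject.ofLE _ _ _ = Subobject.ofLE _ _ _ ≫ 𝟙 _
            rw [← cancel_mono (⨆ k, I k : Subobject M).arrow]
            simp [ha] } }
  have : Mono c.pt.hom := inferInstanceAs (Mono (⨆ k, I k : Subobject M).arrow)
  have hc := IsGrothendieckAbelian.isColimitMapCoconeOfSubobjectMkEqISup F c (by
    simp only [hF]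
    refine (Subobject.mk_arrow _).trans (le_antisymm ?_ ?_)
    · exact iSup_le fun k => le_iSup (fun j : ULift.{v} ℕ => I j.down) ⟨k⟩
    · exact iSup_le fun k => le_iSup I k.down)
  refine acyclic_of_isColimit _ hc fun k n => ⟨⟨k.down + 1⟩, homOfLE (Nat.le_succ k.down),
    fun A (z : A ⟶ (I k.down : CochainComplex E ℤ).X n) hz => ?_⟩
  obtain ⟨A', p, hp, y, hy⟩ := h k.down n z hz
  refine ⟨A', p, hp, y, ?_⟩
  let l : ULift.{v} ℕ := ⟨k.down + 1⟩
  let f : k ⟶ l := homOfLE (Nat.le_succ k.down)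
  let a : (I k.down : CochainComplex E ℤ) ⟶ (I (k.down + 1) : CochainComplex E ℤ) :=
    (F.map f).hom.left
  have ha : a ≫ (I (k.down + 1)).arrow = (I k.down).arrow := MonoOver.w (F.map f)
  change p ≫ z ≫ a.f n = y ≫ (I (k.down + 1) : CochainComplex E ℤ).d (n - 1) n
  rw [← cancel_mono ((I (k.down + 1)).arrow.f n), Category.assoc, Category.assoc, Category.assoc,
    ← hy, ← ha]
  rfl

end FilteredAcyclic

/-! ### Adjoining boundaries with a uniform size bound -/

section SmallSubcomplexes

variable {E : Type u} [Category.{v} E] [Abelian E] [IsGrothendieckAbelian.{v} E]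

/-- Every morphism from `G` to a term of a complex comes from a morphism of complexes from `H`. -/
def Covers (G : E) (H : CochainComplex E ℤ) : Prop :=
  ∀ (L : CochainComplex E ℤ) (n : ℤ) (x : G ⟶ L.X n), ∃ (h : H ⟶ L) (e : G ⟶ H.X n), e ≫ h.f n = x

/-- In each degree `n` the functor `L ↦ Hom(G, L.X n)` is corepresented by a complex; the coproduct
of these over all `n` serves all degrees at once. -/
lemma exists_covers (G : E) : ∃ H, Covers G H := by
  have : HasCoproductsOfShape ℤ E :=
    hasColimitsOfShape_of_equivalence (Discrete.equivalence (Equiv.ulift.{v} (α := ℤ)))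
  let D (n : ℤ) := HomologicalComplex.evalCompCoyonedaCorepresentative (.up ℤ) G n
  let hD (n : ℤ) := HomologicalComplex.evalCompCoyonedaCorepresentable (.up ℤ) G n
  refine ⟨∐ D, fun L n x => ?_⟩
  classical
  let e : G ⟶ (D n).X n := (hD n).homEquiv (𝟙 _)
  let d : D n ⟶ L := (hD n).homEquiv.symm x
  have hd : e ≫ d.f n = x := by
    have := (hD n).homEquiv_comp d (𝟙 _)
    simp only [Category.id_comp] at this
    exact this.symm.trans ((hD n).homEquiv.apply_symm_apply x)
  refine ⟨Sigma.desc (Pi.single n d), e ≫ (Sigma.ι D n).f n, ?_⟩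
  rw [Category.assoc, ← HomologicalComplex.comp_f, Sigma.ι_desc, Pi.single_eq_same, hd]

variable {G : E} (hG : IsSeparator G) {H : CochainComplex E ℤ} (hH : Covers G H)

include hG hH in
-- Whether `x : G ⟶ C.X n` becomes a boundary depends only on its image, so one primitive is chosen
-- for each degree and each subobject of `C.X n`. The index set `U'` therefore depends on `U` alone,
-- not on `L`, `M`, `π` or `t`, and this uniformity is the point.
lemma exists_boundaries (U : Type v) : ∃ U' : Type v, ∀ (L M : CochainComplex E ℤ) (π : L ⟶ M)
    [Epi π] (_ : M.Acyclic) (t : U → (H ⟶ L)), ∃ t' : U' → (H ⟶ L),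
    ∀ (n : ℤ) ⦃A : E⦄ (z : A ⟶ (∐ fun _ : U => H).X n),
      z ≫ (Sigma.desc t ≫ π).f n ≫ M.d n (n + 1) = 0 →
        ∃ (A' : E) (p : A' ⟶ A) (_ : Epi p) (y : A' ⟶ (∐ fun _ : U' => H).X (n - 1)),
          p ≫ z ≫ (Sigma.desc t ≫ π).f n = y ≫ (Sigma.desc t' ≫ π).f (n - 1) ≫ M.d (n - 1) n := by
  let C : CochainComplex E ℤ := ∐ fun _ : U => H
  refine ⟨Shrink.{v} (Σ n : ℤ, Subobject (C.X n)), fun L M π _ hM t => ?_⟩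
  let good (i : Σ n : ℤ, Subobject (C.X n)) (x : G ⟶ C.X i.1) (l : G ⟶ L.X (i.1 - 1)) : Prop :=
    imageSubobject x = i.2 ∧ x ≫ (Sigma.desc t ≫ π).f i.1 = l ≫ π.f (i.1 - 1) ≫ M.d (i.1 - 1) i.1
  have hs (i) : ∃ s : H ⟶ L, (∃ x l, good i x l) →
      ∃ x l, good i x l ∧ ∃ e : G ⟶ H.X (i.1 - 1), e ≫ s.f (i.1 - 1) = l := by
    by_cases hi : ∃ x l, good i x l
    · obtain ⟨x, l, hxl⟩ := hi
      obtain ⟨s, e, h⟩ := hH _ _ l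
      exact ⟨s, fun _ => ⟨x, l, hxl, e, h⟩⟩
    -- Subobjects that are not the image of a suitable element get the default value `0`.
    · exact ⟨0, fun h => (hi h).elim⟩
  choose s hs using hs
  let t' : Shrink.{v} (Σ n : ℤ, Subobject (C.X n)) → (H ⟶ L) := fun i => s ((equivShrink _).symm i)
  refine ⟨t', fun n A z hz => ?_⟩
  let σ := (Sigma.desc t ≫ π).f n
  let β := (Sigma.desc t' ≫ π).f (n - 1) ≫ M.d (n - 1) n
  suffices z ≫ σ ≫ cokernel.π β = 0 by
    obtain ⟨A', p, hp, y, hy⟩ := (ShortComplex.exact_cokernel β).exact_up_to_refinements (z ≫ σ)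
      ((Category.assoc _ _ _).trans this)
    exact ⟨A', p, hp, y, hy⟩
  -- After refinement, acyclicity of `M` and surjectivity of `π` give a primitive `l` with values in
  -- `L`. The vanishing is then tested on morphisms from the separator `G`, where the chosen
  -- primitives are available.
  obtain ⟨A', p, _, y, hy⟩ := exists_of_acyclic hM (z ≫ σ) ((Category.assoc _ _ _).trans hz)
  obtain ⟨A'', p', _, l, hl⟩ := surjective_up_to_refinements_of_epi (π.f (n - 1)) y
  rw [← cancel_epi p, ← cancel_epi p', comp_zero, comp_zero]
  refine (Preadditive.isSeparator_iff G).1 hG _ fun g => ?_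
  have hgood : good ⟨n, imageSubobject (g ≫ p' ≫ p ≫ z)⟩ (g ≫ p' ≫ p ≫ z) (g ≫ l) := by
    refine ⟨rfl, ?_⟩
    change (g ≫ p' ≫ p ≫ z) ≫ σ = _
    rw [Category.assoc, Category.assoc, Category.assoc, hy, reassoc_of% hl, Category.assoc]
  obtain ⟨x, l', ⟨hx, hx'⟩, e, he⟩ := hs _ ⟨_, _, hgood⟩
  dsimp only at x l' hx hx' e he
  have h0 : x ≫ σ ≫ cokernel.π β = 0 := by
    have hi : Sigma.ι (fun _ => H) (equivShrink _ ⟨n, imageSubobject (g ≫ p' ≫ p ≫ z)⟩) ≫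
        Sigma.desc t' = s ⟨n, imageSubobject (g ≫ p' ≫ p ≫ z)⟩ := by
      simp [t']
    have hβ : l' ≫ π.f (n - 1) ≫ M.d (n - 1) n = (e ≫
        (Sigma.ι (fun _ => H) (equivShrink _ ⟨n, imageSubobject (g ≫ p' ≫ p ≫ z)⟩)).f (n - 1)) ≫
          β := by
      rw [← he, ← hi]
      simp only [β, HomologicalComplex.comp_f, Category.assoc]
    rw [← Category.assoc, hx', hβ, Category.assoc, cokernel.condition, comp_zero]
  have h1 : (imageSubobject (g ≫ p' ≫ p ≫ z)).arrow ≫ σ ≫ cokernel.π β = 0 := by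
    rw [← hx, ← cancel_epi (factorThruImageSubobject x), imageSubobject_arrow_comp_assoc, h0,
      comp_zero]
  have h2 := imageSubobject_arrow_comp (g ≫ p' ≫ p ≫ z)
  calc g ≫ p' ≫ p ≫ z ≫ σ ≫ cokernel.π β = (g ≫ p' ≫ p ≫ z) ≫ σ ≫ cokernel.π β := by
        simp only [Category.assoc]
    _ = 0 := by rw [← h2, Category.assoc, h1, comp_zero]

end SmallSubcomplexes

end EnrRec

namespace EnrRec

open CategoryTheory Limits

/-! ### Monomorphisms that are quasi-isomorphisms -/

section AcyclicMono

variable {E : Type u} [Category.{v} E] [Abelian E]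

lemma acyclic_of_iso {K L : CochainComplex E ℤ} (e : K ≅ L) (hK : K.Acyclic) : L.Acyclic :=
  fun n => (hK n).of_iso e

lemma acyclic_cokernel {K L : CochainComplex E ℤ} (f : K ⟶ L) [Mono f] [hf : QuasiIso f] :
    HomologicalComplex.Acyclic (cokernel f) :=
  ShortComplex.ShortExact.acyclic_X₃ (S := ShortComplex.mk _ _ (cokernel.condition f))
    { exact := ShortComplex.exact_cokernel f } hf

lemma quasiIso_of_acyclic_cokernel {K L : CochainComplex E ℤ} (f : K ⟶ L) [Mono f]
    (h : HomologicalComplex.Acyclic (cokernel f)) : QuasiIso f := by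
  have hS : (ShortComplex.mk _ _ (cokernel.condition f)).ShortExact :=
    { exact := ShortComplex.exact_cokernel f }
  have h0 (n : ℤ) : IsZero (HomologicalComplex.homology (cokernel f) n) := (h n).isZero_homology
  rw [quasiIso_iff]
  intro n
  rw [quasiIsoAt_iff_isIso_homologyMap]
  have : Mono (HomologicalComplex.homologyMap f n) :=
    (hS.homology_exact₁ (n - 1) n (by simp)).mono_g ((h0 (n - 1)).eq_of_src _ _)
  have : Epi (HomologicalComplex.homologyMap f n) :=
    (hS.homology_exact₂ n).epi_f ((h0 n).eq_of_tgt _ _)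
  exact isIso_of_mono_of_epi _

/-- A pushout square induces an isomorphism of cokernels, and a monomorphism with acyclic cokernel
is a quasi-isomorphism. -/
lemma quasiIso_inl_of_isPushout {A B X Y : CochainComplex E ℤ} {f : A ⟶ B} {g : A ⟶ X} {f' : X ⟶ Y}
    {g' : B ⟶ Y} (h : IsPushout g f f' g') [Mono f] [QuasiIso f] : QuasiIso f' := by
  have : Mono f' := (MorphismProperty.monomorphisms _).of_isPushout h ‹Mono f›
  have := isIso_cokernel_map_of_isPushout h.flip
  exact quasiIso_of_acyclic_cokernel f' (acyclic_of_iso (asIso (cokernel.map f f' g g' h.w.symm))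
    (acyclic_cokernel f))

/-- A subcomplex whose image in the cokernel of a monomorphism `p` is acyclic meets the source of
`p` in a quasi-isomorphic subcomplex. -/
lemma quasiIso_pullback_snd {L' L B C : CochainComplex E ℤ} (p : L' ⟶ L) [Mono p] (f : B ⟶ L)
    (e : C ⟶ B) [Epi e] (h : HomologicalComplex.Acyclic (image (e ≫ f ≫ cokernel.π p))) :
    QuasiIso (pullback.snd p f) := by
  refine quasiIso_of_acyclic_cokernel _ (acyclic_of_iso ?_ h)
  have sq : IsPullback (pullback.snd p f) (pullback.fst p f) f p :=
    (IsPullback.of_hasPullback p f).flip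
  -- The cokernel of the pullback embeds into the cokernel of `p`; this identifies it with the image
  -- in the hypothesis.
  have := Abelian.mono_cokernel_map_of_isPullback sq
  let F : MonoFactorisation (e ≫ f ≫ cokernel.π p) :=
    { I := cokernel (pullback.snd p f)
      m := cokernel.map _ _ _ _ sq.w
      e := e ≫ cokernel.π _ }
  have : Epi F.e := epi_comp _ _
  have : StrongEpi F.e := strongEpi_of_epi _
  exact (image.isoStrongEpiMono F.e F.m F.fac).symm

end AcyclicMono

/-! ### Small acyclic subcomplexes of acyclic quotients -/

section SmallSubcomplexes

variable {E : Type u} [Category.{v} E] [Abelian E] [IsGrothendieckAbelian.{v} E]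

/-- The image of the coproduct of an increasing sequence of families is acyclic if the cycles of the
image of every stage become boundaries at the next stage. -/
lemma acyclic_image_of_stages {H L M : CochainComplex E ℤ} (π : L ⟶ M) (U U' : ℕ → Type v)
    (t : ∀ k, U k → (H ⟶ L)) (t' : ∀ k, U' k → (H ⟶ L)) (inl : ∀ k, U k → U (k + 1))
    (inr : ∀ k, U' k → U (k + 1)) (t_inl : ∀ k i, t (k + 1) (inl k i) = t k i)
    (t_inr : ∀ k i, t (k + 1) (inr k i) = t' k i)
    (ht' : ∀ (k : ℕ) (n : ℤ) ⦃A : E⦄ (z : A ⟶ (∐ fun _ : U k => H).X n),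
      z ≫ (Sigma.desc (t k) ≫ π).f n ≫ M.d n (n + 1) = 0 →
        ∃ (A' : E) (p : A' ⟶ A) (_ : Epi p) (y : A' ⟶ (∐ fun _ : U' k => H).X (n - 1)),
          p ≫ z ≫ (Sigma.desc (t k) ≫ π).f n =
            y ≫ (Sigma.desc (t' k) ≫ π).f (n - 1) ≫ M.d (n - 1) n) :
    HomologicalComplex.Acyclic
      (image (Sigma.desc (f := fun _ => H) (fun x : Σ k, U k => t x.1 x.2) ≫ π)) := by
  let tω : (Σ k, U k) → (H ⟶ L) := fun x => t x.1 x.2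
  let σ (k : ℕ) : (∐ fun _ : U k => H) ⟶ M :=
    Sigma.desc (f := fun _ : U k => H) (t k) ≫ π
  let σω : (∐ fun _ : (Σ k, U k) => H) ⟶ M :=
    Sigma.desc (f := fun _ : (Σ k, U k) => H) tω ≫ π
  let I (k : ℕ) : Subobject M := imageSubobject (σ k)
  have hσ (k : ℕ) : σ k = Sigma.desc (fun i : U k => Sigma.ι (fun _ : U (k + 1) => H) (inl k i)) ≫
      σ (k + 1) := by
    refine Sigma.hom_ext _ _ fun i => ?_
    simp [σ, t_inl]
  have hσ' (k : ℕ) : σ k = Sigma.desc (fun i : U k => Sigma.ι (fun _ : (Σ k, U k) => H) ⟨k, i⟩) ≫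
      σω := by
    refine Sigma.hom_ext _ _ fun i => ?_
    simp [σ, σω, tω]
  have hI : Monotone I := monotone_nat_of_le_succ fun k => by
    dsimp only [I]
    rw [hσ]
    exact imageSubobject_comp_le _ _
  have hsup : ⨆ k, I k = imageSubobject σω := by
    refine le_antisymm (iSup_le fun k => ?_) ?_
    · dsimp only [I]
      rw [hσ']
      exact imageSubobject_comp_le _ _
    · have hfac (k : ℕ) (i : U k) : (⨆ k, I k).Factors (t k i ≫ π) := by
        refine Subobject.factors_of_le _ (le_iSup I k) ?_
        have : t k i ≫ π = Sigma.ι (fun _ : U k => H) i ≫ σ k := by simp [σ]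
        rw [this]
        exact imageSubobject_factors_comp_self _ _
      refine imageSubobject_le _ (Sigma.desc fun x => (⨆ k, I k).factorThru _ (hfac x.1 x.2)) ?_
      refine Sigma.hom_ext _ _ fun i => ?_
      simp [σω, tω]
  have hac : HomologicalComplex.Acyclic ((⨆ k, I k : Subobject M) : CochainComplex E ℤ) := by
    refine acyclic_iSup I hI fun k n A z hz => ?_
    -- A cycle of the image of stage `k` is lifted, after refinement, to the coproduct, where `ht'`
    -- applies; the primitive so found lies in the image of stage `k + 1`.
    obtain ⟨A', p, hp, y, hy⟩ := surjective_up_to_refinements_of_epi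
      ((factorThruImageSubobject (σ k)).f n) z
    have h1 : (factorThruImageSubobject (σ k)).f n ≫ (I k).arrow.f n = (σ k).f n := by
      rw [← HomologicalComplex.comp_f, imageSubobject_arrow_comp]
    have h2 : y ≫ (σ k).f n ≫ M.d n (n + 1) = 0 := by
      rw [← h1, Category.assoc, (I k).arrow.comm, ← reassoc_of% hy, reassoc_of% hz]
      simp
    obtain ⟨A'', p', hp', y', hy'⟩ := ht' k n y h2
    let j : (∐ fun _ : U' k => H) ⟶ (∐ fun _ : U (k + 1) => H) :=
      Sigma.desc (fun i : U' k => Sigma.ι (fun _ : U (k + 1) => H) (inr k i))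
    have hj : Sigma.desc (t' k) ≫ π = j ≫ σ (k + 1) := by
      refine Sigma.hom_ext _ _ fun i => ?_
      simp [σ, t_inr, j]
    refine ⟨A'', p' ≫ p, epi_comp _ _, y' ≫ (j ≫ factorThruImageSubobject (σ (k + 1))).f (n - 1),
      ?_⟩
    have h3 : (j ≫ factorThruImageSubobject (σ (k + 1))) ≫ (I (k + 1)).arrow = j ≫ σ (k + 1) := by
      rw [Category.assoc, imageSubobject_arrow_comp]
    rw [Category.assoc, reassoc_of% hy, h1]
    refine hy'.trans ?_
    rw [hj, ← h3, HomologicalComplex.comp_f, Category.assoc, Category.assoc,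
      ← (I (k + 1)).arrow.comm]
  rw [hsup] at hac
  exact acyclic_of_iso (imageSubobjectIso _) hac

variable {G : E} (hG : IsSeparator G) {H : CochainComplex E ℤ} (hH : Covers G H)

include hG hH in
/-- Every acyclic quotient is detected by acyclic images of coproducts of a bounded number of copies
of `H`. -/
lemma exists_acyclic_image : ∃ U : Type v, ∀ (L M : CochainComplex E ℤ) (π : L ⟶ M) [Epi π]
    (_ : M.Acyclic) (s : H ⟶ L), ∃ t : U → (H ⟶ L), (∃ i, t i = s) ∧
      HomologicalComplex.Acyclic (image (Sigma.desc t ≫ π)) := by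
  choose nxt hnxt using exists_boundaries hG hH
  -- Stage `0` is a single copy of `H`, to be mapped by `s`; each further stage keeps the previous
  -- copies and adds those needed to bound its cycles. All sizes are fixed before `L`, `M`, `π` and
  -- `s` are given.
  let U (k : ℕ) : Type v := Nat.rec PUnit.{v + 1} (fun _ X => X ⊕ nxt X) k
  refine ⟨Σ k, U k, fun L M π _ hM s => ?_⟩
  choose t' ht' using fun X => hnxt X L M π hM
  let t (k : ℕ) : U k → (H ⟶ L) := Nat.rec (motive := fun k => U k → (H ⟶ L)) (fun _ => s)
    (fun k tk => Sum.elim tk (t' (U k) tk)) k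
  exact ⟨fun x => t x.1 x.2, ⟨⟨0, PUnit.unit⟩, rfl⟩, acyclic_image_of_stages π U
    (fun k => nxt (U k)) t (fun k => t' (U k) (t k)) (fun _ => Sum.inl) (fun _ => Sum.inr)
    (fun _ _ => rfl) (fun _ _ => rfl) (fun k => ht' (U k) (t k))⟩

end SmallSubcomplexes

end EnrRec

namespace EnrRec

open CategoryTheory Limits

/-! ### Directed unions of subobjects and their quotients -/

section DirectedUnion

variable {E : Type u} [Category.{v} E] [Abelian E] [IsGrothendieckAbelian.{v} E]
  {J : Type v} [Preorder J] [IsDirectedOrder J] [Nonempty J] {L : E} (m : J →o Subobject L)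

/-- The diagram of objects that underlies a diagram of subobjects. -/
@[simps]
noncomputable def subobjectDiagram {E : Type u} [Category.{v} E] {J : Type v} [Preorder J] {L : E}
    (m : J →o Subobject L) : J ⥤ E where
  obj j := (m j : E)
  map f := Subobject.ofLE _ _ (m.monotone (leOfHom f))

/-- The union of a diagram of subobjects, as a cocone. -/
@[simps]
noncomputable def subobjectCocone : Cocone (subobjectDiagram m) where
  pt := ((⨆ j, m j : Subobject L) : E)
  ι :=
    { app j := Subobject.ofLE (m j) _ (le_iSup m j)
      naturality _ _ _ :=
        (Subobject.ofLE_comp_ofLE _ _ _ _ _).trans (Category.comp_id _).symm }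

/-- A directed union of subobjects is a colimit. -/
noncomputable def isColimitSubobjectCocone : IsColimit (subobjectCocone m) := by
  let F : J ⥤ MonoOver L :=
    { obj j := MonoOver.mk (m j).arrow
      map f := MonoOver.homMk (Subobject.ofLE _ _ (m.monotone (leOfHom f))) }
  let c : Cocone (F ⋙ MonoOver.forget _) :=
    { pt := Over.mk (⨆ k, m k : Subobject L).arrow
      ι :=
        { app k := Over.homMk (Subobject.ofLE (m k) _ (le_iSup m k)) (Subobject.ofLE_arrow _)
          naturality k l f := by
            ext1
            exact (Subobject.ofLE_comp_ofLE _ _ _ _ _).trans (Category.comp_id _).symm } }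
  have : Mono c.pt.hom := inferInstanceAs (Mono (⨆ k, m k : Subobject L).arrow)
  have hF (k) : Subobject.mk (F.obj k).obj.hom = m k := Subobject.mk_arrow _
  exact IsGrothendieckAbelian.isColimitMapCoconeOfSubobjectMkEqISup F c (by
    simp only [hF]
    exact Subobject.mk_arrow _)

lemma exists_desc_iSup {Y : E} (g : ∀ j, (m j : E) ⟶ Y)
    (hg : ∀ i j (h : i ≤ j), Subobject.ofLE _ _ (m.monotone h) ≫ g j = g i) :
    ∃ f : ((⨆ j, m j : Subobject L) : E) ⟶ Y,
      ∀ j, Subobject.ofLE (m j) _ (le_iSup m j) ≫ f = g j :=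
  ⟨(isColimitSubobjectCocone m).desc
    { pt := Y
      ι :=
        { app := g
          naturality i j f := (hg i j (leOfHom f)).trans (Category.comp_id _).symm } },
    fun _ => (isColimitSubobjectCocone m).fac _ _⟩

lemma iSup_hom_ext {Y : E} {f g : ((⨆ j, m j : Subobject L) : E) ⟶ Y}
    (h : ∀ j, Subobject.ofLE (m j) _ (le_iSup m j) ≫ f =
      Subobject.ofLE (m j) _ (le_iSup m j) ≫ g) : f = g :=
  (isColimitSubobjectCocone m).hom_ext h

/-- The projection between the quotients by two comparable subobjects. -/
noncomputable def quotientMap {A B : Subobject L} (h : A ≤ B) :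
    cokernel A.arrow ⟶ cokernel B.arrow :=
  cokernel.desc _ (cokernel.π _) (by rw [← Subobject.ofLE_arrow h, Category.assoc,
    cokernel.condition, comp_zero])

omit [IsGrothendieckAbelian.{v} E] in
@[simp]
lemma π_quotientMap {A B : Subobject L} (h : A ≤ B) :
    cokernel.π A.arrow ≫ quotientMap h = cokernel.π B.arrow :=
  cokernel.π_desc _ _ _

omit [IsGrothendieckAbelian.{v} E] in
@[simp]
lemma π_quotientMap_assoc {A B : Subobject L} (h : A ≤ B) {Z : E} (f : cokernel B.arrow ⟶ Z) :
    cokernel.π A.arrow ≫ quotientMap h ≫ f = cokernel.π B.arrow ≫ f := by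
  rw [← Category.assoc, π_quotientMap]

omit [IsGrothendieckAbelian.{v} E] in
lemma quotientMap_comp {A B C : Subobject L} (h : A ≤ B) (h' : B ≤ C) :
    quotientMap h ≫ quotientMap h' = quotientMap (h.trans h') := by
  rw [← cancel_epi (cokernel.π A.arrow)]
  simp

/-- The quotients by the members of a directed family of subobjects. -/
@[simps]
noncomputable def quotientDiagram : J ⥤ E where
  obj j := cokernel (m j).arrow
  map f := quotientMap (m.monotone (leOfHom f))
  map_comp _ _ := (quotientMap_comp _ _).symm
  map_id j := by
    rw [← cancel_epi (cokernel.π (m j).arrow), π_quotientMap, Category.comp_id]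

/-- The quotient by a directed union of subobjects, as a cocone. -/
@[simps]
noncomputable def quotientCocone : Cocone (quotientDiagram m) where
  pt := cokernel (⨆ j, m j : Subobject L).arrow
  ι :=
    { app j := quotientMap (le_iSup m j)
      naturality _ _ f := (quotientMap_comp (m.monotone (leOfHom f)) _).trans (Category.comp_id _).symm }

/-- By directedness a cocone on the quotients is a single morphism out of `L` that kills every
member of the family, hence kills the union. -/
lemma nonempty_isColimit_quotientCocone : Nonempty (IsColimit (quotientCocone m)) := by
  let q (j : J) : L ⟶ (quotientDiagram m).obj j := cokernel.π (m j).arrow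
  have hq (s : Cocone (quotientDiagram m)) {i j : J} (h : i ≤ j) :
      q i ≫ s.ι.app i = q j ≫ s.ι.app j := by
    rw [← s.w (homOfLE h), ← Category.assoc]
    congr 1
    exact π_quotientMap (m.monotone h)
  have hq' (s : Cocone (quotientDiagram m)) (i j : J) : q i ≫ s.ι.app i = q j ≫ s.ι.app j := by
    obtain ⟨k, hik, hjk⟩ := exists_ge_ge i j
    rw [hq s hik, hq s hjk]
  obtain ⟨j₀⟩ := ‹Nonempty J›
  have h0 (s : Cocone (quotientDiagram m)) :
      (⨆ j, m j : Subobject L).arrow ≫ q j₀ ≫ s.ι.app j₀ = 0 := by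
    refine iSup_hom_ext m fun j => ?_
    rw [hq' s j₀ j, Subobject.ofLE_arrow_assoc, comp_zero]
    exact (cokernel.condition_assoc _ _).trans zero_comp
  refine ⟨{ desc s := cokernel.desc _ _ (h0 s), fac s j := ?_, uniq s f hf := ?_ }⟩
  · have : Epi (q j) := inferInstanceAs (Epi (cokernel.π _))
    rw [← cancel_epi (q j), hq' s j j₀]
    exact (π_quotientMap_assoc (le_iSup m j) _).trans (cokernel.π_desc _ _ _)
  · let f' : cokernel (⨆ j, m j : Subobject L).arrow ⟶ s.pt := f
    change f' = _
    rw [← cancel_epi (cokernel.π (⨆ j, m j : Subobject L).arrow), cokernel.π_desc, ← hf j₀]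
    exact (π_quotientMap_assoc (le_iSup m j₀) f').symm

end DirectedUnion

section AcyclicUnion

variable {E : Type u} [Category.{v} E] [Abelian E] [IsGrothendieckAbelian.{v} E]
  {J : Type v} [Preorder J] [IsDirectedOrder J] [Nonempty J] {L : CochainComplex E ℤ}

/-- The cokernel is a filtered colimit of acyclic cokernels, so `acyclic_of_isColimit` applies
without moving to a later stage. -/
lemma quasiIso_iSup_arrow (m : J →o Subobject L) (hm : ∀ j, QuasiIso (m j).arrow) :
    QuasiIso (⨆ j, m j : Subobject L).arrow := by
  obtain ⟨hc⟩ := nonempty_isColimit_quotientCocone m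
  refine quasiIso_of_acyclic_cokernel _ (acyclic_of_isColimit _ hc fun j n =>
    ⟨j, 𝟙 _, fun A z hz => ?_⟩)
  have hj : HomologicalComplex.Acyclic ((quotientDiagram m).obj j) :=
    acyclic_cokernel (m j).arrow
  obtain ⟨A', p, hp, y, hy⟩ := exists_of_acyclic hj z hz
  refine ⟨A', p, hp, y, ?_⟩
  rw [← hy, CategoryTheory.Functor.map_id, HomologicalComplex.id_f]
  exact congrArg _ (Category.comp_id _)

end AcyclicUnion

/-! ### A set of test inclusions for injective fibrancy -/

section TestClass

variable {E : Type u} [Category.{v} E] [Abelian E] [IsGrothendieckAbelian.{v} E]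

/-- The index type for the inclusions of quasi-isomorphic subcomplexes of quotients of `K`. -/
def AcyclicTest (K : CochainComplex E ℤ) :=
  Σ R : Subobject K, { A : Subobject (cokernel R.arrow) // QuasiIso A.arrow }

instance (K : CochainComplex E ℤ) : Small.{v} (AcyclicTest K) :=
  inferInstanceAs (Small.{v} (Σ _, _))

/-- The inclusions of quasi-isomorphic subcomplexes of quotients of `K`. -/
def acyclicTest (K : CochainComplex E ℤ) : MorphismProperty (CochainComplex E ℤ) :=
  MorphismProperty.ofHoms (fun x : AcyclicTest K => x.2.1.arrow)

lemma acyclicTest_le (K : CochainComplex E ℤ) {X Y : CochainComplex E ℤ} (f : X ⟶ Y)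
    (hf : acyclicTest K f) : Mono f ∧ QuasiIso f := by
  obtain ⟨x⟩ := hf
  exact ⟨inferInstance, x.2.2⟩

/-- Otherwise every morphism from the separator to a term of `L` would factor through `p`, and a
separator detects isomorphisms among monomorphisms. -/
lemma exists_not_factors {G : E} (hG : IsSeparator G) {H : CochainComplex E ℤ} (hH : Covers G H)
    {L' L : CochainComplex E ℤ} (p : L' ⟶ L) [Mono p] (hp : ¬ IsIso p) :
    ∃ s : H ⟶ L, ∀ h : H ⟶ L', h ≫ p ≠ s := by
  by_contra! hs
  refine hp ?_
  have (n : ℤ) : IsIso (p.f n) := by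
    rw [hG.isDetector.isIso_iff_of_mono]
    intro G' hG' x
    obtain rfl : G' = G := by simpa [eq_comm] using hG'
    obtain ⟨s, e, rfl⟩ := hH L n x
    obtain ⟨h, rfl⟩ := hs s
    exact ⟨e ≫ h.f n, by simp⟩
  exact HomologicalComplex.Hom.isIso_of_components p

omit [IsGrothendieckAbelian.{v} E] in
lemma quasiIso_mk_arrow {L' L : CochainComplex E ℤ} (p : L' ⟶ L) [Mono p] [QuasiIso p] :
    QuasiIso (Subobject.mk p).arrow :=
  Subobject.underlyingIso_hom_comp_eq_mk p ▸ quasiIso_comp _ _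

lemma isPushout_mk_arrow {E : Type u} [Category.{v} E] {A B X Y : E} {a : A ⟶ X} {j : A ⟶ B}
    [Mono j] {i : X ⟶ Y} {r : B ⟶ Y} (sq : IsPushout a j i r) :
    IsPushout ((Subobject.underlyingIso j).hom ≫ a) (Subobject.mk j).arrow i r :=
  sq.of_iso (Subobject.underlyingIso j).symm (Iso.refl _) (Iso.refl _) (Iso.refl _) (by simp)
    (by simp) (by simp) (by simp)

/-- A quasi-isomorphic proper subcomplex can be enlarged by a pushout of a test inclusion. -/
lemma exists_acyclicTest {G : E} (hG : IsSeparator G) {H : CochainComplex E ℤ} (hH : Covers G H) :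
    ∃ K : CochainComplex E ℤ, ∀ ⦃L' L : CochainComplex E ℤ⦄ (p : L' ⟶ L) [Mono p] [QuasiIso p],
      ¬ IsIso p → ∃ (X : CochainComplex E ℤ) (i : L' ⟶ X) (p' : X ⟶ L),
        (acyclicTest K).pushouts i ∧ ¬ IsIso i ∧ Mono p' ∧ QuasiIso p' ∧ i ≫ p' = p := by
  obtain ⟨U, hU⟩ := exists_acyclic_image hG hH
  refine ⟨∐ fun _ : U => H, fun L' L p _ _ hp => ?_⟩
  obtain ⟨s, hs⟩ := exists_not_factors hG hH p hp
  obtain ⟨t, ⟨i, rfl⟩, ht⟩ := hU _ _ (cokernel.π p) (acyclic_cokernel p) s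
  -- The image `B` of the coproduct in `L` is a quotient of `K`, embedded by `f`, with acyclic image
  -- in `L / L'`. So the inclusion of `B ∩ L'` in `B` is a test inclusion, and its pushout `X` is
  -- the subcomplex `L' + B`, which is larger than `L'` because `t i` lands in `B`.
  let R := kernelSubobject (Sigma.desc t)
  let f : cokernel R.arrow ⟶ L := cokernel.desc _ (Sigma.desc t) (kernelSubobject_arrow_comp _)
  have hR : (ShortComplex.mk _ _ (kernelSubobject_arrow_comp (Sigma.desc t))).Exact :=
    ShortComplex.exact_of_f_is_kernel _ (IsLimit.ofIsoLimit (kernelIsKernel (Sigma.desc t))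
      (Fork.ext (kernelSubobjectIso (Sigma.desc t)).symm (by simp)))
  have : Mono f := hR.mono_cokernelDesc
  have hf : cokernel.π R.arrow ≫ f = Sigma.desc t := cokernel.π_desc _ _ _
  rw [← hf, Category.assoc] at ht
  have hq : QuasiIso (pullback.snd p f) := quasiIso_pullback_snd p f (cokernel.π R.arrow) ht
  obtain ⟨X, inl, inr, hpo⟩ : ∃ (X : _) (inl : L' ⟶ X) (inr : cokernel R.arrow ⟶ X),
      IsPushout (pullback.fst p f) (pullback.snd p f) inl inr :=
    ⟨_, _, _, IsPushout.of_hasPushout _ _⟩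
  have hin : QuasiIso inl := quasiIso_inl_of_isPushout hpo
  let d : X ⟶ L := hpo.desc p f pullback.condition
  have hd₁ : inl ≫ d = p := hpo.inl_desc _ _ _
  have hd₂ : inr ≫ d = f := hpo.inr_desc _ _ _
  refine ⟨X, inl, d, ?_, fun h => ?_, ?_, ?_, hd₁⟩
  · exact ⟨_, _, _, _, _, ⟨(⟨R, Subobject.mk (pullback.snd p f), quasiIso_mk_arrow _⟩ :
      AcyclicTest _)⟩, isPushout_mk_arrow hpo⟩
  · refine hs ((Sigma.ι (fun _ : U => H) i ≫ cokernel.π R.arrow) ≫ inr ≫ inv inl) ?_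
    rw [Category.assoc, Category.assoc, Category.assoc, (IsIso.inv_comp_eq inl).2 hd₁.symm, hd₂, hf,
      Sigma.ι_desc]
  · exact hpo.mono_of_isPullback_of_mono (IsPullback.of_hasPullback p f) _ hd₁ hd₂
  · have : QuasiIso (inl ≫ d) := hd₁ ▸ inferInstance
    exact quasiIso_of_comp_left inl d

end TestClass

end EnrRec

namespace EnrRec

open CategoryTheory Limits ZeroObject

/-! ### Extension along monic quasi-isomorphisms by Zorn's lemma -/

section Extension

variable {E : Type u} [Category.{v} E] [Abelian E] [IsGrothendieckAbelian.{v} E]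

/-- An extension of `f : K ⟶ Y` along a part of the monomorphism `i : K ⟶ L`. -/
structure PartialExtension {K L Y : CochainComplex E ℤ} (i : K ⟶ L) (f : K ⟶ Y) where
  /-- the domain -/
  A : Subobject L
  quasiIso : QuasiIso A.arrow
  /-- the extension -/
  g : (A : CochainComplex E ℤ) ⟶ Y
  fac : ∃ k : K ⟶ A, k ≫ A.arrow = i ∧ k ≫ g = f

namespace PartialExtension

variable {K L Y : CochainComplex E ℤ} {i : K ⟶ L} {f : K ⟶ Y}

instance : Preorder (PartialExtension i f) where
  le x y := ∃ h : x.A ≤ y.A, Subobject.ofLE _ _ h ≫ y.g = x.g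
  le_refl x := ⟨le_rfl, by simp⟩
  le_trans x y z := fun ⟨h, e⟩ ⟨h', e'⟩ => ⟨h.trans h', by
    rw [← e, ← e', ← Category.assoc, Subobject.ofLE_comp_ofLE]⟩

instance : Small.{v} (PartialExtension i f) :=
  small_of_injective (β := Σ A : Subobject L, ((A : CochainComplex E ℤ) ⟶ Y))
    (f := fun x => ⟨x.A, x.g⟩) (by
      rintro ⟨A, _, g, _⟩ ⟨A', _, g', _⟩ h
      simp only [Sigma.mk.injEq] at h
      obtain ⟨rfl, h⟩ := h
      obtain rfl := eq_of_heq h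
      rfl)

/-- The extensions glue over the union of their domains, and the union is again a quasi-isomorphic
subcomplex. Chains are first reindexed in the universe `v`, since the results on directed unions
require it. -/
lemma exists_upper_bound (c : Set (PartialExtension i f)) (hc : IsChain (· ≤ ·) c)
    (hc' : c.Nonempty) : BddAbove c := by
  have : Nonempty c := hc'.to_subtype
  have hdir : IsDirectedOrder (Shrink.{v} c) := ⟨fun a b => by
    have h : ∀ x y : c, ∃ z : c, x ≤ z ∧ y ≤ z := fun x y => by
      rcases hc.total x.2 y.2 with h | h
      · exact ⟨y, h, le_rfl⟩
      · exact ⟨x, le_rfl, h⟩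
    obtain ⟨z, h₁, h₂⟩ := h ((orderIsoShrink c).symm a) ((orderIsoShrink c).symm b)
    exact ⟨orderIsoShrink c z, (OrderIso.symm_apply_le _).1 h₁, (OrderIso.symm_apply_le _).1 h₂⟩⟩
  have : Nonempty (Shrink.{v} c) := ‹Nonempty c›.map (equivShrink c)
  let x (j : Shrink.{v} c) : PartialExtension i f := ((orderIsoShrink c).symm j).1
  have hx : Monotone x := fun a b h => (orderIsoShrink c).symm.monotone h
  let m : Shrink.{v} c →o Subobject L := ⟨fun j => (x j).A, fun a b h => (hx h).choose⟩
  obtain ⟨g, hg⟩ := exists_desc_iSup m (fun j => (x j).g) (fun a b h => (hx h).choose_spec)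
  obtain ⟨j₀⟩ := ‹Nonempty (Shrink.{v} c)›
  obtain ⟨k, hk, hk'⟩ := (x j₀).fac
  refine ⟨⟨⨆ j, m j, quasiIso_iSup_arrow m (fun j => (x j).quasiIso), g,
    ⟨k ≫ Subobject.ofLE (m j₀) _ (le_iSup m j₀), ?_, ?_⟩⟩, fun y hy => ?_⟩
  · rw [Category.assoc, Subobject.ofLE_arrow]
    exact hk
  · rw [Category.assoc, hg, hk']
  · obtain ⟨j, hj⟩ : ∃ j, x j = y := ⟨orderIsoShrink c ⟨y, hy⟩, by simp [x]⟩
    subst hj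
    exact ⟨le_iSup m j, hg j⟩

end PartialExtension

/-- Extension along the test inclusions implies injective fibrancy. -/
lemma isInjectiveFibrant_of_acyclicTest {K : CochainComplex E ℤ}
    (hK : ∀ ⦃L' L : CochainComplex E ℤ⦄ (p : L' ⟶ L) [Mono p] [QuasiIso p],
      ¬ IsIso p → ∃ (X : CochainComplex E ℤ) (i : L' ⟶ X) (p' : X ⟶ L),
        (acyclicTest K).pushouts i ∧ ¬ IsIso i ∧ Mono p' ∧ QuasiIso p' ∧ i ≫ p' = p)
    {Y : CochainComplex E ℤ}
    (hY : ∀ ⦃A B : CochainComplex E ℤ⦄ (i : A ⟶ B), acyclicTest K i → ∀ f : A ⟶ Y,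
      ∃ g : B ⟶ Y, i ≫ g = f) : IsInjectiveFibrant Y := by
  intro K' L i _ _ f
  have : Nonempty (PartialExtension i f) :=
    ⟨⟨Subobject.mk i, quasiIso_mk_arrow i, (Subobject.underlyingIso i).hom ≫ f,
      (Subobject.underlyingIso i).inv, by simp, by simp⟩⟩
  obtain ⟨x, hx⟩ := zorn_le_nonempty (α := PartialExtension i f)
    (fun c hc hc' => PartialExtension.exists_upper_bound c hc hc')
  obtain ⟨k, hk, hk'⟩ := x.fac
  have := x.quasiIso
  by_cases h : IsIso x.A.arrow
  · refine ⟨inv x.A.arrow ≫ x.g, ?_⟩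
    rw [← Category.assoc, (IsIso.eq_comp_inv x.A.arrow).2 hk |>.symm, hk']
  · exfalso
    -- If the maximal domain were proper, it could be enlarged by a pushout of a test inclusion. The
    -- extension property for test inclusions carries `x.g` over to the pushout, against maximality.
    obtain ⟨X, j, p, ⟨A, B, j', l, r, hj', sq⟩, hj, _, _, fac⟩ := hK _ h
    obtain ⟨g, hg⟩ := hY j' hj' (l ≫ x.g)
    have h0 : j ≫ (Subobject.underlyingIso p).inv ≫ (Subobject.mk p).arrow = x.A.arrow := by
      simp [fac]
    have h1 : x.A ≤ Subobject.mk p := Subobject.le_mk_of_comm j fac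
    have h2 : Subobject.ofLE _ _ h1 = j ≫ (Subobject.underlyingIso p).inv := by
      rw [← cancel_mono (Subobject.mk p).arrow]
      simp [fac]
    let y : PartialExtension i f :=
      { A := Subobject.mk p
        quasiIso := quasiIso_mk_arrow p
        g := (Subobject.underlyingIso p).hom ≫ sq.desc x.g g hg.symm
        fac := ⟨k ≫ Subobject.ofLE _ _ h1, by simp [hk], by simp [h2, hk']⟩ }
    have hxy : x ≤ y := ⟨h1, by simp [y, h2]⟩
    have h3 : Subobject.mk p ≤ x.A := (hx hxy).choose
    refine hj ⟨(Subobject.underlyingIso p).inv ≫ Subobject.ofLE _ _ h3, ?_, ?_⟩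
    · rw [← cancel_mono x.A.arrow]
      simp [fac]
    · rw [← cancel_mono p]
      simp [fac]

omit [IsGrothendieckAbelian.{v} E] in
/-- An injective fibrant complex is K-injective. -/
lemma IsInjectiveFibrant.isKInjective {Y : CochainComplex E ℤ} (hY : IsInjectiveFibrant Y) :
    Y.IsKInjective where
  nonempty_homotopy_zero {K} f hK := by
    -- For acyclic `K` the inclusion in the contractible cone of `𝟙 K` is a monic quasi-isomorphism.
    -- A morphism that extends to a contractible complex is null-homotopic.
    let i := CochainComplex.mappingCone.inr (𝟙 K)
    let h := CochainComplex.mappingCone.homotopyToZeroOfId K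
    have : Mono i := by
      have (n : ℤ) : Mono (i.f n) := by
        refine mono_of_mono_fac (h := 𝟙 _)
          (CochainComplex.mappingCone.inr_f_snd_v (𝟙 K) n)
      exact HomologicalComplex.mono_of_mono_f _ this
    have hC (n : ℤ) : (CochainComplex.mappingCone (𝟙 K)).ExactAt n := by
      rw [HomologicalComplex.exactAt_iff_isZero_homology, IsZero.iff_id_eq_zero,
        ← HomologicalComplex.homologyMap_id, h.homologyMap_eq,
        HomologicalComplex.homologyMap_zero]
    have : QuasiIso i :=
      (quasiIso_iff _).2 fun n => (quasiIsoAt_iff_exactAt i n (hK n)).2 (hC n)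
    obtain ⟨g, hg⟩ := hY i f
    exact ⟨(Homotopy.ofEq ((congrArg (· ≫ g) (Category.comp_id i)).trans hg).symm).trans
      (((h.compLeft i).compRight g).trans (Homotopy.ofEq (by simp)))⟩

end Extension

/-! ### The small object argument for the test inclusions -/

section SmallObject

variable {E : Type u} [Category.{v} E] [Abelian E] [IsGrothendieckAbelian.{v} E]

open MorphismProperty

instance (K : CochainComplex E ℤ) : MorphismProperty.IsSmall.{v} (acyclicTest K) := by
  dsimp [acyclicTest]
  infer_instance

/-- A regular cardinal larger than the number of subobjects of each quotient of `K` works: the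
sources of test inclusions embed in such quotients, so morphisms out of them commute with `κ`-long
unions of monomorphisms. -/
instance (K : CochainComplex E ℤ) : HasSmallObjectArgument.{v} (acyclicTest K) := by
  obtain ⟨κ, hκ', hκ⟩ := HasCardinalLT.exists_regular_cardinal_forall.{v}
    (fun R : Subobject K => Subobject (cokernel R.arrow))
  have : Fact κ.IsRegular := ⟨hκ'⟩
  have : Nonempty κ.ord.ToType := by simpa using hκ'.ne_zero
  have := WellFoundedLT.toOrderBot κ.ord.ToType
  exact ⟨κ, inferInstance, inferInstance,
    { preservesColimit {A B X Y} i hi f hf := by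
        let hf' : (monomorphisms _).TransfiniteCompositionOfShape κ.ord.ToType f :=
          { toTransfiniteCompositionOfShape := hf.toTransfiniteCompositionOfShape
            map_mem j hj := by
              have := (hf.attachCells j hj).pushouts_coproducts
              simp only [ofHoms_homFamily] at this
              refine (?_ : _ ≤ monomorphisms _) _ this
              simp only [pushouts_le_iff, coproducts_le_iff]
              exact fun _ _ _ h => (acyclicTest_le K _ h).1 }
        have (j j' : κ.ord.ToType) (φ : j ⟶ j') : Mono (hf'.F.map φ) := hf'.mem_map φ
        apply IsGrothendieckAbelian.preservesColimit_coyoneda_obj_of_mono (Y := hf'.F) (κ := κ)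
        obtain ⟨x⟩ := hi
        exact Subobject.hasCardinalLT_of_mono (hκ x.1) x.2.1.arrow }⟩

end SmallObject

/-! ### Lifting against disks on injective objects -/

section Lifting

variable {E : Type u} [Category.{v} E] [Abelian E]

/-- The extension problem that corresponds to lifting an acyclic monomorphism against the
projection from the cone of an injective object. -/
lemma exists_lift_of_injective {A B : CochainComplex E ℤ} (i : A ⟶ B) [Mono i] [QuasiIso i] {J : E}
    [Injective J] (n : ℤ) (a : A.X (n + 1) ⟶ J) (b : B.X n ⟶ J) (hb : B.d (n - 1) n ≫ b = 0)
    (hab : i.f n ≫ b = A.d n (n + 1) ≫ a) :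
    ∃ ψ : B.X (n + 1) ⟶ J, i.f (n + 1) ≫ ψ = a ∧ B.d n (n + 1) ≫ ψ = b := by
  let σ : A.X (n + 1) ⊞ B.X n ⟶ B.X (n + 1) := biprod.desc (i.f (n + 1)) (B.d n (n + 1))
  have hC := acyclic_cokernel i
  -- The required `ψ` is an extension of `(a, b)` along `σ`; by injectivity of `J` it exists as soon
  -- as `(a, b)` kills the kernel of `σ`.
  suffices kernel.ι σ ≫ biprod.desc a b = 0 by
    have hS : (ShortComplex.mk _ _ (kernel.condition σ)).Exact :=
      ShortComplex.exact_of_f_is_kernel _ (kernelIsKernel σ)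
    refine ⟨hS.descToInjective (biprod.desc a b) this, ?_, ?_⟩
    · have := biprod.inl ≫= hS.comp_descToInjective (biprod.desc a b) this
      simpa [σ] using this
    · have := biprod.inr ≫= hS.comp_descToInjective (biprod.desc a b) this
      simpa [σ] using this
  let x := kernel.ι σ ≫ biprod.fst
  let y := kernel.ι σ ≫ biprod.snd
  have hxy : x ≫ i.f (n + 1) + y ≫ B.d n (n + 1) = 0 := by
    have : kernel.ι σ ≫ biprod.desc (i.f (n + 1)) (B.d n (n + 1)) = 0 := kernel.condition σ
    rwa [biprod.desc_eq, Preadditive.comp_add, ← Category.assoc, ← Category.assoc] at this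
  suffices h : x ≫ a + y ≫ b = 0 by
    rwa [biprod.desc_eq, Preadditive.comp_add, ← Category.assoc, ← Category.assoc]
  clear_value x y
  have hS : (ShortComplex.mk _ _ (cokernel.condition i)).ShortExact :=
    { exact := ShortComplex.exact_cokernel i }
  have hSn (m : ℤ) : ((ShortComplex.mk _ _ (cokernel.condition i)).map
    (HomologicalComplex.eval E (.up ℤ) m)).ShortExact := hS.map_of_exact _
  -- the image of `y` in the cokernel is a cycle, hence a boundary
  have h1 : (y ≫ (cokernel.π i).f n) ≫ HomologicalComplex.d (cokernel i) n (n + 1) = 0 := by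
    have h3 : i.f (n + 1) ≫ (cokernel.π i).f (n + 1) = 0 := by
      rw [← HomologicalComplex.comp_f, cokernel.condition, HomologicalComplex.zero_f]
    rw [Category.assoc, (cokernel.π i).comm, ← Category.assoc, eq_neg_of_add_eq_zero_right hxy]
    simp [h3]
  obtain ⟨A₁, p₁, _, c, hc⟩ := exists_of_acyclic hC _ h1
  obtain ⟨A₂, p₂, _, z, hz⟩ := surjective_up_to_refinements_of_epi ((cokernel.π i).f (n - 1)) c
  have h2 : (p₂ ≫ p₁ ≫ y - z ≫ B.d (n - 1) n) ≫ (cokernel.π i).f n = 0 := by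
    rw [Preadditive.sub_comp, Category.assoc, Category.assoc, Category.assoc, hc, reassoc_of% hz,
      (cokernel.π i).comm, sub_self]
  obtain ⟨A₃, p₃, _, t, ht⟩ : ∃ (A₃ : E) (p₃ : A₃ ⟶ A₂) (_ : Epi p₃) (t : A₃ ⟶ A.X n),
      p₃ ≫ (p₂ ≫ p₁ ≫ y - z ≫ B.d (n - 1) n) = t ≫ i.f n :=
    (hSn n).exact.exact_up_to_refinements _ h2
  -- Up to refinement `y = i t + d z`, and then `x = - d t` because `i` is monic. The terms `- a d
  -- t` and `b i t` cancel by `hab`, and `b d z` vanishes by `hb`.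
  have ht' : p₃ ≫ p₂ ≫ p₁ ≫ y = t ≫ i.f n + p₃ ≫ z ≫ B.d (n - 1) n := by
    rw [← ht, Preadditive.comp_sub, sub_add_cancel]
  have h3 : t ≫ A.d n (n + 1) = - (p₃ ≫ p₂ ≫ p₁ ≫ x) := by
    have : Mono (i.f (n + 1)) := inferInstance
    rw [← cancel_mono (i.f (n + 1)), Category.assoc, ← i.comm, ← Category.assoc, ← ht,
      Preadditive.neg_comp]
    simp only [Category.assoc, Preadditive.comp_sub, Preadditive.sub_comp,
      HomologicalComplex.d_comp_d, comp_zero, sub_zero, eq_neg_of_add_eq_zero_right hxy,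
      Preadditive.comp_neg]
  have : Epi (p₃ ≫ p₂ ≫ p₁) := inferInstance
  rw [← cancel_epi (p₃ ≫ p₂ ≫ p₁), comp_zero, Preadditive.comp_add]
  have h4 := congrArg (· ≫ b) ht'
  have h5 := congrArg (· ≫ a) h3
  simp only [Category.assoc, Preadditive.add_comp, Preadditive.neg_comp, hb, hab, comp_zero,
    add_zero] at h4 h5
  simp only [Category.assoc]
  rw [h4, h5, add_neg_cancel]

variable (J : E) (n : ℤ)

/-- The complex `J = J` in degrees `n` and `n + 1`. -/
noncomputable abbrev disk : CochainComplex E ℤ :=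
  HomologicalComplex.double (𝟙 J) (show (ComplexShape.up ℤ).Rel n (n + 1) from rfl)

/-- The identification of the lower term of `disk J n`. -/
noncomputable def diskIso₀ : (disk J n).X n ≅ J := HomologicalComplex.doubleXIso₀ _ _

/-- The identification of the upper term of `disk J n`. -/
noncomputable def diskIso₁ : (disk J n).X (n + 1) ≅ J :=
  HomologicalComplex.doubleXIso₁ _ _ (by lia)

lemma disk_d : (disk J n).d n (n + 1) ≫ (diskIso₁ J n).hom = (diskIso₀ J n).hom := by
  rw [HomologicalComplex.double_d _ _ (by lia)]
  simp [diskIso₀, diskIso₁]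

lemma diskIso₀_inv_d : (diskIso₀ J n).inv ≫ (disk J n).d n (n + 1) = (diskIso₁ J n).inv := by
  rw [Iso.inv_comp_eq, ← disk_d, Category.assoc, Iso.hom_inv_id, Category.comp_id]

/-- The projection of `disk J n` to its lower term. -/
noncomputable def diskProj : disk J n ⟶ (HomologicalComplex.single E (.up ℤ) n).obj J :=
  HomologicalComplex.mkHomToSingle (diskIso₀ J n).hom fun i hi => by
    have hi : i + 1 = n := hi
    rw [HomologicalComplex.double_d_eq_zero₀ _ _ _ _ (by lia), zero_comp]

lemma diskProj_f : (diskProj J n).f n ≫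
    (HomologicalComplex.singleObjXSelf (.up ℤ) n J).hom = (diskIso₀ J n).hom := by
  simp [diskProj]

variable {J n}

/-- The morphism to `disk J n` given by its component in degree `n + 1`. -/
noncomputable def toDisk {B : CochainComplex E ℤ} (ψ : B.X (n + 1) ⟶ J) : B ⟶ disk J n where
  f k :=
    if hk₁ : k = n + 1 then
      eqToHom (by rw [hk₁]) ≫ ψ ≫ (diskIso₁ J n).inv ≫ eqToHom (by rw [hk₁])
    else if hk₀ : k = n then
      eqToHom (by rw [hk₀]) ≫ B.d n (n + 1) ≫ ψ ≫ (diskIso₀ J n).inv ≫ eqToHom (by rw [hk₀])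
    else 0
  comm' k l hkl := by
    obtain rfl : k + 1 = l := hkl
    by_cases h₁ : k = n
    · subst h₁
      rw [dif_neg (by lia), dif_pos rfl, dif_pos rfl]
      simp [diskIso₀_inv_d]
    · by_cases h₀ : k + 1 = n
      · subst h₀
        rw [dif_neg (by lia), dif_neg (by lia), dif_neg (by lia), dif_pos rfl]
        simp
      · exact (HomologicalComplex.isZero_double_X _ _ _ h₀ (by lia)).eq_of_tgt _ _

lemma toDisk_f₁ {B : CochainComplex E ℤ} (ψ : B.X (n + 1) ⟶ J) :
    (toDisk ψ).f (n + 1) ≫ (diskIso₁ J n).hom = ψ := by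
  simp [toDisk]

lemma f_diskIso₀ {B : CochainComplex E ℤ} (φ : B ⟶ disk J n) :
    φ.f n ≫ (diskIso₀ J n).hom = B.d n (n + 1) ≫ φ.f (n + 1) ≫ (diskIso₁ J n).hom := by
  rw [← φ.comm_assoc, disk_d]

lemma disk_hom_ext {B : CochainComplex E ℤ} {φ ψ : B ⟶ disk J n}
    (h : φ.f (n + 1) ≫ (diskIso₁ J n).hom = ψ.f (n + 1) ≫ (diskIso₁ J n).hom) : φ = ψ := by
  refine HomologicalComplex.to_double_hom_ext ?_ ?_
  · rw [← cancel_mono (diskIso₀ J n).hom, f_diskIso₀, f_diskIso₀, h]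
  · rwa [cancel_mono] at h

/-- A morphism to a disk is determined by its component in the upper degree, and
`exists_lift_of_injective` provides that component. -/
lemma hasLiftingProperty_diskProj [Injective J] {A B : CochainComplex E ℤ} (i : A ⟶ B) [Mono i]
    [QuasiIso i] : HasLiftingProperty i (diskProj J n) where
  sq_hasLift {t b} sq := by
    let s := HomologicalComplex.singleObjXSelf (.up ℤ) n J
    obtain ⟨ψ, h₁, h₂⟩ := exists_lift_of_injective i n (t.f (n + 1) ≫ (diskIso₁ J n).hom)
      (b.f n ≫ s.hom) (by rw [← b.comm_assoc]; simp) (by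
        rw [← f_diskIso₀, ← Category.assoc, ← HomologicalComplex.comp_f, ← sq.w,
          HomologicalComplex.comp_f, Category.assoc, diskProj_f])
    refine ⟨⟨⟨toDisk ψ, disk_hom_ext ?_, ?_⟩⟩⟩
    · rw [HomologicalComplex.comp_f, Category.assoc, toDisk_f₁, h₁]
    · refine HomologicalComplex.to_single_hom_ext ?_
      rw [← cancel_mono s.hom, HomologicalComplex.comp_f, Category.assoc, diskProj_f, f_diskIso₀,
        toDisk_f₁, h₂]

/-- Let `C` be the cokernel and embed `C.X n` modulo boundaries in an injective `J`. Lifting the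
resulting morphism from `C` through the disk makes `C.X n ⟶ J` factor through the differential, so
it kills cycles, and every cycle is a boundary. -/
lemma quasiIso_of_hasLiftingProperty_diskProj [EnoughInjectives E] {X Y : CochainComplex E ℤ}
    (i : X ⟶ Y) [Mono i]
    (h : ∀ (J : E) [Injective J] (n : ℤ), HasLiftingProperty i (diskProj J n)) : QuasiIso i := by
  refine quasiIso_of_acyclic_cokernel i fun n => ?_
  rw [HomologicalComplex.exactAt_iff' _ (n - 1) n (n + 1) (by simp) (by simp),
    ShortComplex.exact_iff_kernel_ι_comp_cokernel_π_zero]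
  let C : CochainComplex E ℤ := cokernel i
  change kernel.ι (C.d n (n + 1)) ≫ cokernel.π (C.d (n - 1) n) = 0
  let J := Injective.under (cokernel (C.d (n - 1) n))
  let φ : C.X n ⟶ J := cokernel.π (C.d (n - 1) n) ≫ Injective.ι _
  let b : C ⟶ (HomologicalComplex.single E (.up ℤ) n).obj J :=
    HomologicalComplex.mkHomToSingle φ fun k hk => by
      obtain rfl : k = n - 1 := by
        have : k + 1 = n := hk
        lia
      simp [φ]
  have := h J n
  have sq : CommSq 0 i (diskProj J n) (cokernel.π i ≫ b) := ⟨by simp⟩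
  let l : C ⟶ disk J n := cokernel.desc i sq.lift sq.fac_left
  have hl : l ≫ diskProj J n = b := by
    rw [← cancel_epi (cokernel.π i)]
    simp [l]
  have hl' : l.f n ≫ (diskIso₀ J n).hom = φ := by
    rw [← diskProj_f, ← Category.assoc, ← HomologicalComplex.comp_f, hl]
    simp [b]
  rw [← cancel_mono (Injective.ι (cokernel (C.d (n - 1) n))), zero_comp, Category.assoc]
  change _ ≫ φ = 0
  rw [← hl', f_diskIso₀, kernel.condition_assoc, zero_comp]

end Lifting

/-! ### Injective fibrant resolutions -/

section Resolution

variable {E : Type u} [Category.{v} E] [Abelian E] [IsGrothendieckAbelian.{v} E]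

/-- Every complex in a Grothendieck category is quasi-isomorphic to an injective fibrant one. -/
lemma exists_injectiveFibrant (X : CochainComplex E ℤ) :
    ∃ (Y : CochainComplex E ℤ) (i : X ⟶ Y), QuasiIso i ∧ IsInjectiveFibrant Y := by
  obtain ⟨H, hH⟩ := exists_covers (separator E)
  obtain ⟨K, hK⟩ := exists_acyclicTest (isSeparator_separator E) hH
  -- The first factor of `X ⟶ 0` lifts against all morphisms with the lifting property for monic
  -- quasi-isomorphisms. Taking an injective complex over `0` shows that it is monic, taking the
  -- disks shows that it is a quasi-isomorphism.
  let fac := MorphismProperty.factorizationData (acyclicTest K).rlp.llp (acyclicTest K).rlp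
    (0 : X ⟶ 0)
  have hlift {P S : CochainComplex E ℤ} (p : P ⟶ S)
      (hp : ∀ ⦃A B : CochainComplex E ℤ⦄ (i : A ⟶ B) [Mono i] [QuasiIso i],
        HasLiftingProperty i p) : HasLiftingProperty fac.i p :=
    fac.hi p fun A B i hi => by
      obtain ⟨_, _⟩ := acyclicTest_le K i hi
      exact hp i
  have : Mono fac.i := by
    have := hlift (0 : Injective.under X ⟶ 0) fun A B i _ _ =>
      ⟨fun {t b} sq => ⟨⟨⟨Injective.factorThru t i, by simp, (isZero_zero _).eq_of_tgt _ _⟩⟩⟩⟩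
    have sq : CommSq (Injective.ι X) fac.i (0 : Injective.under X ⟶ 0) 0 :=
      ⟨(isZero_zero _).eq_of_tgt _ _⟩
    exact mono_of_mono_fac sq.fac_left
  refine ⟨fac.Z, fac.i, quasiIso_of_hasLiftingProperty_diskProj _ fun J _ n => hlift _
    fun A B i _ _ => hasLiftingProperty_diskProj i, isInjectiveFibrant_of_acyclicTest hK
    fun A B i hi f => ?_⟩
  have := fac.hp i hi
  have sq : CommSq f i fac.p 0 := ⟨(isZero_zero _).eq_of_tgt _ _⟩
  exact ⟨sq.lift, sq.fac_left⟩

end Resolution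

end EnrRec

namespace EnrRec

open CategoryTheory Limits MonoidalCategory MonoidalClosed

namespace EnrFun

/-! ### The enriched Yoneda lemma -/

section TensorAdjunction

variable {V : Type u} [Category.{v} V] [MonoidalCategory V] [MonoidalClosed V]
  {C : Type w} [EnrichedCategory V C]

lemma tensorRepr_act (c : C) (M : V) (d e : C) : ((tensorRepr V c).obj M).act d e =
    (α_ M (c ⟶[V] d) (d ⟶[V] e)).hom ≫ M ◁ eComp V c d e :=
  uncurry_curry _

/-- The `V`-natural transformation `V_C(c, -) ⊘ M ⟶ F` given by `M ⟶ F(c)`. -/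
def tensorReprDesc (c : C) {M : V} {F : EnrFun V C} (f : M ⟶ F.obj c) :
    (tensorRepr V c).obj M ⟶ F :=
  Hom.mk' (fun d => f ▷ (c ⟶[V] d) ≫ F.act c d) (fun d e => by
    rw [tensorRepr_act]
    change ((α_ M (c ⟶[V] d) (d ⟶[V] e)).hom ≫ M ◁ eComp V c d e) ≫ f ▷ (c ⟶[V] e) ≫ F.act c e =
      (f ▷ (c ⟶[V] d) ≫ F.act c d) ▷ (d ⟶[V] e) ≫ F.act d e
    rw [← Category.assoc, tensorRepr_aux, Category.assoc, Category.assoc, F.act_comp,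
      Iso.hom_inv_id_assoc, comp_whiskerRight, Category.assoc])

/-- The element `M ⟶ F(c)` that corresponds to `V_C(c, -) ⊘ M ⟶ F`. -/
def tensorReprElement (c : C) {M : V} {F : EnrFun V C} (φ : (tensorRepr V c).obj M ⟶ F) :
    M ⟶ F.obj c :=
  ((ρ_ M).inv ≫ M ◁ eId V c) ≫ φ.app c

/-- The enriched Yoneda lemma: `V_C(c, -) ⊘ -` is left adjoint to evaluation at `c`. -/
def tensorReprEquiv (c : C) (M : V) (F : EnrFun V C) :
    ((tensorRepr V c).obj M ⟶ F) ≃ (M ⟶ F.obj c) where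
  toFun φ := tensorReprElement c φ
  invFun f := tensorReprDesc c f
  left_inv φ := by
    ext d
    have h := φ.act_app c d
    rw [tensorRepr_act] at h
    let φc : M ⊗ (c ⟶[V] c) ⟶ F.obj c := φ.app c
    let φd : M ⊗ (c ⟶[V] d) ⟶ F.obj d := φ.app d
    replace h : ((α_ M (c ⟶[V] c) (c ⟶[V] d)).hom ≫ M ◁ eComp V c c d) ≫ φd =
      φc ▷ (c ⟶[V] d) ≫ F.act c d := h
    have h2 : ((ρ_ M).inv ≫ M ◁ eId V c) ▷ (c ⟶[V] d) ≫ (α_ M (c ⟶[V] c) (c ⟶[V] d)).hom ≫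
        M ◁ eComp V c c d = 𝟙 _ := by
      have : ((ρ_ M).inv ≫ M ◁ eId V c) ▷ (c ⟶[V] d) ≫ (α_ M (c ⟶[V] c) (c ⟶[V] d)).hom ≫
        M ◁ eComp V c c d = M ◁ ((λ_ _).inv ≫ eId V c ▷ _ ≫ eComp V c c d) := by
          simp only [MonoidalCategory.whiskerLeft_comp, comp_whiskerRight]
          monoidal
      rw [this, e_id_comp, MonoidalCategory.whiskerLeft_id]
    change (((ρ_ M).inv ≫ M ◁ eId V c) ≫ φc) ▷ (c ⟶[V] d) ≫ F.act c d = φd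
    rw [comp_whiskerRight, Category.assoc, ← h, ← Category.assoc, h2, Category.id_comp]
  right_inv f := by
    change ((ρ_ M).inv ≫ M ◁ eId V c) ≫ f ▷ (c ⟶[V] c) ≫ F.act c c = f
    rw [Category.assoc, whisker_exchange_assoc, ← rightUnitor_inv_naturality_assoc, F.act_id,
      Category.comp_id]

/-- The functor `V_C(c, -) ⊘ -` is left adjoint to evaluation at `c`. -/
def tensorReprAdj (c : C) : tensorRepr V c ⊣ ev V c :=
  Adjunction.mkOfHomEquiv
    { homEquiv := tensorReprEquiv c
      homEquiv_naturality_left_symm {M M' F} f g := by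
        ext d
        let g' : M' ⟶ F.obj c := g
        change (f ≫ g') ▷ (c ⟶[V] d) ≫ F.act c d = f ▷ (c ⟶[V] d) ≫ g' ▷ (c ⟶[V] d) ≫ F.act c d
        rw [comp_whiskerRight, Category.assoc]
      homEquiv_naturality_right f g := (Category.assoc _ _ _).symm }

end TensorAdjunction

/-! ### Enriched functors form a Grothendieck category -/

section Grothendieck

variable {V : Type u} [Category.{v} V] [Abelian V] [IsGrothendieckAbelian.{v} V]
  [MonoidalCategory V] [MonoidalClosed V] [SymmetricCategory V]
  {C : Type v} [EnrichedCategory V C]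

instance (J : Type v) [SmallCategory J] [IsFiltered J] :
    HasExactColimitsOfShape J (EnrFun V C) where
  preservesFiniteLimits := preservesFiniteLimits_of_ev _ fun c => by
    have : PreservesFiniteLimits ((Functor.whiskeringRight J (EnrFun V C) V).obj (ev V c)) :=
      ⟨fun K _ _ => inferInstance⟩
    have : PreservesFiniteLimits (colim (J := J) (C := V)) :=
      HasExactColimitsOfShape.preservesFiniteLimits
    have : PreservesFiniteLimits
        ((Functor.whiskeringRight J (EnrFun V C) V).obj (ev V c) ⋙ colim) :=
      comp_preservesFiniteLimits _ _
    exact preservesFiniteLimits_of_natIso (preservesColimitNatIso (ev V c)).symm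

instance : HasColimitsOfSize.{v, v} (EnrFun V C) := ⟨fun _ _ => inferInstance⟩

instance : HasLimitsOfSize.{v, v} (EnrFun V C) := ⟨fun _ _ => inferInstance⟩

instance : HasFilteredColimitsOfSize.{v, v} (EnrFun V C) := ⟨fun _ _ _ => inferInstance⟩

/-- Exactness of filtered colimits is pointwise. By Yoneda the tensors of the representables with a
separator of `V` are jointly separating, and smallness of `C` allows their coproduct. -/
instance : IsGrothendieckAbelian.{v} (EnrFun V C) where
  locallySmall := ⟨fun F G => inferInstanceAs (Small.{v} (F ⟶ G))⟩
  ab5OfSize := ⟨fun _ _ _ => inferInstance⟩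
  hasSeparator := by
    let G (c : C) : EnrFun V C := (tensorRepr V c).obj (separator V)
    have hG : IsSeparator (∐ G) := by
      rw [isSeparator_sigma]
      intro X Y f g h
      ext c
      refine (isSeparator_separator V).def _ _ fun x => ?_
      have h1 := h (G c) (ObjectProperty.ofObj_apply _ c) (tensorReprDesc c x)
      have h2 (k : X ⟶ Y) : tensorReprElement c (tensorReprDesc c x ≫ k) = x ≫ k.app c :=
        (Category.assoc _ _ _).symm.trans
          (congrArg (· ≫ k.app c) ((tensorReprEquiv c _ _).right_inv x))
      rw [← h2, ← h2, h1]
    exact ⟨_, hG⟩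

end Grothendieck

/-! ### Kan extensions along the inclusion and the Serre quotient -/

section KanExtension

variable {V : Type u} [Category.{v} V] [MonoidalCategory V] [MonoidalClosed V]
  {C : Type w} [EnrichedCategory V C] (A : Set C)

instance (J : Type w₁) [Category.{w₂} J] [HasLimitsOfShape J V] :
    PreservesLimitsOfShape J (restrict V A) where
  preservesLimit :=
    ⟨fun hs => ⟨isLimitOfEv _ fun a => isLimitOfPreserves (ev V (a : C)) hs⟩⟩

instance (J : Type w₁) [Category.{w₂} J] [HasColimitsOfShape J V]
    [∀ X : V, PreservesColimitsOfShape J (tensorRight X)] :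
    PreservesColimitsOfShape J (restrict V A) where
  preservesColimit :=
    ⟨fun hs => ⟨isColimitOfEv _ fun a => isColimitOfPreserves (ev V (a : C)) hs⟩⟩

lemma restrict_obj_act (F : EnrFun V C) (a b : A) :
    ((restrict V A).obj F).act a b = F.act a b := by
  change uncurry (𝟙 ((a : C) ⟶[V] (b : C)) ≫ F.map a b) = uncurry (F.map a b)
  rw [Category.id_comp]

/-- The restriction of `V_C(a, -) ⊘ M` is `V_A(a, -) ⊘ M`. -/
def restrictTensorRepr (a : A) (M : V) :
    (tensorRepr V a).obj M ⟶ (restrict V A).obj ((tensorRepr V (a : C)).obj M) :=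
  Hom.mk' (fun _ => 𝟙 _) (fun d e => by
    rw [restrict_obj_act, tensorRepr_act, tensorRepr_act]
    refine (Category.comp_id _).trans ((Category.id_comp _).symm.trans ?_)
    exact congrArg (· ≫ _) (id_whiskerRight _ _).symm)

instance (a : A) (M : V) : IsIso (restrictTensorRepr A a M) :=
  have (c : A) : IsIso ((restrictTensorRepr A a M).app c) := inferInstanceAs (IsIso (𝟙 _))
  isIso_of_app _

variable {A} in
/-- Any right adjoint of the restriction functor is fully faithful. -/
lemma isIso_counit_restrict {R : EnrFun V A ⥤ EnrFun V C} (adj : restrict V A ⊣ R) :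
    IsIso adj.counit := by
  have (G : EnrFun V A) : IsIso (adj.counit.app G) := by
    have (a : A) : IsIso ((adj.counit.app G).app a) := by
      rw [isIso_iff_yoneda_map_bijective]
      intro M
      -- Yoneda over `C`, the adjunction, `r(V_C(a, -) ⊘ M) ≅ V_A(a, -) ⊘ M` and Yoneda over `A`
      -- together identify morphisms from `M` to both values at `a`; `he` shows that the bijection
      -- is composition with the counit.
      let e : (M ⟶ (R.obj G).obj (a : C)) ≃ (M ⟶ G.obj a) :=
        (tensorReprEquiv (a : C) M (R.obj G)).symm.trans
          ((adj.homEquiv ((tensorRepr V (a : C)).obj M) G).symm.trans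
            (((asIso (restrictTensorRepr A a M)).homFromEquiv (Z := G)).symm.trans
              (tensorReprEquiv a M G)))
      have he (f : M ⟶ (R.obj G).obj (a : C)) : e f = f ≫ (adj.counit.app G).app a := by
        let φ : (tensorRepr V (a : C)).obj M ⟶ R.obj G := tensorReprDesc (a : C) f
        have h1 : (adj.homEquiv ((tensorRepr V (a : C)).obj M) G).symm φ =
            (restrict V A).map φ ≫ adj.counit.app G := adj.homEquiv_counit _ _ _
        have h2 : e f = tensorReprElement a (restrictTensorRepr A a M ≫
            (adj.homEquiv ((tensorRepr V (a : C)).obj M) G).symm φ) := rfl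
        have h3 : tensorReprElement (a : C) φ = f := (tensorReprEquiv (a : C) M _).right_inv f
        rw [h2, h1]
        refine Eq.trans ?_ (congrArg (· ≫ (adj.counit.app G).app a) h3)
        refine (congrArg (((ρ_ M).inv ≫ M ◁ eId V (a : C)) ≫ ·) (Category.id_comp _)).trans ?_
        exact (Category.assoc _ _ _).symm
      refine (?_ : (fun f => f ≫ (adj.counit.app G).app a) = e) ▸ e.bijective
      exact funext fun f => (he f).symm
    exact isIso_of_app _
  exact NatIso.isIso_of_isIso_app _

end KanExtension

section Adjoints

variable (V : Type u) [Category.{v} V] [Abelian V] [IsGrothendieckAbelian.{v} V]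
  [MonoidalCategory V] [MonoidalClosed V] [SymmetricCategory V]
  {C : Type v} [EnrichedCategory V C] (A : Set C)

instance : PreservesLimitsOfSize.{v, v} (restrict V A) := ⟨inferInstance⟩

instance : PreservesColimitsOfSize.{v, v} (restrict V A) := ⟨inferInstance⟩

/-- This and the next instance come from the special adjoint functor theorem, so no end or coend
formula for the Kan extensions is needed. -/
instance : (restrict V A).IsRightAdjoint :=
  isRightAdjoint_of_preservesLimits_of_isCoseparating.{v}
    (isCoseparator_coseparator (EnrFun V C)) _

instance : (restrict V A).IsLeftAdjoint :=
  isLeftAdjoint_of_preservesColimits_of_isSeparating.{v} (isSeparator_separator (EnrFun V C)) _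

/-- The left Kan extension functor. -/
noncomputable abbrev kanLeft : EnrFun V A ⥤ EnrFun V C := (restrict V A).leftAdjoint

/-- The right Kan extension functor. -/
noncomputable abbrev kanRight : EnrFun V A ⥤ EnrFun V C := (restrict V A).rightAdjoint

/-- The left Kan extension adjunction. -/
noncomputable def kanLeftAdj : kanLeft V A ⊣ restrict V A := Adjunction.ofIsRightAdjoint _

/-- The right Kan extension adjunction. -/
noncomputable def kanRightAdj : restrict V A ⊣ kanRight V A := Adjunction.ofIsLeftAdjoint _

instance : IsIso (kanRightAdj V A).counit := isIso_counit_restrict _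

instance : (kanRight V A).Full := (kanRightAdj V A).fullyFaithfulROfIsIsoCounit.full

instance : (kanRight V A).Faithful := (kanRightAdj V A).fullyFaithfulROfIsIsoCounit.faithful

/-- In an adjoint triple one outer functor is fully faithful if and only if the other is. -/
instance : IsIso (kanLeftAdj V A).unit :=
  (Adjunction.Triple.mk (kanLeftAdj V A) (kanRightAdj V A)).isIso_unit_iff_isIso_counit.2
    inferInstance

omit [IsGrothendieckAbelian.{v} V] in
lemma isZero_iff_ev (F : EnrFun V C) : IsZero F ↔ ∀ c, IsZero (F.obj c) := by
  refine ⟨fun h c => (ev V c).map_isZero h, fun h => ?_⟩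
  rw [IsZero.iff_id_eq_zero]
  ext c
  exact (h c).eq_of_src _ _

omit [IsGrothendieckAbelian.{v} V] in
lemma vanishing_eq_kernel : vanishing V A = (restrict V A).kernel := by
  ext F
  refine Iff.trans ?_ (isZero_iff_ev V ((restrict V A).obj F)).symm
  exact ⟨fun h a => h a a.2, fun h a ha => h ⟨a, ha⟩⟩

/-- `S_A` is the kernel of the exact functor `r`, so the morphisms to be inverted are those inverted
by `r`, and by adjunction those seen as bijections by all right Kan extensions. -/
lemma isoModSerre_vanishing_eq_isLocal : (vanishing V A).isoModSerre =
    ObjectProperty.isLocal (· ∈ Set.range (kanRight V A).obj) := by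
  -- A variable Serre class allows substitution along `vanishing_eq_kernel` together with the
  -- instance that depends on it.
  have (P : ObjectProperty (EnrFun V C)) [P.IsSerreClass] (hP : P = (restrict V A).kernel) :
      P.isoModSerre = ObjectProperty.isLocal (· ∈ Set.range (kanRight V A).obj) := by
    subst hP
    exact Abelian.isoModSerre_kernel_eq_isLocal_of_rightAdjoint (kanRightAdj V A)
  exact this _ (vanishing_eq_kernel V A)

instance : (restrict V A).IsLocalization (vanishing V A).isoModSerre := by
  rw [isoModSerre_vanishing_eq_isLocal]
  exact ObjectProperty.isLocalization_isLocal (kanRightAdj V A)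

/-- The Serre quotient is equivalent to the category of enriched functors on `A`. -/
noncomputable def serreEquivalence : SerreQuotient V A ≌ EnrFun V A :=
  Localization.uniq (localize V A) (restrict V A) (vanishing V A).isoModSerre

/-- The equivalence with the Serre quotient identifies restriction with localization. -/
noncomputable def restrictCompSerreEquivalence :
    restrict V A ⋙ (serreEquivalence V A).inverse ≅ localize V A :=
  Localization.compUniqInverse _ _ _

/-- The inclusion of the local objects. -/
noncomputable def localInclusion : SerreQuotient V A ⥤ EnrFun V C :=
  (serreEquivalence V A).functor ⋙ kanRight V A

/-- Localization is left adjoint to the inclusion of the local objects. -/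
noncomputable def localizeAdj : localize V A ⊣ localInclusion V A :=
  ((kanRightAdj V A).comp (serreEquivalence V A).symm.toAdjunction).ofNatIsoLeft
    (restrictCompSerreEquivalence V A)

instance : (localInclusion V A).Full := inferInstanceAs (_ ⋙ _).Full

instance : (localInclusion V A).Faithful := inferInstanceAs (_ ⋙ _).Faithful

instance : (localInclusion V A).Additive := (localizeAdj V A).right_adjoint_additive

instance : (kanLeft V A).Additive := (kanLeftAdj V A).left_adjoint_additive

instance : (kanRight V A).Additive := (kanRightAdj V A).right_adjoint_additive

/-- The composite `κ = ℓ ∘ r_L` is inverse to the equivalence with the Serre quotient. -/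
noncomputable def kanLeftCompLocalize :
    kanLeft V A ⋙ localize V A ≅ (serreEquivalence V A).inverse :=
  Functor.isoWhiskerLeft (kanLeft V A) (restrictCompSerreEquivalence V A).symm ≪≫
    (Functor.associator _ _ _).symm ≪≫
    Functor.isoWhiskerRight (asIso (kanLeftAdj V A).unit).symm _ ≪≫ Functor.leftUnitor _

instance : (kanLeft V A ⋙ localize V A).IsEquivalence :=
  Functor.isEquivalence_of_iso (kanLeftCompLocalize V A).symm

/-- Up to equivalence this is the essential image of the right Kan extension. Its objects are local;
conversely, for local `X` the unit at `X` is a local equivalence between local objects, hence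
invertible. -/
lemma essImage_localInclusion :
    (localInclusion V A).essImage = (vanishing V A).isoModSerre.isLocal := by
  have hW := congrArg MorphismProperty.isLocal (isoModSerre_vanishing_eq_isLocal V A)
  refine Eq.trans ?_ hW.symm
  have hR : (kanRight V A).essImage ≤
      (ObjectProperty.isLocal (· ∈ Set.range (kanRight V A).obj)).isLocal := by
    rintro X ⟨Y, ⟨e⟩⟩
    exact ObjectProperty.prop_of_iso _ e (ObjectProperty.le_isLocal_isLocal _ _ ⟨Y, rfl⟩)
  refine le_antisymm (fun X ⟨Y, ⟨e⟩⟩ => hR _ ⟨_, ⟨e⟩⟩) fun X hX => ?_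
  have : IsIso ((kanRightAdj V A).unit.app X) :=
    (ObjectProperty.isLocal_iff_isIso _ _ hX (hR _ ⟨_, ⟨Iso.refl _⟩⟩)).1
      (MorphismProperty.le_isLocal_isLocal _ _
        (ObjectProperty.isLocal_adj_unit_app (kanRightAdj V A) X))
  exact ⟨(serreEquivalence V A).inverse.obj ((restrict V A).obj X),
    ⟨(kanRight V A).mapIso ((serreEquivalence V A).counitIso.app _) ≪≫
      (asIso ((kanRightAdj V A).unit.app X)).symm⟩⟩

end Adjoints

end EnrFun

end EnrRec

namespace EnrRec

open CategoryTheory Limits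

/-! ### Adjunctions on complexes and on derived categories -/

section HomotopyAdjunction

variable {D : Type*} [Category* D] [Preadditive D] {E : Type*} [Category* E] [Preadditive E]
  {G : D ⥤ E} {F : E ⥤ D} [G.Additive] [F.Additive] (adj : G ⊣ F)
  {ι : Type*} (c : ComplexShape ι)

/-- An adjunction of additive functors, applied degreewise to complexes. -/
def mapComplexAdj : G.mapHomologicalComplex c ⊣ F.mapHomologicalComplex c :=
  Adjunction.mkOfUnitCounit
    { unit :=
        { app K := { f n := adj.unit.app (K.X n), comm' i j _ := (adj.unit.naturality (K.d i j)).symm }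
          naturality K L f := by ext n; exact adj.unit.naturality (f.f n) }
      counit :=
        { app K :=
            { f n := adj.counit.app (K.X n), comm' i j _ := (adj.counit.naturality (K.d i j)).symm }
          naturality K L f := by ext n; exact adj.counit.naturality (f.f n) }
      left_triangle := by
        ext K n
        exact (congrArg (_ ≫ ·) (Category.id_comp _)).trans (adj.left_triangle_components (K.X n))
      right_triangle := by
        ext K n
        exact (congrArg (_ ≫ ·) (Category.id_comp _)).trans (adj.right_triangle_components (K.X n)) }

/-- An adjunction of additive functors, applied degreewise in the homotopy categories. -/
def mapHomotopyAdj : G.mapHomotopyCategory c ⊣ F.mapHomotopyCategory c :=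
  Adjunction.mkOfUnitCounit
    { unit :=
        { app K := (HomotopyCategory.quotient D c).map ((mapComplexAdj adj c).unit.app K.as)
          naturality := by
            rintro ⟨K⟩ ⟨L⟩ f
            obtain ⟨f, rfl⟩ := (HomotopyCategory.quotient D c).map_surjective f
            exact congrArg (HomotopyCategory.quotient D c).map
              ((mapComplexAdj adj c).unit.naturality f) }
      counit :=
        { app K := (HomotopyCategory.quotient E c).map ((mapComplexAdj adj c).counit.app K.as)
          naturality := by
            rintro ⟨K⟩ ⟨L⟩ f
            obtain ⟨f, rfl⟩ := (HomotopyCategory.quotient E c).map_surjective f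
            exact congrArg (HomotopyCategory.quotient E c).map
              ((mapComplexAdj adj c).counit.naturality f) }
      left_triangle := by
        ext K
        refine (congrArg (_ ≫ ·) (Category.id_comp _)).trans ?_
        exact (congrArg (HomotopyCategory.quotient E c).map
          ((mapComplexAdj adj c).left_triangle_components K.as)).trans
            ((HomotopyCategory.quotient E c).map_id _)
      right_triangle := by
        ext K
        refine (congrArg (_ ≫ ·) (Category.id_comp _)).trans ?_
        exact (congrArg (HomotopyCategory.quotient D c).map
          ((mapComplexAdj adj c).right_triangle_components K.as)).trans
            ((HomotopyCategory.quotient D c).map_id _) }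

end HomotopyAdjunction

section KInjective

variable {D : Type*} [Category* D] [Abelian D] {E : Type*} [Category* E] [Abelian E]

lemma acyclic_map (G : D ⥤ E) [G.Additive] [PreservesFiniteLimits G] [PreservesFiniteColimits G]
    {K : CochainComplex D ℤ} (hK : K.Acyclic) :
    HomologicalComplex.Acyclic ((G.mapHomologicalComplex (ComplexShape.up ℤ)).obj K) :=
  fun n => (hK n).map G

/-- A morphism from an acyclic `K` to `F Y` is the transpose of one from `G K`, which is acyclic as
`G` is exact; the null-homotopy there is transposed back. -/
lemma isKInjective_map {G : D ⥤ E} {F : E ⥤ D} [G.Additive] [F.Additive]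
    [PreservesFiniteLimits G] [PreservesFiniteColimits G] (adj : G ⊣ F)
    (Y : CochainComplex E ℤ) [Y.IsKInjective] :
    CochainComplex.IsKInjective ((F.mapHomologicalComplex (ComplexShape.up ℤ)).obj Y) where
  nonempty_homotopy_zero {K} f hK := by
    obtain ⟨g, rfl⟩ := ((mapComplexAdj adj (ComplexShape.up ℤ)).homEquiv K Y).surjective f
    have h := CochainComplex.IsKInjective.homotopyZero g (acyclic_map G hK)
    rw [Adjunction.homEquiv_unit]
    exact ⟨((F.mapHomotopy h).compLeft ((mapComplexAdj adj _).unit.app K)).trans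
      (Homotopy.ofEq (by simp))⟩

lemma isKProjective_map {G : D ⥤ E} {F : E ⥤ D} [G.Additive] [F.Additive]
    [PreservesFiniteLimits F] [PreservesFiniteColimits F] (adj : G ⊣ F)
    (X : CochainComplex D ℤ) [X.IsKProjective] :
    CochainComplex.IsKProjective ((G.mapHomologicalComplex (ComplexShape.up ℤ)).obj X) where
  nonempty_homotopy_zero {K} f hK := by
    obtain ⟨g, rfl⟩ := ((mapComplexAdj adj (ComplexShape.up ℤ)).homEquiv X K).symm.surjective f
    have h := CochainComplex.IsKProjective.homotopyZero g (acyclic_map F hK)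
    rw [Adjunction.homEquiv_counit]
    exact ⟨((G.mapHomotopy h).compRight ((mapComplexAdj adj _).counit.app K)).trans
      (Homotopy.ofEq (by simp))⟩

variable [HasDerivedCategory.{w₁} D] [HasDerivedCategory.{w₂} E]

section DerivedAdjunction

variable {G : D ⥤ E} {F : E ⥤ D} [G.Additive] [F.Additive]
    [PreservesFiniteLimits G] [PreservesFiniteColimits G] (adj : G ⊣ F)
    (k : KInjectiveResolution E)

/-- The right derived functor of `F` along a choice of K-injective resolutions. -/
noncomputable abbrev rightDerived (F : E ⥤ D) [F.Additive] (k : KInjectiveResolution E) :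
    DerivedCategory E ⥤ DerivedCategory D :=
  k.k ⋙ F.mapHomotopyCategory (ComplexShape.up ℤ) ⋙ DerivedCategory.Qh

/-- The counit of the derived adjunction. -/
noncomputable def derivedCounit : rightDerived F k ⋙ G.mapDerivedCategory ⟶ 𝟭 _ :=
  { app Y := G.mapDerivedCategoryFactorsh.hom.app ((F.mapHomotopyCategory _).obj (k.k.obj Y)) ≫
      DerivedCategory.Qh.map ((mapHomotopyAdj adj _).counit.app (k.k.obj Y)) ≫ k.iso.inv.app Y
    naturality Y Y' f := by
      have h₁ := G.mapDerivedCategoryFactorsh.hom.naturality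
        ((F.mapHomotopyCategory _).map (k.k.map f))
      have h₂ := (mapHomotopyAdj adj (ComplexShape.up ℤ)).counit.naturality (k.k.map f)
      have h₃ := k.iso.inv.naturality f
      dsimp at h₁ h₂ h₃ ⊢
      rw [reassoc_of% h₁, Category.assoc, Category.assoc, ← h₃, ← Functor.map_comp_assoc, h₂,
        Functor.map_comp_assoc] }

/-- Both `kY` and `F kY` are K-injective, so on both sides morphisms in the derived category are
homotopy classes, and the map is the bijection of the homotopy-level adjunction up to isomorphisms.
-/
lemma derivedCounit_bijective (X : DerivedCategory D) (Y : DerivedCategory E) :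
    Function.Bijective (fun f : X ⟶ (rightDerived F k).obj Y =>
      G.mapDerivedCategory.map f ≫ (derivedCounit adj k).app Y) := by
  obtain ⟨X', ⟨e⟩⟩ : ∃ X' : HomotopyCategory D _, Nonempty (DerivedCategory.Qh.obj X' ≅ X) :=
    ⟨_, ⟨DerivedCategory.Qh.objObjPreimageIso X⟩⟩
  have : CochainComplex.IsKInjective (k.k.obj Y).as := k.isKInjective Y
  have h₁ : Function.Bijective (fun g : X' ⟶ (F.mapHomotopyCategory _).obj (k.k.obj Y) =>
      e.inv ≫ DerivedCategory.Qh.map g) :=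
    (Iso.homFromEquiv (Z := (rightDerived F k).obj Y) e).bijective.comp
      (have := isKInjective_map adj (k.k.obj Y).as
       CochainComplex.IsKInjective.Qh_map_bijective X'
        ((F.mapHomologicalComplex _).obj (k.k.obj Y).as))
  refine (Function.Bijective.of_comp_iff _ h₁).1 ?_
  have h₂ : Function.Bijective (fun g : (G.mapHomotopyCategory _).obj X' ⟶ k.k.obj Y =>
      DerivedCategory.Qh.map g) :=
    CochainComplex.IsKInjective.Qh_map_bijective _ (k.k.obj Y).as
  have h₃ := h₂.comp ((mapHomotopyAdj adj (ComplexShape.up ℤ)).homEquiv X' (k.k.obj Y)).symm.bijective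
  let α : DerivedCategory.Qh.obj ((G.mapHomotopyCategory _).obj X') ≅ G.mapDerivedCategory.obj X :=
    (G.mapDerivedCategoryFactorsh.app X').symm ≪≫ G.mapDerivedCategory.mapIso e
  let β : DerivedCategory.Qh.obj (k.k.obj Y) ≅ Y := k.iso.symm.app Y
  have h₄ := (Iso.homCongr α β).bijective.comp h₃
  convert! h₄ using 1
  ext g
  have := G.mapDerivedCategoryFactorsh.hom.naturality g
  dsimp [derivedCounit, Iso.homCongr, α, β] at this ⊢
  rw [Adjunction.homEquiv_counit]
  simp only [Functor.map_comp, Category.assoc, reassoc_of% this]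

/-- If `F` is right adjoint to an exact functor `G`, then the right derived functor of `F` is
right adjoint to the functor induced by `G` on the derived categories. -/
noncomputable def derivedAdj : G.mapDerivedCategory ⊣ rightDerived F k :=
  Adjunction.mkOfHomEquiv
    { homEquiv X Y := (Equiv.ofBijective _ (derivedCounit_bijective adj k X Y)).symm
      homEquiv_naturality_left_symm f g := by simp
      homEquiv_naturality_right {X Y Y'} f g := by
        rw [Equiv.symm_apply_eq]
        let E' := Equiv.ofBijective _ (derivedCounit_bijective adj k X Y)
        obtain ⟨f, rfl⟩ := E'.surjective f
        rw [Equiv.symm_apply_apply]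
        have h := (derivedCounit adj k).naturality g
        change (G.mapDerivedCategory.map f ≫ (derivedCounit adj k).app _) ≫ g =
          G.mapDerivedCategory.map (f ≫ (rightDerived F k).map g) ≫ (derivedCounit adj k).app _
        rw [Category.assoc, Functor.map_comp, Category.assoc]
        exact congrArg (_ ≫ ·) h.symm }

end DerivedAdjunction

end KInjective

end EnrRec

namespace EnrRec

open CategoryTheory Limits ZeroObject

/-! ### Functorial K-injective resolutions -/

section Resolution

variable {E : Type*} [Category* E] [Abelian E]

lemma Q_map_eq_zero_iff_of_isKInjective [HasDerivedCategory.{w₁} E] {X Y : CochainComplex E ℤ}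
    [Y.IsKInjective] (f : X ⟶ Y) : DerivedCategory.Q.map f = 0 ↔ Nonempty (Homotopy f 0) := by
  rw [← HomotopyCategory.quotient_map_eq_zero_iff]
  have h := DerivedCategory.quotientCompQhIso_hom_naturality f
  constructor
  · intro hf
    apply (CochainComplex.IsKInjective.Qh_map_bijective _ Y).injective
    rw [← cancel_mono ((DerivedCategory.quotientCompQhIso E).hom.app Y), h, hf, comp_zero,
      Functor.map_zero, zero_comp]
  · intro hf
    rw [hf, Functor.map_zero, zero_comp] at h
    rw [← cancel_epi ((DerivedCategory.quotientCompQhIso E).hom.app X), ← h, comp_zero]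

lemma Q_map_surjective_of_isKInjective [HasDerivedCategory.{w₁} E] (X Y : CochainComplex E ℤ)
    [Y.IsKInjective] : Function.Surjective
      (DerivedCategory.Q.map : (X ⟶ Y) → (DerivedCategory.Q.obj X ⟶ DerivedCategory.Q.obj Y)) := by
  intro f
  obtain ⟨g, hg⟩ := (CochainComplex.IsKInjective.Qh_map_bijective
    ((HomotopyCategory.quotient _ _).obj X) Y).surjective
      ((DerivedCategory.quotientCompQhIso E).hom.app X ≫ f ≫
        (DerivedCategory.quotientCompQhIso E).inv.app Y)
  obtain ⟨g, rfl⟩ := (HomotopyCategory.quotient _ _).map_surjective g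
  refine ⟨g, ?_⟩
  have h := DerivedCategory.quotientCompQhIso_hom_naturality g
  rw [hg] at h
  rw [← cancel_epi ((DerivedCategory.quotientCompQhIso E).hom.app X), ← h]
  simp

lemma Q_map_eq_zero_iff_of_isKProjective [HasDerivedCategory.{w₁} E] {X Y : CochainComplex E ℤ}
    [X.IsKProjective] (f : X ⟶ Y) : DerivedCategory.Q.map f = 0 ↔ Nonempty (Homotopy f 0) := by
  rw [← HomotopyCategory.quotient_map_eq_zero_iff]
  have h := DerivedCategory.quotientCompQhIso_hom_naturality f
  constructor
  · intro hf
    apply (CochainComplex.IsKProjective.Qh_map_bijective X _).injective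
    rw [← cancel_mono ((DerivedCategory.quotientCompQhIso E).hom.app Y), h, hf, comp_zero,
      Functor.map_zero, zero_comp]
  · intro hf
    rw [hf, Functor.map_zero, zero_comp] at h
    rw [← cancel_epi ((DerivedCategory.quotientCompQhIso E).hom.app X), ← h, comp_zero]

lemma Q_map_surjective_of_isKProjective [HasDerivedCategory.{w₁} E] (X Y : CochainComplex E ℤ)
    [X.IsKProjective] : Function.Surjective
      (DerivedCategory.Q.map : (X ⟶ Y) → (DerivedCategory.Q.obj X ⟶ DerivedCategory.Q.obj Y)) := by
  intro f
  obtain ⟨g, hg⟩ := (CochainComplex.IsKProjective.Qh_map_bijective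
    X ((HomotopyCategory.quotient _ _).obj Y)).surjective
      ((DerivedCategory.quotientCompQhIso E).hom.app X ≫ f ≫
        (DerivedCategory.quotientCompQhIso E).inv.app Y)
  obtain ⟨g, rfl⟩ := (HomotopyCategory.quotient _ _).map_surjective g
  refine ⟨g, ?_⟩
  have h := DerivedCategory.quotientCompQhIso_hom_naturality g
  rw [hg] at h
  rw [← cancel_epi ((DerivedCategory.quotientCompQhIso E).hom.app X), ← h]
  simp

variable (E) in
/-- Every complex is quasi-isomorphic to a K-injective one. -/
def HasKInjectiveResolutions : Prop :=
  ∀ X : CochainComplex E ℤ, ∃ (Y : CochainComplex E ℤ) (i : X ⟶ Y), QuasiIso i ∧ Y.IsKInjective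

lemma HasKInjectiveResolutions.exists_iso (hE : HasKInjectiveResolutions E)
    [HasDerivedCategory.{w₁} E] (X : DerivedCategory E) :
    ∃ Y : CochainComplex E ℤ, Y.IsKInjective ∧ Nonempty (DerivedCategory.Q.obj Y ≅ X) := by
  obtain ⟨Y, i, _, hY⟩ := hE (DerivedCategory.Q.objPreimage X)
  exact ⟨Y, hY, ⟨(asIso (DerivedCategory.Q.map i)).symm ≪≫ DerivedCategory.Q.objObjPreimageIso X⟩⟩

/-- Functorial K-injective resolutions. -/
noncomputable def HasKInjectiveResolutions.kInjectiveResolution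
    (hE : HasKInjectiveResolutions E) [HasDerivedCategory.{w₁} E] : KInjectiveResolution E :=
  -- Functoriality comes for free: `Qh` restricts to an equivalence on K-injective complexes, and
  -- `k` is a quasi-inverse.
  let P : ObjectProperty (HomotopyCategory E (ComplexShape.up ℤ)) :=
    fun K => CochainComplex.IsKInjective K.as
  let Φ := P.ι ⋙ DerivedCategory.Qh
  have hΦ (K L : P.FullSubcategory) : Function.Bijective (Φ.map : (K ⟶ L) → _) :=
    have : CochainComplex.IsKInjective L.obj.as := L.property
    (CochainComplex.IsKInjective.Qh_map_bijective K.obj L.obj.as).comp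
      (P.fullyFaithfulι.map_bijective K L)
  have : Φ.Full := ⟨fun {K L} => (hΦ K L).surjective⟩
  have : Φ.Faithful := ⟨fun {K L} => @(hΦ K L).injective⟩
  have : Φ.EssSurj := ⟨fun X => by
    obtain ⟨Y, hY, ⟨e⟩⟩ := hE.exists_iso X
    exact ⟨⟨(HomotopyCategory.quotient _ _).obj Y, hY⟩,
      ⟨(DerivedCategory.quotientCompQhIso E).app Y ≪≫ e⟩⟩⟩
  have : Φ.IsEquivalence := {}
  { k := Φ.inv ⋙ P.ι
    isKInjective Y := (Φ.inv.obj Y).property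
    iso := Φ.asEquivalence.counitIso.symm }

lemma hasKInjectiveResolutions {E : Type u} [Category.{v} E] [Abelian E]
    [IsGrothendieckAbelian.{v} E] : HasKInjectiveResolutions E := fun X =>
  have ⟨Y, i, hi, hY⟩ := exists_injectiveFibrant X
  ⟨Y, i, hi, hY.isKInjective⟩

/-- This moves resolutions from `[A, V]` to the Serre quotient. -/
lemma HasKInjectiveResolutions.of_equivalence {E' : Type*} [Category* E'] [Abelian E']
    (hE : HasKInjectiveResolutions E) (e : E' ≌ E) [e.functor.Additive] [e.inverse.Additive] :
    HasKInjectiveResolutions E' := fun X => by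
  obtain ⟨Y, i, hi, hY⟩ := hE ((e.functor.mapHomologicalComplex _).obj X)
  refine ⟨(e.inverse.mapHomologicalComplex _).obj Y,
    (mapComplexAdj e.toAdjunction _).homEquiv _ _ i, ?_, isKInjective_map e.toAdjunction Y⟩
  rw [Adjunction.homEquiv_unit]
  have : IsIso ((mapComplexAdj e.toAdjunction (ComplexShape.up ℤ)).unit.app X) := by
    have (n : ℤ) : IsIso (((mapComplexAdj e.toAdjunction (ComplexShape.up ℤ)).unit.app X).f n) :=
      inferInstanceAs (IsIso (e.unit.app (X.X n)))
    exact HomologicalComplex.Hom.isIso_of_components _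
  infer_instance

end Resolution

section Cofans

variable {T : Type*} [Category* T] {I : Type*}

/-- Colimit cofans transported along isomorphisms. -/
def isColimitCofanOfIso {X X' : I → T} (e : ∀ i, X i ≅ X' i) {c : Cofan X} (hc : IsColimit c)
    (c' : Cofan X') (e' : c.pt ≅ c'.pt) (h : ∀ i, (e i).hom ≫ c'.inj i = c.inj i ≫ e'.hom) :
    IsColimit c' :=
  Cofan.IsColimit.mk c' (fun t => e'.inv ≫ Cofan.IsColimit.desc hc (fun i => (e i).hom ≫ t.inj i))
    (fun t i => by
      rw [← cancel_epi (e i).hom, reassoc_of% h i, Iso.hom_inv_id_assoc]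
      exact Cofan.IsColimit.fac hc _ i)
    (fun t m hm => by
      rw [Iso.eq_inv_comp]
      refine Cofan.IsColimit.hom_ext hc _ _ fun i => ?_
      rw [← reassoc_of% h i, hm]
      exact (Cofan.IsColimit.fac hc (fun i => (e i).hom ≫ t.inj i) i).symm)

end Cofans

/-! ### Coproducts and size of derived categories -/

section Coproducts

variable {E : Type*} [Category.{v} E] [Abelian E] [HasDerivedCategory.{w₁} E]

lemma isZero_Q_obj_iff (K : CochainComplex E ℤ) :
    IsZero (DerivedCategory.Q.obj K) ↔ HomologicalComplex.Acyclic K := by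
  constructor
  · intro h n
    rw [HomologicalComplex.exactAt_iff_isZero_homology]
    exact ((DerivedCategory.homologyFunctor E n).map_isZero h).of_iso
      ((DerivedCategory.homologyFunctorFactors E n).app K).symm
  · intro h
    have : QuasiIso (0 : K ⟶ 0) := by
      have h₀ := HomologicalComplex.acyclic_of_isZero _ (isZero_zero (CochainComplex E ℤ))
      exact ⟨fun n => (quasiIsoAt_iff_exactAt' _ n (h₀ n)).2 (h n)⟩
    exact (DerivedCategory.Q.map_isZero (isZero_zero _)).of_iso
      (asIso (DerivedCategory.Q.map (0 : K ⟶ 0)))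

omit [HasDerivedCategory.{w₁} E] in
/-- A null-homotopic morphism lifts to the path object. -/
lemma exists_acyclic_lift (Y : CochainComplex E ℤ) : ∃ (P : CochainComplex E ℤ) (p : P ⟶ Y),
    HomologicalComplex.Acyclic P ∧ ∀ ⦃X : CochainComplex E ℤ⦄ (f : X ⟶ Y), Nonempty (Homotopy f 0) →
      ∃ g, g ≫ p = f := by
  refine ⟨CochainComplex.mappingCocone (𝟙 Y), CochainComplex.mappingCocone.fst _, ?_,
    fun X f ⟨h⟩ => ?_⟩
  · let := HasDerivedCategory.standard E
    rw [← isZero_Q_obj_iff]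
    refine (Functor.map_isZero (shiftFunctor (DerivedCategory E) (-1 : ℤ)) ?_).of_iso
      ((DerivedCategory.Q.commShiftIso (-1 : ℤ)).app (CochainComplex.mappingCone (𝟙 Y)))
    rw [IsZero.iff_id_eq_zero, ← DerivedCategory.Q.map_id, ← DerivedCategory.Q.map_zero]
    exact DerivedCategory.Q_map_eq_of_homotopy _
      (CochainComplex.mappingCone.homotopyToZeroOfId Y)
  · obtain ⟨z, hz⟩ := CochainComplex.HomComplex.Cochain.equivHomotopy f 0 h
    exact ⟨CochainComplex.mappingCocone.lift (𝟙 Y) f (-z) (by simp [hz]), by simp⟩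

/-- Coproducts of complexes are coproducts in the derived category. -/
noncomputable def HasKInjectiveResolutions.isColimitCofanQ (hE : HasKInjectiveResolutions E)
    {I : Type*} {X : I → CochainComplex E ℤ} (c : Cofan X) (hc : IsColimit c) :
    IsColimit (Cofan.mk (DerivedCategory.Q.obj c.pt) (fun i => DerivedCategory.Q.map (c.inj i))) :=
  have hdesc (Z : DerivedCategory E) (f : ∀ i, DerivedCategory.Q.obj (X i) ⟶ Z) :
      ∃ g : DerivedCategory.Q.obj c.pt ⟶ Z, ∀ i, DerivedCategory.Q.map (c.inj i) ≫ g = f i := by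
    obtain ⟨Y, hY, ⟨e⟩⟩ := hE.exists_iso Z
    choose g hg using fun i => Q_map_surjective_of_isKInjective (X i) Y (f i ≫ e.inv)
    refine ⟨DerivedCategory.Q.map (Cofan.IsColimit.desc hc g) ≫ e.hom, fun i => ?_⟩
    rw [← Category.assoc, ← Functor.map_comp, Cofan.IsColimit.fac, hg]
    simp
  have hext (Z : DerivedCategory E) (f : DerivedCategory.Q.obj c.pt ⟶ Z)
      (hf : ∀ i, DerivedCategory.Q.map (c.inj i) ≫ f = 0) : f = 0 := by
    obtain ⟨Y, hY, ⟨e⟩⟩ := hE.exists_iso Z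
    obtain ⟨g, hg⟩ := Q_map_surjective_of_isKInjective c.pt Y (f ≫ e.inv)
    -- Null-homotopies on the summands become chain maps to an acyclic complex, which glue by the
    -- universal property of the coproduct of complexes.
    obtain ⟨P, p, hP, hp⟩ := exists_acyclic_lift Y
    have h (i : I) : Nonempty (Homotopy (c.inj i ≫ g) 0) := by
      rw [← Q_map_eq_zero_iff_of_isKInjective, Functor.map_comp, hg, reassoc_of% hf i, zero_comp]
    choose l hl using fun i => hp _ (h i)
    have : Cofan.IsColimit.desc hc l ≫ p = g := Cofan.IsColimit.hom_ext hc _ _ fun i => by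
      rw [← Category.assoc, Cofan.IsColimit.fac, hl]
    rw [← cancel_mono e.inv, ← hg, ← this, zero_comp, Functor.map_comp,
      ((isZero_Q_obj_iff P).2 hP).eq_of_tgt (DerivedCategory.Q.map _) 0, zero_comp]
  Cofan.IsColimit.mk _ (fun t => (hdesc t.pt t.inj).choose) (fun t => (hdesc t.pt t.inj).choose_spec)
    (fun t m hm => by
      rw [← sub_eq_zero]
      refine hext _ _ fun i => ?_
      rw [Preadditive.comp_sub, (hdesc t.pt t.inj).choose_spec i, sub_eq_zero]
      exact hm i)

lemma HasKInjectiveResolutions.hasCoproducts (hE : HasKInjectiveResolutions E)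
    [HasCoproducts.{w} E] : HasCoproducts.{w} (DerivedCategory E) :=
  hasCoproducts_of_colimit_cofans
    (fun {I} Z => Cofan.mk
      (DerivedCategory.Q.obj (∐ fun i => DerivedCategory.Q.objPreimage (Z i)))
      (fun i => (DerivedCategory.Q.objObjPreimageIso (Z i)).inv ≫ DerivedCategory.Q.map
        (Sigma.ι (fun i => DerivedCategory.Q.objPreimage (Z i)) i)))
    (fun {I} Z => isColimitCofanOfIso (fun i => DerivedCategory.Q.objObjPreimageIso (Z i))
      (hE.isColimitCofanQ _ (coproductIsCoproduct _)) _ (Iso.refl _) (fun i => by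
        simp [Cofan.inj]))

lemma HasKInjectiveResolutions.preservesColimitsOfShape_mapDerivedCategory
    (hE : HasKInjectiveResolutions E) {E' : Type*} [Category* E'] [Abelian E']
    [HasDerivedCategory.{w₂} E'] (hE' : HasKInjectiveResolutions E') (Φ : E ⥤ E') [Φ.Additive]
    [PreservesFiniteLimits Φ] [PreservesFiniteColimits Φ] {I : Type w}
    [HasColimitsOfShape (Discrete I) E] [PreservesColimitsOfShape (Discrete I) Φ] :
    PreservesColimitsOfShape (Discrete I) Φ.mapDerivedCategory := by
  suffices ∀ Z : I → DerivedCategory E, PreservesColimit (Discrete.functor Z)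
      Φ.mapDerivedCategory from preservesColimitsOfShape_of_discrete _
  intro Z
  let X (i : I) := DerivedCategory.Q.objPreimage (Z i)
  let e (i : I) : DerivedCategory.Q.obj (X i) ≅ Z i := DerivedCategory.Q.objObjPreimageIso (Z i)
  have : PreservesColimit (Discrete.functor fun i => DerivedCategory.Q.obj (X i))
      Φ.mapDerivedCategory := by
    refine preservesColimit_of_preserves_colimit_cocone
      (hE.isColimitCofanQ _ (coproductIsCoproduct X)) ((isColimitMapCoconeCofanMkEquiv _ _ _).symm ?_)
    let Ψ := Φ.mapHomologicalComplex (ComplexShape.up ℤ)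
    have hΨ : IsColimit (Cofan.mk (Ψ.obj (∐ X)) (fun i => Ψ.map (Sigma.ι X i))) :=
      isColimitMapCoconeCofanMkEquiv _ _ _ (isColimitOfPreserves Ψ (coproductIsCoproduct X))
    exact isColimitCofanOfIso (fun i => (Φ.mapDerivedCategoryFactors.app (X i)).symm)
      (hE'.isColimitCofanQ _ hΨ) _ (Φ.mapDerivedCategoryFactors.app (∐ X)).symm
      (fun i => (Φ.mapDerivedCategoryFactors.inv.naturality (Sigma.ι X i)).symm)
  exact preservesColimit_of_iso_diagram _ (K₁ := Discrete.functor fun i =>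
    DerivedCategory.Q.obj (X i)) (K₂ := Discrete.functor Z) (Discrete.natIso fun i => e i.as)

lemma HasKInjectiveResolutions.locallySmall (hE : HasKInjectiveResolutions E) :
    LocallySmall.{v} (DerivedCategory E) where
  hom_small X Y := by
    obtain ⟨Y', hY, ⟨e⟩⟩ := hE.exists_iso Y
    let X' := DerivedCategory.Q.objPreimage X
    let e' := DerivedCategory.Q.objObjPreimageIso X
    have : Small.{v} (DerivedCategory.Q.obj X' ⟶ DerivedCategory.Q.obj Y') :=
      small_of_surjective (Q_map_surjective_of_isKInjective X' Y')
    exact small_map (Iso.homCongr e' e).symm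

end Coproducts

end EnrRec

namespace EnrRec

open CategoryTheory Limits Pretriangulated ZeroObject

section Exactness

variable {T : Type*} [Category* T] [HasZeroObject T] [Preadditive T] [HasShift T ℤ]
  [∀ n : ℤ, (shiftFunctor T n).Additive] [Pretriangulated T]
  {X Y Z : T} {f : X ⟶ Y} {g : Y ⟶ Z} {h : Z ⟶ X⟦(1 : ℤ)⟧} (hT : Triangle.mk f g h ∈ distTriang T)

include hT

lemma distTriang_comp₁₂ : f ≫ g = 0 := comp_distTriang_mor_zero₁₂ _ hT

lemma distTriang_comp₃₁ : h ≫ f⟦(1 : ℤ)⟧' = 0 := comp_distTriang_mor_zero₃₁ _ hT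

lemma exists_desc_of_comp_eq_zero {W : T} (u : Y ⟶ W) (hu : f ≫ u = 0) : ∃ v : Z ⟶ W, u = g ≫ v :=
  Triangle.yoneda_exact₂ _ hT u hu

lemma exists_lift_of_comp_eq_zero' {W : T} (u : W ⟶ Z) (hu : u ≫ h = 0) : ∃ v : W ⟶ Y, u = v ≫ g :=
  Triangle.coyoneda_exact₃ _ hT u hu

end Exactness

/-! ### Compact objects and telescopes -/

section Telescope

variable {T : Type*} [Category* T] [Preadditive T] {X : ℕ → T} (a : ∀ n, X n ⟶ X (n + 1))
  {c : Cofan (fun n : ULift.{v} ℕ => X n.down)} (hc : IsColimit c)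

/-- The coprojections of a countable coproduct. -/
def natInj (c : Cofan (fun n : ULift.{v} ℕ => X n.down)) (n : ℕ) : X n ⟶ c.pt := c.inj ⟨n⟩

include hc in
omit [Preadditive T] in
lemma exists_natDesc {Y : T} (f : ∀ n, X n ⟶ Y) : ∃ g : c.pt ⟶ Y, ∀ n, natInj c n ≫ g = f n :=
  ⟨Cofan.IsColimit.desc hc (fun n => f n.down), fun n =>
    Cofan.IsColimit.fac hc (fun n => f n.down) ⟨n⟩⟩

include hc in
omit [Preadditive T] in
lemma nat_hom_ext {Y : T} {f g : c.pt ⟶ Y} (h : ∀ n, natInj c n ≫ f = natInj c n ≫ g) : f = g :=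
  Cofan.IsColimit.hom_ext hc _ _ fun n => h n.down

include hc in
/-- A morphism from a compact object to a countable coproduct vanishes if it is killed by
`1 - shift`. -/
lemma eq_zero_of_comp_one_sub_shift {K : T} (hK : IsCompactObject.{v} K) (s : c.pt ⟶ c.pt)
    (hs : ∀ n, natInj c n ≫ s = natInj c n - a n ≫ natInj c (n + 1)) (y : K ⟶ c.pt)
    (hy : y ≫ s = 0) : y = 0 := by
  -- Write `y m` for the component `y ≫ π m`. The hypothesis says `y 0 = 0` and `y (m + 1) = y m ≫ a
  -- m`, so all components vanish; by compactness `y` is a finite sum determined by its components.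
  choose π hπ using fun m => exists_natDesc hc
    (fun n => if h : n = m then eqToHom (by rw [h]) else (0 : X n ⟶ X m))
  have hπ₁ (m : ℕ) : natInj c m ≫ π m = 𝟙 _ := by simp [hπ]
  have hπ₂ (m n : ℕ) (h : n ≠ m) : natInj c n ≫ π m = 0 := by simp [hπ, h]
  have hσ₀ : s ≫ π 0 = π 0 := nat_hom_ext hc fun n => by
    rw [← Category.assoc, hs, Preadditive.sub_comp, Category.assoc, hπ₂ 0 (n + 1) (by simp),
      comp_zero, sub_zero]
  have hσ (m : ℕ) : s ≫ π (m + 1) = π (m + 1) - π m ≫ a m := nat_hom_ext hc fun n => by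
    rw [← Category.assoc, hs, Preadditive.sub_comp, Category.assoc, Preadditive.comp_sub,
      ← Category.assoc _ (π m)]
    by_cases h : n = m
    · subst h; simp [hπ₁]
    · rw [hπ₂ m n h, hπ₂ (m + 1) (n + 1) (by simpa), comp_zero, zero_comp]
  have h₀ (m : ℕ) : y ≫ π m = 0 := by
    induction m with
    | zero => rw [← hσ₀, reassoc_of% hy, zero_comp]
    | succ m ih =>
      have := congrArg (y ≫ ·) (hσ m)
      simp only [reassoc_of% hy, zero_comp, Preadditive.comp_sub, reassoc_of% ih, sub_zero] at this
      exact this.symm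
  obtain ⟨t, g, hg⟩ := hK _ c hc y
  have hg' : y = ∑ i ∈ t, g i ≫ natInj c i.down := hg
  rw [hg']
  refine Finset.sum_eq_zero fun i hi => ?_
  have : g i = 0 := by
    rw [← h₀ i.down, hg', Preadditive.sum_comp, Finset.sum_eq_single i]
    · rw [Category.assoc, hπ₁, Category.comp_id]
    · intro j _ hj
      rw [Category.assoc, hπ₂ _ _ (fun h => hj (ULift.ext _ _ h)), comp_zero]
    · exact fun h => (h hi).elim
  rw [this, zero_comp]

include hc in
/-- A morphism from a compact object to a countable coproduct factors through a stage after
composition with a morphism that identifies the stages. -/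
lemma exists_fac_stage {K H : T} (hK : IsCompactObject.{v} K) (p : c.pt ⟶ H)
    (hp : ∀ n, natInj c n ≫ p = a n ≫ natInj c (n + 1) ≫ p) (y : K ⟶ c.pt) :
    ∃ (n : ℕ) (u : K ⟶ X n), y ≫ p = u ≫ natInj c n ≫ p := by
  have raise (n : ℕ) (u : K ⟶ X n) (k : ℕ) :
      ∃ u' : K ⟶ X (n + k), u ≫ natInj c n ≫ p = u' ≫ natInj c (n + k) ≫ p := by
    induction k with
    | zero => exact ⟨u, rfl⟩
    | succ k ih =>
      obtain ⟨u', hu'⟩ := ih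
      exact ⟨u' ≫ a (n + k), by rw [hu', hp (n + k), Category.assoc]; rfl⟩
  obtain ⟨t, g, hg⟩ := hK _ c hc y
  have hg' : y = ∑ i ∈ t, g i ≫ natInj c i.down := hg
  rw [hg', Preadditive.sum_comp]
  clear hg hg'
  induction t using Finset.induction_on with
  | empty => exact ⟨0, 0, by simp⟩
  | insert i t hi ih =>
    obtain ⟨n, u, hu⟩ := ih
    obtain ⟨u₁, h₁⟩ := raise n u i.down
    obtain ⟨u₂, h₂⟩ := raise i.down (g i) n
    obtain ⟨u₂', h₂'⟩ : ∃ u₂' : K ⟶ X (n + i.down),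
        u₂ ≫ natInj c (i.down + n) ≫ p = u₂' ≫ natInj c (n + i.down) ≫ p := by
      rw [Nat.add_comm n]
      exact ⟨u₂, rfl⟩
    refine ⟨n + i.down, u₂' + u₁, ?_⟩
    rw [Finset.sum_insert hi, hu, h₁, Category.assoc, h₂, h₂', Preadditive.add_comp]

end Telescope

/-! ### Bousfield localization at compact objects -/

section Bousfield

variable {T : Type*} [Category* T] [HasZeroObject T] [Preadditive T] [HasShift T ℤ]
  [∀ n : ℤ, (shiftFunctor T n).Additive] [Pretriangulated T] [HasCoproducts.{v} T]

/-- The homotopy colimit of a sequence of objects over `Y`. -/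
lemma exists_hocolim {L : ObjectProperty T} (hL : IsLocalizingSubcategory.{v} L)
    {Y : T} (X : ℕ → T) (hX : ∀ n, L (X n)) (a : ∀ n, X n ⟶ X (n + 1)) (f : ∀ n, X n ⟶ Y)
    (haf : ∀ n, a n ≫ f (n + 1) = f n) :
    ∃ (H : T) (_ : L H) (g : H ⟶ Y) (j : ∀ n, X n ⟶ H), (∀ n, j n ≫ g = f n) ∧
      (∀ n, j n = a n ≫ j (n + 1)) ∧
      ∀ (K : T), IsCompactObject.{v} K → ∀ y : K ⟶ H, ∃ (n : ℕ) (u : K ⟶ X n), y = u ≫ j n := by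
  let c : Cofan (fun n : ULift.{v} ℕ => X n.down) := Cofan.mk _ (Sigma.ι _)
  have hc : IsColimit c := coproductIsCoproduct _
  obtain ⟨s, hs⟩ := exists_natDesc hc (fun n => natInj c n - a n ≫ natInj c (n + 1))
  obtain ⟨F, hF⟩ := exists_natDesc hc f
  -- The homotopy colimit is the cone of `1 - shift`.
  obtain ⟨H, p, δ, hT⟩ := distinguished_cocone_triangle s
  have hsp : s ≫ p = 0 := distTriang_comp₁₂ hT
  obtain ⟨g, hg⟩ := exists_desc_of_comp_eq_zero hT F (nat_hom_ext hc fun n => by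
    rw [← Category.assoc, hs, Preadditive.sub_comp, hF, Category.assoc, hF, haf, sub_self,
      comp_zero])
  have hp (n : ℕ) : natInj c n ≫ p = a n ≫ natInj c (n + 1) ≫ p := by
    have := congrArg (natInj c n ≫ ·) hsp
    simpa only [comp_zero, reassoc_of% hs n, Preadditive.sub_comp, sub_eq_zero, Category.assoc]
      using this
  have := hL.isTriangulated
  have := hL.isClosedUnderIsomorphisms
  have hLc : L c.pt := hL.coproduct _ c hc fun n => hX n.down
  refine ⟨H, L.ext_of_isTriangulatedClosed₃ _ hT hLc hLc, g, fun n => natInj c n ≫ p,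
    fun n => ?_, hp, fun K hK y => ?_⟩
  · refine (Category.assoc _ _ _).trans ?_
    exact (congrArg (natInj c n ≫ ·) hg.symm).trans (hF n)
  -- The obstruction to lifting `y` to the coproduct is killed by the suspension of `1 - shift`,
  -- hence is zero as `K` is compact; the lift then comes from a finite stage.
  · have hy : y ≫ δ = 0 := by
      let c' : Cofan (fun n : ULift.{v} ℕ => (X n.down)⟦(1 : ℤ)⟧) :=
        Cofan.mk (c.pt⟦(1 : ℤ)⟧) (fun n => (c.inj n)⟦(1 : ℤ)⟧')
      have hc' : IsColimit c' := isColimitCofanMkObjOfIsColimit (shiftFunctor T (1 : ℤ)) _ _ hc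
      refine eq_zero_of_comp_one_sub_shift (c := c') (X := fun n => (X n)⟦(1 : ℤ)⟧)
        (fun n => (a n)⟦(1 : ℤ)⟧') hc' hK (s⟦(1 : ℤ)⟧') (fun n => ?_) (y ≫ δ) ?_
      · change (natInj c n)⟦(1 : ℤ)⟧' ≫ s⟦(1 : ℤ)⟧' =
          (natInj c n)⟦(1 : ℤ)⟧' - (a n)⟦(1 : ℤ)⟧' ≫ (natInj c (n + 1))⟦(1 : ℤ)⟧'
        rw [← Functor.map_comp, hs, Functor.map_sub, Functor.map_comp]
      · have : δ ≫ s⟦(1 : ℤ)⟧' = 0 := distTriang_comp₃₁ hT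
        rw [Category.assoc, this, comp_zero]
    obtain ⟨y', hy'⟩ := exists_lift_of_comp_eq_zero' hT y hy
    obtain ⟨n, u, hu⟩ := exists_fac_stage a hc hK p hp y'
    exact ⟨n, u, hy'.trans hu⟩

variable [LocallySmall.{v} T] {κ : Type v} {S : κ → T}

/-- Killing all morphisms from the objects `S k` to `X` that vanish in `Y`. -/
lemma exists_kill {L : ObjectProperty T} (hL : IsLocalizingSubcategory.{v} L) (hS : ∀ k, L (S k))
    {X Y : T} (hX : L X) (f : X ⟶ Y) :
    ∃ (X' : T) (_ : L X') (i : X ⟶ X') (f' : X' ⟶ Y), i ≫ f' = f ∧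
      ∀ (k : κ) (u : S k ⟶ X), u ≫ f = 0 → u ≫ i = 0 := by
  let I : Type v := Σ k, Shrink.{v} {u : S k ⟶ X // u ≫ f = 0}
  let c : Cofan (fun i : I => S i.1) := Cofan.mk _ (Sigma.ι _)
  have hc : IsColimit c := coproductIsCoproduct _
  let m (i : I) : S i.1 ⟶ X := ((equivShrink _).symm i.2).1
  let d := Cofan.IsColimit.desc hc m
  have hd (i : I) : c.inj i ≫ d = m i := Cofan.IsColimit.fac hc _ i
  obtain ⟨X', i, δ, hT⟩ := distinguished_cocone_triangle d
  obtain ⟨f', hf'⟩ := exists_desc_of_comp_eq_zero hT f (Cofan.IsColimit.hom_ext hc _ _ fun j => by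
    rw [← Category.assoc, hd, comp_zero]
    exact ((equivShrink _).symm j.2).2)
  have := hL.isTriangulated
  have := hL.isClosedUnderIsomorphisms
  refine ⟨X', L.ext_of_isTriangulatedClosed₃ _ hT (hL.coproduct _ c hc fun j => hS j.1) hX, i, f',
    hf'.symm, fun k u hu => ?_⟩
  have h₁ : m ⟨k, equivShrink _ ⟨u, hu⟩⟩ = u := by simp [m]
  have h₂ : d ≫ i = 0 := distTriang_comp₁₂ hT
  rw [← h₁, ← hd, Category.assoc, h₂, comp_zero]

/-- The Bousfield localization triangles for a family of compact objects closed under shifts. -/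
lemma exists_triangle_of_isCompactObject {L : ObjectProperty T}
    (hL : IsLocalizingSubcategory.{v} L) (hS : ∀ k, L (S k)) (hc : ∀ k, IsCompactObject.{v} (S k))
    (hshift : ∀ k (n : ℤ), ∃ k', Nonempty (S k' ≅ (S k)⟦n⟧)) (Y : T) :
    ∃ (X Z : T) (f : X ⟶ Y) (g : Y ⟶ Z) (h : Z ⟶ X⟦(1 : ℤ)⟧), Triangle.mk f g h ∈ distTriang T ∧
      L X ∧ ∀ (k : κ) (u : S k ⟶ Z), u = 0 := by
  have := hL.isTriangulated
  have := hL.isClosedUnderIsomorphisms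
  -- The killing step becomes an operation on objects of `L` over `Y`, so that it can be iterated.
  choose X' hX' i f' hif hi using fun (A : Σ X : {X : T // L X}, X.1 ⟶ Y) =>
    exists_kill hL hS A.1.2 A.2
  let I : Type v := Σ k, Shrink.{v} (S k ⟶ Y)
  let c : Cofan (fun i : I => S i.1) := Cofan.mk _ (Sigma.ι _)
  have hc₀ : IsColimit c := coproductIsCoproduct _
  let d := Cofan.IsColimit.desc hc₀ (fun i : I => (equivShrink _).symm i.2)
  have hd (i : I) : c.inj i ≫ d = (equivShrink _).symm i.2 := Cofan.IsColimit.fac hc₀ _ i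
  -- Starting with all morphisms from the `S k` to `Y` makes `Hom(S k, H) ⟶ Hom(S k, Y)` surjective.
  -- Iterated killing makes it injective: a morphism to `H` comes from a stage and dies at the next
  -- one.
  let A (n : ℕ) : Σ X : {X : T // L X}, X.1 ⟶ Y :=
    Nat.rec ⟨⟨c.pt, hL.coproduct _ c hc₀ fun j => hS j.1⟩, d⟩
      (fun _ B => ⟨⟨X' B, hX' B⟩, f' B⟩) n
  obtain ⟨H, hH, f, j, hj, hj', hstage⟩ := exists_hocolim hL (fun n => (A n).1.1)
    (fun n => (A n).1.2) (fun n => i (A n)) (fun n => (A n).2) (fun n => hif (A n))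
  have hsurj (k : κ) (u : S k ⟶ Y) : ∃ v, v ≫ f = u := by
    refine ⟨c.inj ⟨k, equivShrink _ u⟩ ≫ j 0, ?_⟩
    rw [Category.assoc, hj 0]
    exact (hd _).trans (by simp)
  have hinj (k : κ) (u : S k ⟶ H) (hu : u ≫ f = 0) : u = 0 := by
    obtain ⟨n, u', rfl⟩ := hstage _ (hc k) u
    rw [Category.assoc, hj] at hu
    have := hi (A n) k u' hu
    rw [hj', reassoc_of% this, zero_comp]
  obtain ⟨Z, g, h, hT⟩ := distinguished_cocone_triangle f
  refine ⟨H, Z, f, g, h, hT, hH, fun k u => ?_⟩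
  have hhf : h ≫ f⟦(1 : ℤ)⟧' = 0 := distTriang_comp₃₁ hT
  have hfg : f ≫ g = 0 := distTriang_comp₁₂ hT
  -- Desuspended, `u ≫ h` is a morphism from `(S k)⟦-1⟧` to `H` that vanishes in `Y`. Since the
  -- family is closed under shifts, `hinj` applies.
  have huh : u ≫ h = 0 := by
    obtain ⟨k', ⟨e⟩⟩ := hshift k (-1)
    let ε : (shiftFunctor T (1 : ℤ)).obj ((S k)⟦(-1 : ℤ)⟧) ≅ S k :=
      (shiftFunctorCompIsoId T (-1 : ℤ) 1 (by simp)).app (S k)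
    obtain ⟨t, ht⟩ := (shiftFunctor T (1 : ℤ)).map_surjective (ε.hom ≫ u ≫ h)
    have h₀ : t ≫ f = 0 := (shiftFunctor T (1 : ℤ)).map_injective (by
      rw [Functor.map_comp, ht, Category.assoc, Category.assoc, hhf, comp_zero, comp_zero,
        Functor.map_zero])
    have h₁ : t = 0 := by
      rw [← cancel_epi e.hom, comp_zero]
      exact hinj k' _ (by rw [Category.assoc, h₀, comp_zero])
    rw [← cancel_epi ε.hom, ← ht, h₁, Functor.map_zero, comp_zero]
  obtain ⟨v, hv⟩ := exists_lift_of_comp_eq_zero' hT u huh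
  obtain ⟨v', rfl⟩ := hsurj k v
  rw [hv, Category.assoc, hfg, comp_zero]

end Bousfield

end EnrRec

namespace EnrRec

open CategoryTheory Limits Pretriangulated ZeroObject

section FullSubcategories

variable {T : Type*} [Category* T] (E : ObjectProperty T)

lemma isRightAdjoint_ι (h : ∀ Y, ∃ (Z : T) (_ : E Z) (g : Y ⟶ Z), ∀ W, E W →
    Function.Bijective (fun u : Z ⟶ W => g ≫ u)) : E.ι.IsRightAdjoint := by
  choose Z hZ g hg using h
  let e (Y : T) (W : E.FullSubcategory) :
      ((⟨Z Y, hZ Y⟩ : E.FullSubcategory) ⟶ W) ≃ (Y ⟶ E.ι.obj W) :=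
    (E.fullyFaithfulι.homEquiv).trans (Equiv.ofBijective _ (hg Y W.obj W.property))
  exact (Adjunction.adjunctionOfEquivLeft e (fun Y W W' u v => by
    change g Y ≫ E.ι.map (v ≫ u) = (g Y ≫ E.ι.map v) ≫ E.ι.map u
    rw [Functor.map_comp, Category.assoc])).isRightAdjoint

lemma isLeftAdjoint_ι (h : ∀ Y, ∃ (Z : T) (_ : E Z) (g : Z ⟶ Y), ∀ W, E W →
    Function.Bijective (fun u : W ⟶ Z => u ≫ g)) : E.ι.IsLeftAdjoint := by
  choose Z hZ g hg using h
  let e (W : E.FullSubcategory) (Y : T) :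
      (E.ι.obj W ⟶ Y) ≃ (W ⟶ (⟨Z Y, hZ Y⟩ : E.FullSubcategory)) :=
    ((E.fullyFaithfulι.homEquiv).trans (Equiv.ofBijective _ (hg Y W.obj W.property))).symm
  exact (Adjunction.adjunctionOfEquivRight e (fun W' W Y u v => by
    rw [Equiv.symm_apply_eq]
    obtain ⟨v, rfl⟩ := (e W Y).symm.surjective v
    rw [Equiv.apply_symm_apply]
    change E.ι.map u ≫ E.ι.map v ≫ g Y = E.ι.map (u ≫ v) ≫ g Y
    rw [Functor.map_comp, Category.assoc])).isLeftAdjoint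

end FullSubcategories

/-! ### Recollements from orthogonality -/

section Triangulated

variable {T : Type*} [Category* T] [HasZeroObject T] [Preadditive T] [HasShift T ℤ]
  [∀ n : ℤ, (shiftFunctor T n).Additive] [Pretriangulated T]
  {U : Type*} [Category* U] [HasZeroObject U] [Preadditive U] [HasShift U ℤ]
  [∀ n : ℤ, (shiftFunctor U n).Additive] [Pretriangulated U]

lemma IsTriangulatedFunctor.leftAdjoint {F : T ⥤ U} {G : U ⥤ T} (adj : F ⊣ G)
    (hG : IsTriangulatedFunctor G) : IsTriangulatedFunctor F := by
  obtain ⟨_, _⟩ := hG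
  let _ := adj.leftAdjointCommShift ℤ
  have := adj.commShift_of_rightAdjoint ℤ
  exact ⟨_, adj.isTriangulated_leftAdjoint⟩

lemma IsTriangulatedFunctor.rightAdjoint {F : T ⥤ U} {G : U ⥤ T} (adj : F ⊣ G)
    (hF : IsTriangulatedFunctor F) : IsTriangulatedFunctor G := by
  obtain ⟨_, _⟩ := hF
  let _ := adj.rightAdjointCommShift ℤ
  have := adj.commShift_of_leftAdjoint ℤ
  exact ⟨_, adj.isTriangulated_rightAdjoint⟩

variable {E L : ObjectProperty T} [E.IsTriangulated] [E.IsClosedUnderIsomorphisms]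
  [L.IsTriangulated]
  {r : T ⥤ U} {rR : U ⥤ T} (adj : r ⊣ rR) [IsIso adj.counit]

section

variable (hE : ∀ X, E X ↔ IsZero (r.obj X)) (hLE : L ≤ E.leftOrthogonal)
  (hL : ∀ Y, ∃ (X Z : T) (f : X ⟶ Y) (g : Y ⟶ Z) (h : Z ⟶ X⟦(1 : ℤ)⟧),
    Triangle.mk f g h ∈ distTriang T ∧ L X ∧ E Z)

omit [HasZeroObject T] [∀ n : ℤ, (shiftFunctor T n).Additive] [Pretriangulated T]
  [HasZeroObject U] [∀ n : ℤ, (shiftFunctor U n).Additive] [Pretriangulated U] in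
omit [Preadditive T] [HasShift T ℤ] [Preadditive U] [HasShift U ℤ] in
lemma isIso_map_unit (Y : T) : IsIso (r.map (adj.unit.app Y)) := by
  have := adj.left_triangle_components Y
  have h : IsIso (r.map (adj.unit.app Y) ≫ adj.counit.app (r.obj Y)) := by
    rw [this]
    exact inferInstanceAs (IsIso (𝟙 (r.obj Y)))
  exact IsIso.of_isIso_comp_right _ (adj.counit.app (r.obj Y))

include hE in
omit [E.IsTriangulated] in
-- Both sides say that `r` kills the cone of `f`.
lemma trW_iff_isIso_map (hr : IsTriangulatedFunctor r) {X Y : T} (f : X ⟶ Y) :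
    E.trW f ↔ IsIso (r.map f) := by
  obtain ⟨_, _⟩ := hr
  obtain ⟨Z, g, h, hT⟩ := distinguished_cocone_triangle f
  refine (ObjectProperty.trW_iff_of_distinguished _ _ hT).trans ((hE Z).trans ?_)
  exact (r.mapTriangle.obj (Triangle.mk f g h)).isZero₃_iff_isIso₁ (r.map_distinguished _ hT)

include adj hE hLE in
omit [L.IsTriangulated] in
-- As `X` is left orthogonal to the kernel, `Hom(X, -)` inverts the unit `Y ⟶ rR r Y`, whose cone
-- lies in the kernel. So `Hom(X, Y) = Hom(X, rR r Y) = Hom(r X, r Y)`.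
lemma map_bijective_of_le_leftOrthogonal (hr : IsTriangulatedFunctor r) {X : T} (hX : L X) (Y : T) :
    Function.Bijective (r.map : (X ⟶ Y) → _) := by
  have h : E.trW.isColocal X := by
    rw [ObjectProperty.isColocal_trW]
    exact hLE _ hX
  rw [← (adj.homEquiv X (r.obj Y)).bijective.of_comp_iff' r.map]
  convert! h (adj.unit.app Y) ((trW_iff_isIso_map hE hr _).2 (isIso_map_unit adj Y)) using 1
  ext f
  simp [Adjunction.homEquiv_unit]

include adj hE hLE hL in
omit [L.IsTriangulated] in
-- For essential surjectivity, `M ≅ r rR M`, and `r` does not distinguish `rR M` from its part in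
-- `L`.
lemma isEquivalence_ι_comp (hr : IsTriangulatedFunctor r) : (L.ι ⋙ r).IsEquivalence := by
  have hΦ (X Y : L.FullSubcategory) : Function.Bijective ((L.ι ⋙ r).map : (X ⟶ Y) → _) :=
    (map_bijective_of_le_leftOrthogonal adj hE hLE hr X.property Y.obj).comp
      (L.fullyFaithfulι.map_bijective X Y)
  exact
    { full := ⟨fun {X Y} => (hΦ X Y).surjective⟩
      faithful := ⟨fun {X Y} => @(hΦ X Y).injective⟩
      essSurj := ⟨fun M => by
        obtain ⟨X, Z, f, g, h, hT, hX, hZ⟩ := hL (rR.obj M)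
        have : IsIso (r.map f) :=
          (trW_iff_isIso_map hE hr f).1 ((ObjectProperty.trW_iff_of_distinguished _ _ hT).2 hZ)
        exact ⟨⟨X, hX⟩, ⟨asIso (r.map f) ≪≫ asIso (adj.counit.app M)⟩⟩⟩ }

/-- The left adjoint of a localization functor `r`, given by an equivalence `L ⋙ r`. -/
noncomputable def leftAdjointOfIsEquivalence
    (hr : IsTriangulatedFunctor r) [(L.ι ⋙ r).IsEquivalence] : (L.ι ⋙ r).inv ⋙ L.ι ⊣ r :=
  let c (M : U) : M ≅ r.obj ((L.ι ⋙ r).inv.obj M).obj :=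
    (L.ι ⋙ r).asEquivalence.counitIso.symm.app M
  have hc {M' M : U} (f : M' ⟶ M) :
      (c M').hom ≫ r.map (L.ι.map ((L.ι ⋙ r).inv.map f)) = f ≫ (c M).hom :=
    ((L.ι ⋙ r).asEquivalence.counitIso.inv.naturality f).symm
  let e (M : U) (Y : T) : (((L.ι ⋙ r).inv.obj M).obj ⟶ Y) ≃ (M ⟶ r.obj Y) :=
    (Equiv.ofBijective _ (map_bijective_of_le_leftOrthogonal adj hE hLE hr
      ((L.ι ⋙ r).inv.obj M).property Y)).trans (c M).symm.homFromEquiv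
  have he (M : U) (Y : T) (f) : e M Y f = (c M).hom ≫ r.map f := rfl
  Adjunction.mkOfHomEquiv
    { homEquiv := e
      homEquiv_naturality_left_symm {M' M Y} f g := by
        obtain ⟨g, rfl⟩ := (e M Y).surjective g
        rw [Equiv.symm_apply_apply, Equiv.symm_apply_eq, he, he]
        change _ = (c M').hom ≫ r.map (L.ι.map ((L.ι ⋙ r).inv.map f) ≫ g)
        rw [Functor.map_comp, reassoc_of% hc f]
      homEquiv_naturality_right {M Y Y'} f g := by
        refine (he M Y' (f ≫ g)).trans ?_
        rw [he]
        exact (congrArg _ (r.map_comp _ _)).trans (Category.assoc _ _ _).symm }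

include hLE hL in
omit [E.IsTriangulated] [E.IsClosedUnderIsomorphisms] in
-- The vertex `Z` of the localization triangle is the reflection of `Y`: the objects of `E` receive
-- no nonzero morphisms from `L`.
lemma isRightAdjoint_kernel_ι : E.ι.IsRightAdjoint := by
  refine isRightAdjoint_ι E fun Y => ?_
  obtain ⟨X, Z, f, g, h, hT, hX, hZ⟩ := hL Y
  refine ⟨Z, hZ, g, fun W hW => ?_⟩
  have hW' : L.trW.isLocal W := by
    rw [ObjectProperty.isLocal_trW]
    exact fun X f hX => hLE _ hX f hW
  exact hW' g (ObjectProperty.trW.mk' L hT hX)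

include adj hE in
-- The coreflection of `Y` is the fibre of the unit `Y ⟶ rR r Y`: by adjunction, objects killed by
-- `r` have no nonzero morphisms to the image of `rR`.
lemma isLeftAdjoint_kernel_ι (hr : IsTriangulatedFunctor r) : E.ι.IsLeftAdjoint := by
  refine isLeftAdjoint_ι E fun Y => ?_
  obtain ⟨Z, f, h, hT, hZ⟩ := (ObjectProperty.trW_iff' _ _).1
    ((trW_iff_isIso_map hE hr _).2 (isIso_map_unit adj Y))
  refine ⟨Z, hZ, f, fun W hW => ?_⟩
  have hW' : E.rightOrthogonal.trW.isColocal W := by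
    rw [ObjectProperty.isColocal_trW]
    exact fun X f hX => hX f hW
  refine hW' f ((ObjectProperty.trW_iff_of_distinguished _ _ hT).2 fun X u hX => ?_)
  apply (adj.homEquiv _ _).symm.injective
  exact ((hE X).1 hX).eq_of_src _ _

/-- The recollement attached to a localization functor with a fully faithful right adjoint and
to a subcategory `L` left orthogonal to its kernel. -/
noncomputable def recollementOfLocalization (hr : IsTriangulatedFunctor r)
    [(L.ι ⋙ r).IsEquivalence] : Recollement E.ι r :=
  have := isRightAdjoint_kernel_ι hLE hL
  have := isLeftAdjoint_kernel_ι adj hE hr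
  have hι : IsTriangulatedFunctor E.ι := ⟨inferInstance, inferInstance⟩
  have adjL := leftAdjointOfIsEquivalence adj hE hLE hr
  { iL := E.ι.leftAdjoint
    iR := E.ι.rightAdjoint
    jL := (L.ι ⋙ r).inv ⋙ L.ι
    jR := rR
    adjiL := Adjunction.ofIsRightAdjoint _
    adjiR := Adjunction.ofIsLeftAdjoint _
    adjjL := adjL
    adjjR := adj
    triangulated_i := hι
    triangulated_j := hr
    triangulated_iL := hι.leftAdjoint (Adjunction.ofIsRightAdjoint _)
    triangulated_iR := hι.rightAdjoint (Adjunction.ofIsLeftAdjoint _)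
    triangulated_jL := hr.leftAdjoint adjL
    triangulated_jR := hr.rightAdjoint adj
    fullyFaithful_i := E.fullyFaithfulι
    fullyFaithful_jL := .ofFullyFaithful _
    fullyFaithful_jR := adj.fullyFaithfulROfIsIsoCounit
    essImage_eq_kernel X := by
      rw [← hE]
      exact ⟨fun ⟨Y, ⟨e⟩⟩ => E.prop_of_iso e Y.property, fun hX => ⟨⟨X, hX⟩, ⟨Iso.refl _⟩⟩⟩ }

end

variable {B : Type*} [Category* B] [HasZeroObject B] [Preadditive B] [HasShift B ℤ]
  [∀ n : ℤ, (shiftFunctor B n).Additive] [Pretriangulated B]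
  {U' : Type*} [Category* U'] [HasZeroObject U'] [Preadditive U'] [HasShift U' ℤ]
  [∀ n : ℤ, (shiftFunctor U' n).Additive] [Pretriangulated U']

/-- A recollement transported along an equivalence of the quotient. -/
noncomputable def Recollement.ofEquivalence {i : B ⥤ T} {j : T ⥤ U} (R : Recollement i j)
    (e : U' ≌ U) {j' : T ⥤ U'} (α : j ⋙ e.inverse ≅ j') (hj' : IsTriangulatedFunctor j')
    {jR : U' ⥤ T} (adj : j' ⊣ jR) : Recollement i j' :=
  have adjL : e.functor ⋙ R.jL ⊣ j' := (e.toAdjunction.comp R.adjjL).ofNatIsoRight α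
  have := R.fullyFaithful_jL.full
  have := R.fullyFaithful_jL.faithful
  { iL := R.iL
    iR := R.iR
    jL := e.functor ⋙ R.jL
    jR := jR
    adjiL := R.adjiL
    adjiR := R.adjiR
    adjjL := adjL
    adjjR := adj
    triangulated_i := R.triangulated_i
    triangulated_j := hj'
    triangulated_iL := R.triangulated_iL
    triangulated_iR := R.triangulated_iR
    triangulated_jL := hj'.leftAdjoint adjL
    triangulated_jR := hj'.rightAdjoint adj
    fullyFaithful_i := R.fullyFaithful_i
    fullyFaithful_jL := .ofFullyFaithful _
    fullyFaithful_jR := (Adjunction.Triple.mk adjL adj).fullyFaithfulEquiv (.ofFullyFaithful _)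
    essImage_eq_kernel X := by
      rw [R.essImage_eq_kernel]
      have h : IsZero (j'.obj X) ↔ IsZero (e.inverse.obj (j.obj X)) :=
        (α.app X).symm.isZero_iff
      rw [h]
      exact ⟨fun h => e.inverse.map_isZero h,
        fun h => (e.functor.map_isZero h).of_iso (e.counitIso.app _).symm⟩ }

end Triangulated

end EnrRec

namespace EnrRec

open CategoryTheory Limits Pretriangulated ZeroObject

/-! ### The tensor–evaluation adjunction in derived categories -/

section Transpose

variable {D : Type*} [Category* D] [Abelian D] {E : Type*} [Category* E] [Abelian E]
  [HasDerivedCategory.{w₁} D] [HasDerivedCategory.{w₂} E]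
  {G : D ⥤ E} {F : E ⥤ D} [G.Additive] [F.Additive] [PreservesFiniteLimits F]
  [PreservesFiniteColimits F] (adj : G ⊣ F)

variable (G) in
/-- The functor `G`, applied degreewise. -/
abbrev mapComplex : CochainComplex D ℤ ⥤ CochainComplex E ℤ :=
  G.mapHomologicalComplex (ComplexShape.up ℤ)

/-- The unit of an adjunction `G ⊣ F` with `F` exact, in the derived category. -/
noncomputable def derivedUnit (K : CochainComplex D ℤ) : DerivedCategory.Q.obj K ⟶
    F.mapDerivedCategory.obj (DerivedCategory.Q.obj ((mapComplex G).obj K)) :=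
  DerivedCategory.Q.map ((mapComplexAdj adj _).unit.app K) ≫
    F.mapDerivedCategoryFactors.inv.app ((mapComplex G).obj K)

lemma derivedUnit_comp_map_Q_map {K : CochainComplex D ℤ} {Y : CochainComplex E ℤ}
    (g : (mapComplex G).obj K ⟶ Y) :
    derivedUnit adj K ≫ F.mapDerivedCategory.map (DerivedCategory.Q.map g) =
      DerivedCategory.Q.map ((mapComplexAdj adj _).homEquiv K Y g) ≫
        F.mapDerivedCategoryFactors.inv.app Y := by
  have h := F.mapDerivedCategoryFactors.inv.naturality g
  rw [Adjunction.homEquiv_unit, Functor.map_comp, Category.assoc, derivedUnit, Category.assoc]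
  exact congrArg (_ ≫ ·) h.symm

/-- The complex `K` is a test object for the adjunction `G ⊣ F` if every object of the derived
category is represented by a complex `Y` such that `Hom(G K, Y)` and `Hom(K, F Y)` in the derived
categories are given by chain maps up to homotopy. -/
def IsTestComplex (_ : G ⊣ F) (K : CochainComplex D ℤ) : Prop :=
  ∀ Y : DerivedCategory E, ∃ Y' : CochainComplex E ℤ, Nonempty (DerivedCategory.Q.obj Y' ≅ Y) ∧
    Function.Surjective (DerivedCategory.Q.map : ((mapComplex G).obj K ⟶ Y') → _) ∧
    Function.Surjective (DerivedCategory.Q.map : (K ⟶ (mapComplex F).obj Y') → _) ∧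
    ∀ u : K ⟶ (mapComplex F).obj Y', DerivedCategory.Q.map u = 0 → Nonempty (Homotopy u 0)

variable {adj} in
-- Chain maps `G K ⟶ Y'` and `K ⟶ F Y'` correspond, and homotopies on the second side transpose to
-- the first. Representing morphisms by chain maps on either side gives both halves, without any
-- exactness of `G`.
lemma IsTestComplex.bijective {K : CochainComplex D ℤ} (hK : IsTestComplex adj K)
    (Y : DerivedCategory E) :
    Function.Bijective (fun f : DerivedCategory.Q.obj ((mapComplex G).obj K) ⟶ Y =>
      derivedUnit adj K ≫ F.mapDerivedCategory.map f) := by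
  obtain ⟨Y', ⟨e⟩, h₁, h₂, h₃⟩ := hK Y
  constructor
  · intro f f' hf
    rw [← sub_eq_zero]
    obtain ⟨g, hg⟩ := h₁ ((f - f') ≫ e.inv)
    have h : derivedUnit adj K ≫ F.mapDerivedCategory.map (DerivedCategory.Q.map g) = 0 := by
      have hf' : derivedUnit adj K ≫ F.mapDerivedCategory.map f =
        derivedUnit adj K ≫ F.mapDerivedCategory.map f' := hf
      rw [hg, Functor.map_comp, Functor.map_sub, Preadditive.sub_comp, Preadditive.comp_sub,
        reassoc_of% hf', sub_self]
    rw [derivedUnit_comp_map_Q_map] at h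
    have h' : DerivedCategory.Q.map ((mapComplexAdj adj _).homEquiv K Y' g) = 0 := by
      have := congrArg (· ≫ F.mapDerivedCategoryFactors.hom.app Y') h
      simpa only [Category.assoc, Iso.inv_hom_id_app, Functor.comp_obj, Category.comp_id, zero_comp]
        using! this
    obtain ⟨h⟩ := h₃ _ h'
    have hh : DerivedCategory.Q.map ((mapComplex G).map
        ((mapComplexAdj adj (ComplexShape.up ℤ)).homEquiv K Y' g)) =
        DerivedCategory.Q.map ((mapComplex G).map 0) :=
      DerivedCategory.Q_map_eq_of_homotopy _ (G.mapHomotopy h)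
    have hg' : DerivedCategory.Q.map g = 0 := by
      rw [← ((mapComplexAdj adj (ComplexShape.up ℤ)).homEquiv K Y').symm_apply_apply g,
        Adjunction.homEquiv_counit, Functor.map_comp, hh, Functor.map_zero, Functor.map_zero,
        zero_comp]
    rw [← cancel_mono e.inv, ← hg, hg', zero_comp]
  · intro v
    obtain ⟨u, hu⟩ := h₂ (v ≫ F.mapDerivedCategory.map e.inv ≫
      F.mapDerivedCategoryFactors.hom.app Y')
    obtain ⟨g, rfl⟩ := ((mapComplexAdj adj (ComplexShape.up ℤ)).homEquiv K Y').surjective u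
    refine ⟨DerivedCategory.Q.map g ≫ e.hom, ?_⟩
    have := derivedUnit_comp_map_Q_map adj g
    rw [hu] at this
    simp only [Functor.map_comp]
    rw [reassoc_of% this]
    simp only [Iso.hom_inv_id_app_assoc]
    rw [← Functor.map_comp, Iso.inv_hom_id, CategoryTheory.Functor.map_id, Category.comp_id]

/-- A left adjoint of an exact functor preserves K-projective complexes, so every representative of
`Y` will do. -/
lemma isTestComplex_of_isKProjective (K : CochainComplex D ℤ) [K.IsKProjective] :
    IsTestComplex adj K := fun Y =>
  have := isKProjective_map adj K
  ⟨DerivedCategory.Q.objPreimage Y, ⟨DerivedCategory.Q.objObjPreimageIso Y⟩,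
    Q_map_surjective_of_isKProjective ((mapComplex G).obj K) _,
    Q_map_surjective_of_isKProjective K _, fun u => (Q_map_eq_zero_iff_of_isKProjective u).1⟩

omit [PreservesFiniteLimits F] [PreservesFiniteColimits F] in
lemma isTestComplex_of_isKInjective (hE : HasKInjectiveResolutions E)
    (hF : ∀ (Y : CochainComplex E ℤ) [Y.IsKInjective],
      CochainComplex.IsKInjective ((mapComplex F).obj Y)) (K : CochainComplex D ℤ) :
    IsTestComplex adj K := fun Y => by
  obtain ⟨Y', _, ⟨e⟩⟩ := hE.exists_iso Y
  have := hF Y'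
  exact ⟨Y', ⟨e⟩, Q_map_surjective_of_isKInjective _ Y',
    Q_map_surjective_of_isKInjective K _, fun u => (Q_map_eq_zero_iff_of_isKInjective u).1⟩

end Transpose

/-! ### Test complexes from a model structure -/

section ModelCategory

open HomotopicalAlgebra

variable {D : Type*} [Category* D] [Abelian D] [HasDerivedCategory.{w₁} D]
  [ModelCategory (CochainComplex D ℤ)]

/-- In a roof `K ⟶ Z' ⟵ Z`, factor `Z ⟶ Z'` as a trivial cofibration followed by a fibration, which
is then trivial. The cofibrant `K` lifts along the fibration, and the cofibration has a retraction
because `Z` is fibrant; that retraction is its inverse in the derived category. -/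
lemma Q_map_surjective_of_isCofibrant (hW : weakEquivalences (CochainComplex D ℤ) =
    HomologicalComplex.quasiIso D (ComplexShape.up ℤ)) (K Z : CochainComplex D ℤ)
    [IsCofibrant K] [IsFibrant Z] : Function.Surjective (DerivedCategory.Q.map : (K ⟶ Z) → _) := by
  intro f
  obtain ⟨Z', g, s, hs₀, rfl⟩ := DerivedCategory.left_fac f
  have hs := (DerivedCategory.isIso_Q_map_iff_quasiIso _ s).1 hs₀
  have hs' : WeakEquivalence s := by
    rw [weakEquivalence_iff, hW]
    exact hs
  let fac := MorphismProperty.factorizationData (trivialCofibrations (CochainComplex D ℤ))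
    (fibrations (CochainComplex D ℤ)) s
  have : Cofibration fac.i := (cofibration_iff _).2 fac.hi.1
  have : WeakEquivalence fac.i := (weakEquivalence_iff _).2 fac.hi.2
  have : Fibration fac.p := (fibration_iff _).2 fac.hp
  have : WeakEquivalence fac.p := weakEquivalence_of_precomp_of_fac fac.fac
  have sq₁ : CommSq (initial.to fac.Z) (initial.to K) fac.p g := ⟨initial.hom_ext _ _⟩
  have sq₂ : CommSq (𝟙 Z) fac.i (terminal.from Z) (terminal.from fac.Z) := ⟨terminal.hom_ext _ _⟩
  have h₁ : sq₁.lift ≫ fac.p = g := sq₁.fac_right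
  have h₂ : fac.i ≫ sq₂.lift = 𝟙 Z := sq₂.fac_left
  have hi : QuasiIso fac.i := by
    have := mem_weakEquivalences fac.i
    rwa [hW] at this
  have hp : QuasiIso fac.p := by
    have := mem_weakEquivalences fac.p
    rwa [hW] at this
  refine ⟨sq₁.lift ≫ sq₂.lift, ?_⟩
  have h₃ : DerivedCategory.Q.map fac.i ≫ DerivedCategory.Q.map sq₂.lift = 𝟙 _ := by
    rw [← Functor.map_comp, h₂, CategoryTheory.Functor.map_id]
  have h₄ : DerivedCategory.Q.map sq₂.lift ≫ DerivedCategory.Q.map fac.i = 𝟙 _ := by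
    rw [← cancel_epi (DerivedCategory.Q.map fac.i), reassoc_of% h₃, Category.comp_id]
  have h₅ : DerivedCategory.Q.map g =
      DerivedCategory.Q.map sq₁.lift ≫ DerivedCategory.Q.map fac.p := by
    rw [← Functor.map_comp, h₁]
  have h₆ : DerivedCategory.Q.map s =
      DerivedCategory.Q.map fac.i ≫ DerivedCategory.Q.map fac.p := by
    rw [← Functor.map_comp, fac.fac]
  rw [IsIso.eq_comp_inv, h₅, h₆, Functor.map_comp, Category.assoc, reassoc_of% h₄]

/-- An injective fibrant representative serves both sides: it is K-injective, which settles
morphisms from `G K`, and its image under `F` is fibrant, which settles morphisms from `K`. -/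
lemma isTestComplex_of_isCofibrant {E : Type u} [Category.{v} E] [Abelian E]
    [IsGrothendieckAbelian.{v} E] [HasDerivedCategory.{w₂} E]
    {G : D ⥤ E} {F : E ⥤ D} [G.Additive] [F.Additive] (adj : G ⊣ F)
    (hW : weakEquivalences (CochainComplex D ℤ) =
      HomologicalComplex.quasiIso D (ComplexShape.up ℤ))
    (hF : ∀ Y : CochainComplex E ℤ, IsInjectiveFibrant Y → IsFibrant ((mapComplex F).obj Y))
    (K : CochainComplex D ℤ) [IsCofibrant K]
    (hK : ∀ (Z : CochainComplex D ℤ) [IsFibrant Z] (f : K ⟶ Z),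
      DerivedCategory.Q.map f = 0 → Nonempty (Homotopy f 0)) :
    IsTestComplex adj K := fun Y => by
  obtain ⟨Y', i, _, hY'⟩ := exists_injectiveFibrant (DerivedCategory.Q.objPreimage Y)
  have := hY'.isKInjective
  have := hF Y' hY'
  exact ⟨Y', ⟨(asIso (DerivedCategory.Q.map i)).symm ≪≫ DerivedCategory.Q.objObjPreimageIso Y⟩,
    Q_map_surjective_of_isKInjective _ Y', Q_map_surjective_of_isCofibrant hW K _, hK _⟩

end ModelCategory

/-! ### Compact objects and localizing subcategories -/

section Compact

variable {T : Type*} [Category* T] [HasZeroObject T] [Preadditive T] [HasShift T ℤ]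
  [∀ n : ℤ, (shiftFunctor T n).Additive] [Pretriangulated T]

omit [HasZeroObject T] [∀ n : ℤ, (shiftFunctor T n).Additive] [Pretriangulated T] in
omit [HasShift T ℤ] in
lemma IsCompactObject.of_iso {K K' : T} (hK : IsCompactObject.{v} K) (e : K ≅ K') :
    IsCompactObject.{v} K' := fun I X c hc f => by
  obtain ⟨s, g, hg⟩ := hK X c hc (e.hom ≫ f)
  refine ⟨s, fun i => e.inv ≫ g i, ?_⟩
  rw [← cancel_epi e.hom, hg, Preadditive.comp_sum]
  simp

omit [HasZeroObject T] [Pretriangulated T] in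
lemma IsCompactObject.shift {K : T} (hK : IsCompactObject.{v} K) (n : ℤ) :
    IsCompactObject.{v} (K⟦n⟧) := fun I X c hc f => by
  let adj : shiftFunctor T n ⊣ shiftFunctor T (-n) := (shiftEquiv T n).toAdjunction
  obtain ⟨s, g, hg⟩ := hK (fun i => (X i)⟦-n⟧) (Cofan.mk (c.pt⟦-n⟧) fun i => (c.inj i)⟦-n⟧')
    (isColimitCofanMkObjOfIsColimit (shiftFunctor T (-n)) _ _ hc) (adj.homEquiv _ _ f)
  refine ⟨s, fun i => (adj.homEquiv _ _).symm (g i), ?_⟩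
  rw [← (adj.homEquiv K c.pt).symm_apply_apply f, hg, Adjunction.homEquiv_counit,
    Functor.map_sum, Preadditive.sum_comp]
  refine Finset.sum_congr rfl fun i _ => ?_
  refine Eq.trans ?_ (congrArg (· ≫ c.inj i) (adj.homEquiv_counit (g := g i)).symm)
  rw [Functor.map_comp, Category.assoc, Category.assoc]
  exact congrArg (_ ≫ ·) (adj.counit.naturality (c.inj i))

omit [HasZeroObject T] [∀ n : ℤ, (shiftFunctor T n).Additive] [Pretriangulated T] in
lemma IsCompactGeneratingFamily.of_iso {J : Type*} {P P' : J → T}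
    (hP : IsCompactGeneratingFamily.{v} P) (e : ∀ j, P j ≅ P' j) :
    IsCompactGeneratingFamily.{v} P' where
  isCompact j := (hP.isCompact j).of_iso (e j)
  isZero_of X hX := hP.isZero_of X fun j n f => by
    rw [← cancel_epi (e j).inv, comp_zero]
    exact hX j n _

lemma isLocalizingSubcategory_localizingHull {K : Type*} (G : K → T) :
    IsLocalizingSubcategory.{v} (localizingHull.{v} G) where
  isTriangulated :=
    { exists_zero := ⟨0, isZero_zero _, fun P hP _ => by
        have := hP.isTriangulated
        have := hP.isClosedUnderIsomorphisms
        exact P.prop_zero⟩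
      isStableUnderShiftBy n := ⟨fun X hX P hP hG => by
        have := hP.isTriangulated
        exact P.le_shift n _ (hX P hP hG)⟩
      toIsTriangulatedClosed₂ := ⟨fun T' hT h₁ h₃ => by
        refine ObjectProperty.le_isoClosure _ _ fun P hP hG => ?_
        have := hP.isTriangulated
        have := hP.isClosedUnderIsomorphisms
        exact P.ext_of_isTriangulatedClosed₂ _ hT (h₁ P hP hG) (h₃ P hP hG)⟩ }
  isClosedUnderIsomorphisms := ⟨fun e hX P hP hG => by
    have := hP.isClosedUnderIsomorphisms
    exact P.prop_of_iso e (hX P hP hG)⟩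
  coproduct I X c hc hX P hP hG := hP.coproduct X c hc fun i => hX i P hP hG

lemma isLocalizingSubcategory_leftOrthogonal (E : ObjectProperty T) [E.IsTriangulated] :
    IsLocalizingSubcategory.{v} E.leftOrthogonal where
  isTriangulated := inferInstance
  isClosedUnderIsomorphisms := inferInstance
  coproduct I X c hc hX Y f hY := Cofan.IsColimit.hom_ext hc _ _ fun i => by
    exact (hX i (c.inj i ≫ f) hY).trans comp_zero.symm

end Compact

end EnrRec

namespace EnrRec

open CategoryTheory Limits Pretriangulated ZeroObject

namespace EnrFun

variable {V : Type u} [Category.{v} V] [Abelian V] [IsGrothendieckAbelian.{v} V]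
    [MonoidalCategory V] [MonoidalClosed V] [SymmetricCategory V]
    {C : Type v} [EnrichedCategory V C] {A : Set C}
    [HasDerivedCategory.{w₁} V] [HasDerivedCategory.{w₂} (EnrFun V C)]

/-! ### The kernel of derived restriction -/

section Acyclic

omit [HasDerivedCategory.{w₁} V] [HasDerivedCategory.{w₂} (EnrFun V C)] in
lemma acyclic_iff_ev (Y : CochainComplex (EnrFun V C) ℤ) : HomologicalComplex.Acyclic Y ↔
    ∀ c, HomologicalComplex.Acyclic ((mapComplex (ev V c)).obj Y) := by
  refine ⟨fun h c => acyclic_map (ev V c) h, fun h n => ?_⟩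
  have h' (c : C) : ((Y.sc n).map (ev V c)).Exact := h c n
  change (Y.sc n).Exact
  rw [ShortComplex.exact_iff_isZero_homology, isZero_iff_ev]
  intro c
  exact ((ShortComplex.exact_iff_isZero_homology _).1 (h' c)).of_iso
    ((Y.sc n).mapHomologyIso (ev V c)).symm

lemma isZero_iff_homology {E : Type*} [Category* E] [Abelian E] [HasDerivedCategory.{w₁} E]
    (X : DerivedCategory E) :
    IsZero X ↔ ∀ n, IsZero ((DerivedCategory.homologyFunctor E n).obj X) := by
  refine ⟨fun h n => Functor.map_isZero _ h, fun h => ?_⟩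
  let e := DerivedCategory.Q.objObjPreimageIso X
  refine IsZero.of_iso ?_ e.symm
  rw [isZero_Q_obj_iff]
  intro n
  rw [HomologicalComplex.exactAt_iff_isZero_homology]
  exact (h n).of_iso (((DerivedCategory.homologyFunctorFactors E n).app _).symm ≪≫
    (DerivedCategory.homologyFunctor E n).mapIso e)

lemma isZero_mapDerivedCategory_obj_Q_iff {E E' : Type*} [Category* E] [Abelian E]
    [HasDerivedCategory.{w₁} E] [Category* E'] [Abelian E'] [HasDerivedCategory.{w₂} E']
    (F : E ⥤ E') [F.Additive] [PreservesFiniteLimits F] [PreservesFiniteColimits F]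
    (X : CochainComplex E ℤ) :
    IsZero (F.mapDerivedCategory.obj (DerivedCategory.Q.obj X)) ↔
      HomologicalComplex.Acyclic ((mapComplex F).obj X) := by
  rw [← isZero_Q_obj_iff]
  exact (F.mapDerivedCategoryFactors.app X).isZero_iff

lemma acyclicOn_iff_isZero_ev (Y : DerivedCategory (EnrFun V C)) :
    acyclicOn V A Y ↔ ∀ a ∈ A, IsZero ((ev V a).mapDerivedCategory.obj Y) :=
  forall₂_congr fun a _ => (isZero_iff_homology ((ev V a).mapDerivedCategory.obj Y)).symm

lemma acyclicOn_iff_isZero_restrictDerived [HasDerivedCategory.{w₃} (EnrFun V A)]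
    (Y : DerivedCategory (EnrFun V C)) :
    acyclicOn V A Y ↔ IsZero ((restrictDerived V A).obj Y) := by
  let e := DerivedCategory.Q.objObjPreimageIso Y
  rw [← (acyclicOn V A).prop_iff_of_iso e, ← ((restrictDerived V A).mapIso e).isZero_iff,
    isZero_mapDerivedCategory_obj_Q_iff, acyclic_iff_ev, acyclicOn_iff_isZero_ev]
  simp only [isZero_mapDerivedCategory_obj_Q_iff]
  exact ⟨fun h a => h a.1 a.2, fun h a ha => h ⟨a, ha⟩⟩

end Acyclic

/-! ### The generators of `T_A`: compactness and orthogonality -/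

section Generators

variable {J : Type v} {P Q : J → CochainComplex V ℤ}

omit [IsGrothendieckAbelian.{v} V] [HasDerivedCategory.{w₂} (EnrFun V C)] in
lemma isCompactGeneratingFamily_of_testCondition
    (hP : IsCompactGeneratingFamily.{v} (fun j => DerivedCategory.Q.obj (P j)))
    (hQ : TestCondition V C P Q) :
    IsCompactGeneratingFamily.{v} (fun j => DerivedCategory.Q.obj (Q j)) := by
  obtain ⟨rfl, _⟩ | ⟨rfl, _⟩ | ⟨_, _, _, h⟩ := hQ
  · exact hP
  · exact hP
  · choose f hf using fun j => (h j).2.1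
    exact hP.of_iso fun j => (asIso (DerivedCategory.Q.map (f j))).symm

lemma isTestComplex_of_testCondition (hQ : TestCondition V C P Q) (c : C) (j : J) :
    IsTestComplex (tensorReprAdj (V := V) c) (Q j) := by
  obtain ⟨rfl, h⟩ | ⟨rfl, h⟩ | ⟨_, hW, hF, h⟩ := hQ
  · have := h j
    exact isTestComplex_of_isKProjective _ _
  · exact isTestComplex_of_isKInjective _ hasKInjectiveResolutions (fun Y _ => h Y c) _
  · have := (h j).1
    exact isTestComplex_of_isCofibrant _ hW (fun Y hY => hF Y hY c) _ (h j).2.2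

variable (hQ : ∀ (c : C) j, IsTestComplex (tensorReprAdj (V := V) c) (Q j))

include hQ in
-- Morphisms from the generator to `X` are morphisms from the compact `Q j` to `X(a)`, and derived
-- evaluation preserves coproducts.
lemma isCompactObject_generator (k : A × J)
    (hk : IsCompactObject.{v} (DerivedCategory.Q.obj (Q k.2))) :
    IsCompactObject.{v} (generator V A Q k) := fun I X c hc f => by
  have hb := (hQ k.1 k.2).bijective
  have : PreservesColimitsOfShape (Discrete I) (ev V (k.1 : C)).mapDerivedCategory :=
    hasKInjectiveResolutions.preservesColimitsOfShape_mapDerivedCategory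
      hasKInjectiveResolutions _
  let D := (ev V (k.1 : C)).mapDerivedCategory
  let u := derivedUnit (tensorReprAdj (V := V) (k.1 : C)) (Q k.2)
  have hc' : IsColimit (Cofan.mk c.pt c.inj) := by
    refine hc.ofIsoColimit (Cocone.ext (Iso.refl _) fun i => ?_)
    exact Category.comp_id _
  obtain ⟨s, g, hg⟩ := hk (fun i => D.obj (X i)) (Cofan.mk (D.obj c.pt) fun i => D.map (c.inj i))
    (isColimitCofanMkObjOfIsColimit D _ _ hc') (u ≫ D.map f)
  choose h hh using fun i => (hb (X i)).surjective (g i)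
  refine ⟨s, h, (hb c.pt).injective (hg.trans ?_)⟩
  change ∑ i ∈ s, g i ≫ D.map (c.inj i) = u ≫ D.map (∑ i ∈ s, h i ≫ c.inj i)
  rw [Functor.map_sum, Preadditive.comp_sum]
  refine Finset.sum_congr rfl fun i _ => ?_
  rw [← hh, D.map_comp]
  exact Category.assoc _ _ _

include hQ in
lemma generator_hom_eq_zero (k : A × J) (Y : DerivedCategory (EnrFun V C)) (hY : acyclicOn V A Y)
    (f : generator V A Q k ⟶ Y) : f = 0 :=
  ((hQ k.1 k.2).bijective Y).injective
    (((acyclicOn_iff_isZero_ev Y).1 hY k.1 k.1.2).eq_of_tgt _ _)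

include hQ in
-- The `Q j` detect whether `Y(a)` is zero, and a morphism from `Q j` to a shift of `Y(a)` is the
-- transpose of one from the generator to that shift of `Y`.
lemma acyclicOn_of_generator_hom_eq_zero
    (hG : IsCompactGeneratingFamily.{v} (fun j => DerivedCategory.Q.obj (Q j)))
    (Y : DerivedCategory (EnrFun V C))
    (hY : ∀ (k : A × J) (n : ℤ) (f : (generator V A Q k)⟦n⟧ ⟶ Y), f = 0) :
    acyclicOn V A Y := by
  rw [acyclicOn_iff_isZero_ev]
  refine fun a ha => hG.isZero_of _ fun j n f => ?_
  let e : (ev V a).mapDerivedCategory.obj (Y⟦n⟧) ≅ ((ev V a).mapDerivedCategory.obj Y)⟦n⟧ :=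
    ((ev V a).mapDerivedCategory.commShiftIso n).app Y
  obtain ⟨g, hg⟩ := ((hQ a j).bijective (Y⟦n⟧)).surjective (f ≫ e.inv)
  have hg₀ : g = 0 := by
    let adj := (shiftEquiv (DerivedCategory (EnrFun V C)) n).symm.toAdjunction
    apply (adj.homEquiv _ _).symm.injective
    exact (hY (⟨a, ha⟩, j) (-n) _).trans (hY (⟨a, ha⟩, j) (-n) _).symm
  have h₀ : derivedUnit (tensorReprAdj a) (Q j) ≫ (ev V a).mapDerivedCategory.map g =
    f ≫ e.inv := hg
  rw [← cancel_mono e.inv, zero_comp, ← h₀, hg₀, Functor.map_zero, comp_zero]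

instance : (generatedBy V A Q).IsTriangulated :=
  (isLocalizingSubcategory_localizingHull _).isTriangulated

include hQ in
-- The left orthogonal is localizing, so it is enough to check the generators.
lemma generatedBy_le_leftOrthogonal : generatedBy V A Q ≤ (acyclicOn V A).leftOrthogonal :=
  fun _ hX => hX _ (isLocalizingSubcategory_leftOrthogonal _)
    fun k Y f hY => generator_hom_eq_zero hQ k Y hY f

include hQ in
lemma exists_triangle_generatedBy
    (hG : IsCompactGeneratingFamily.{v} (fun j => DerivedCategory.Q.obj (Q j)))
    (Y : DerivedCategory (EnrFun V C)) :
    ∃ (X Z : DerivedCategory (EnrFun V C)) (f : X ⟶ Y) (g : Y ⟶ Z) (h : Z ⟶ X⟦(1 : ℤ)⟧),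
      Triangle.mk f g h ∈ distTriang _ ∧ generatedBy V A Q X ∧ acyclicOn V A Z := by
  have : HasCoproducts.{v} (DerivedCategory (EnrFun V C)) :=
    hasKInjectiveResolutions.hasCoproducts
  have : LocallySmall.{v} (DerivedCategory (EnrFun V C)) := hasKInjectiveResolutions.locallySmall
  -- All shifts are included, since the localization triangles need a family closed under shifts.
  let S (k : (A × J) × ℤ) := (generator V A Q k.1)⟦k.2⟧
  have hL : IsLocalizingSubcategory.{v} (generatedBy V A Q) :=
    isLocalizingSubcategory_localizingHull _
  obtain ⟨X, Z, f, g, h, hT, hX, hZ⟩ := exists_triangle_of_isCompactObject hL (S := S)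
    (fun k => (generatedBy V A Q).le_shift k.2 _ fun P _ hP => hP k.1)
    (fun k => (isCompactObject_generator hQ k.1 (hG.isCompact k.1.2)).shift k.2)
    (fun k n => ⟨(k.1, k.2 + n), ⟨(shiftFunctorAdd _ k.2 n).app _⟩⟩) Y
  exact ⟨X, Z, f, g, h, hT, hX,
    acyclicOn_of_generator_hom_eq_zero hQ hG Z fun k n u => hZ (k, n) u⟩

end Generators

end EnrFun

end EnrRec

namespace EnrRec

open CategoryTheory Limits Pretriangulated ZeroObject

/-! ### Derived equivalences and assembly of the recollements -/

section DerivedFunctors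

variable {E₁ : Type*} [Category* E₁] [Abelian E₁] [HasDerivedCategory.{w₁} E₁]
  {E₂ : Type*} [Category* E₂] [Abelian E₂] [HasDerivedCategory.{w₂} E₂]
  {E₃ : Type*} [Category* E₃] [Abelian E₃] [HasDerivedCategory.{w₃} E₃]

/-- The functors induced on derived categories are compatible with composition. -/
noncomputable def mapDerivedCategoryComp {F : E₁ ⥤ E₂} {G : E₂ ⥤ E₃} {H : E₁ ⥤ E₃}
    [F.Additive] [G.Additive] [H.Additive]
    [PreservesFiniteLimits F] [PreservesFiniteColimits F]
    [PreservesFiniteLimits G] [PreservesFiniteColimits G]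
    [PreservesFiniteLimits H] [PreservesFiniteColimits H] (α : F ⋙ G ≅ H) :
    F.mapDerivedCategory ⋙ G.mapDerivedCategory ≅ H.mapDerivedCategory :=
  letI : Localization.Lifting DerivedCategory.Q
      (HomologicalComplex.quasiIso E₁ (ComplexShape.up ℤ))
      (mapComplex F ⋙ mapComplex G ⋙ DerivedCategory.Q)
      (F.mapDerivedCategory ⋙ G.mapDerivedCategory) :=
    ⟨Functor.isoWhiskerRight F.mapDerivedCategoryFactors G.mapDerivedCategory ≪≫
      Functor.isoWhiskerLeft (mapComplex F) G.mapDerivedCategoryFactors⟩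
  Localization.liftNatIso DerivedCategory.Q (HomologicalComplex.quasiIso E₁ (ComplexShape.up ℤ))
    (mapComplex F ⋙ mapComplex G ⋙ DerivedCategory.Q) (mapComplex H ⋙ DerivedCategory.Q) _ _
    (Functor.isoWhiskerRight
      (NatIso.mapHomologicalComplex α (ComplexShape.up ℤ) : mapComplex (F ⋙ G) ≅ mapComplex H)
      DerivedCategory.Q)

/-- The identity functor induces the identity functor of the derived category. -/
noncomputable def mapDerivedCategoryId : (𝟭 E₁).mapDerivedCategory ≅ 𝟭 (DerivedCategory E₁) :=
  Localization.liftNatIso DerivedCategory.Q (HomologicalComplex.quasiIso E₁ (ComplexShape.up ℤ))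
    (mapComplex (𝟭 E₁) ⋙ DerivedCategory.Q) DerivedCategory.Q _ _ (Iso.refl _)

/-- An equivalence of abelian categories induces an equivalence of derived categories. -/
noncomputable def mapDerivedEquivalence (e : E₁ ≌ E₂) [e.functor.Additive] [e.inverse.Additive] :
    DerivedCategory E₁ ≌ DerivedCategory E₂ :=
  .mk e.functor.mapDerivedCategory e.inverse.mapDerivedCategory
    (mapDerivedCategoryId.symm ≪≫ (mapDerivedCategoryComp e.unitIso.symm).symm)
    (mapDerivedCategoryComp e.counitIso ≪≫ mapDerivedCategoryId)

/-- No further resolution enters the counit at `Y`: up to isomorphisms it is the original counit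
applied degreewise to `kY`. -/
lemma isIso_derivedAdj_counit {G : E₁ ⥤ E₂} {F : E₂ ⥤ E₁} [G.Additive] [F.Additive]
    [PreservesFiniteLimits G] [PreservesFiniteColimits G] (adj : G ⊣ F) [IsIso adj.counit]
    (k : KInjectiveResolution E₂) : IsIso (derivedAdj adj k).counit := by
  have (Y : DerivedCategory E₂) : IsIso ((derivedAdj adj k).counit.app Y) := by
    have h : (derivedAdj adj k).counit.app Y = (derivedCounit adj k).app Y := by
      refine (congrArg (· ≫ (derivedCounit adj k).app Y)
        (G.mapDerivedCategory.map_id _)).trans (Category.id_comp _)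
    rw [h]
    have : IsIso ((mapComplexAdj adj (ComplexShape.up ℤ)).counit.app (k.k.obj Y).as) := by
      have (n : ℤ) : IsIso (((mapComplexAdj adj (ComplexShape.up ℤ)).counit.app
          (k.k.obj Y).as).f n) :=
        inferInstanceAs (IsIso (adj.counit.app _))
      exact HomologicalComplex.Hom.isIso_of_components _
    have : IsIso ((mapHomotopyAdj adj (ComplexShape.up ℤ)).counit.app (k.k.obj Y)) :=
      inferInstanceAs (IsIso ((HomotopyCategory.quotient E₂ _).map
        ((mapComplexAdj adj (ComplexShape.up ℤ)).counit.app (k.k.obj Y).as)))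
    exact inferInstanceAs (IsIso (_ ≫ DerivedCategory.Qh.map _ ≫ _))
  exact NatIso.isIso_of_isIso_app _

end DerivedFunctors

end EnrRec

theorem theorem4p12 {V : Type u} [Category.{v} V] [Abelian V] [IsGrothendieckAbelian.{v} V]
    [MonoidalCategory V] [MonoidalClosed V] [SymmetricCategory V]
    {C : Type v} [EnrichedCategory V C] (A : Set C)
    [HasDerivedCategory.{w₁} V] [HasDerivedCategory.{w₂} (EnrFun V C)]
    [HasDerivedCategory.{w₃} (EnrFun V A)] [HasDerivedCategory.{w₄} (SerreQuotient V A)]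
    {J : Type v} (P Q : J → CochainComplex V ℤ)
    (hP : IsCompactGeneratingFamily.{v} (fun j => DerivedCategory.Q.obj (P j)))
    (hQ : TestCondition V C P Q) :
    ∃ (rL : EnrFun V A ⥤ EnrFun V C) (_ : rL ⊣ restrict V A)
      (ℓR : SerreQuotient V A ⥤ EnrFun V C) (_ : localize V A ⊣ ℓR) (_ : ℓR.Additive)
      (_ : (rL ⋙ localize V A).IsEquivalence) (_ : (comparison V A Q).IsEquivalence)
      (R₁ : Recollement (acyclicOn V A).ι (restrictDerived V A))
      (R₂ : Recollement (acyclicOn V A).ι (localizeDerived V A)),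
      ℓR.Full ∧ ℓR.Faithful ∧ ℓR.essImage = (vanishing V A).isoModSerre.isLocal ∧
      R₂.iL = R₁.iL ∧ R₂.iR = R₁.iR ∧
      Nonempty (R₁.jL ≅ (comparison V A Q).inv ⋙ (generatedBy V A Q).ι) ∧
      Nonempty (R₂.jL ≅ mapDerivedOfEquivalence (rL ⋙ localize V A).inv ⋙ R₁.jL) ∧
      Nonempty (KInjectiveResolution (SerreQuotient V A)) ∧
      ∀ k : KInjectiveResolution (SerreQuotient V A),
        Nonempty (R₂.jR ≅
          k.k ⋙ ℓR.mapHomotopyCategory (ComplexShape.up ℤ) ⋙ DerivedCategory.Qh) := by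
  have hQ' (c : C) (j : J) := isTestComplex_of_testCondition hQ c j
  have hG := isCompactGeneratingFamily_of_testCondition hP hQ
  have hL := exists_triangle_generatedBy (A := A) hQ' hG
  have hE (Y) := acyclicOn_iff_isZero_restrictDerived (V := V) (A := A) Y
  have hr : IsTriangulatedFunctor (restrictDerived V A) := ⟨inferInstance, inferInstance⟩
  have hl : IsTriangulatedFunctor (localizeDerived V A) := ⟨inferInstance, inferInstance⟩
  let adj := derivedAdj (kanRightAdj V A)
    (hasKInjectiveResolutions (E := EnrFun V A)).kInjectiveResolution
  have : IsIso adj.counit := isIso_derivedAdj_counit _ _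
  have hF : (comparison V A Q).IsEquivalence :=
    isEquivalence_ι_comp adj hE (generatedBy_le_leftOrthogonal hQ') hL hr
  let R₁ := recollementOfLocalization adj hE (generatedBy_le_leftOrthogonal hQ') hL hr
  let κ := (kanLeft V A ⋙ localize V A).asEquivalence
  have : κ.functor.Additive := inferInstanceAs (kanLeft V A ⋙ localize V A).Additive
  have : κ.inverse.Additive := κ.inverse_additive
  let e := (mapDerivedEquivalence κ).symm
  -- Since the unit of `r_L ⊣ r` is invertible, `r` followed by `ϰ` is `ℓ`; on derived categories,
  -- `ρ` followed by `D(ϰ)` is `λ`.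
  let α : restrictDerived V A ⋙ e.inverse ≅ localizeDerived V A :=
    mapDerivedCategoryComp (Functor.isoWhiskerLeft _ (kanLeftCompLocalize V A) ≪≫
      restrictCompSerreEquivalence V A)
  have : (serreEquivalence V A).symm.functor.Additive :=
    Functor.additive_of_iso (kanLeftCompLocalize V A)
  have : (serreEquivalence V A).inverse.Additive := this
  have : (serreEquivalence V A).functor.Additive := (serreEquivalence V A).symm.inverse_additive
  let k₀ := (hasKInjectiveResolutions.of_equivalence (serreEquivalence V A)).kInjectiveResolution
  let R₂ := R₁.ofEquivalence e α hl (derivedAdj (localizeAdj V A) k₀)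
  -- Both formulas for the left adjoints hold by construction of `R₁` and `R₂`. Any choice of
  -- resolutions gives a right adjoint of `λ`, so the last claim is uniqueness of adjoints.
  exact ⟨kanLeft V A, kanLeftAdj V A, localInclusion V A, localizeAdj V A, inferInstance,
    inferInstance, hF, R₁, R₂, inferInstance, inferInstance, essImage_localInclusion V A, rfl, rfl,
    ⟨Iso.refl _⟩, ⟨Iso.refl _⟩, ⟨k₀⟩,
    fun k => ⟨R₂.adjjR.rightAdjointUniq (derivedAdj (localizeAdj V A) k)⟩⟩
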